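/- Let $d\ge 1$, let $|\cdot|$ be the Euclidean norm on $\mathbb R^d$, and let $U(x,r):=\{y\in\mathbb R^d: |x-y|<r\}$. Let $\mathfrak X=(X_t)_{t\ge 0}$ be a Lévy process on $\mathbb R^d$ (independent and stationary increments, right continuous paths with left limits almost surely; under $\mathbb P^x$ it starts at $x$). For every open $U\subset\mathbb R^d$ let $\tau_U:=\inf\{t\ge 0: X_t\notin U\}$, and let $\mu_x^U$ be the exit distribution $$\mu_x^U(E):=\mathbb P^x[\tau_U<\infty,\ X_{\tau_U}\in E],\qquad E\subset\mathbb R^d \text{ Borel},\ x\in\mathbb R^d.$$ For closed $A$ let $\varepsilon_x^A:=\mu_x^{\mathbb R^d\setminus A}$, and let $\|\mu\|$ denote the total mass of a measure $\mu$. For an open set $U$, let $\mathcal H(U)$ be the set of all universally measurable functions $h:\mathbb R^d\to\mathbb R$ which are harmonic on $U$, that is, such that for every open $V$ with $\overline V\subset U$ and every $x\in V$, $h$ is $\mu_x^V$-integrable and $\int h\,d\mu_x^V=h(x)$. Let $\mathcal H^+(U)$ and $\mathcal H_b(U)$ be the sets of those $h\in\mathcal H(U)$ which are nonnegative, respectively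 bounded, on $\mathbb R^d$, and let $\|h\|_\infty:=\sup_{\mathbb R^d}|h|$. Suppose that there is a Borel measurable function $n\ge 0$ on $\mathbb R^d$ such that, for all $x\in\mathbb R^d$, $r>0$ and Borel sets $A\subset\mathbb R^d\setminus\overline{U(x,r)}$, $$\mathbb P^x[X_{\tau_{U(x,r)}}\in A]=\mathbb E^x\int_0^{\tau_{U(x,r)}}\int_A n(z-X_u)\,dz\,du,$$ and that there are $0<\alpha<1/2$ and $c_J\ge 1$ such that $n(z)\le c_J\,n(z+y)$ for all $y,z\in\mathbb R^d$ with $|y|<2\alpha|z|$. Suppose further that there is a Borel measurable function $G:\mathbb R^d\times\mathbb R^d\to(0,\infty]$ with the following properties, where $G\nu(x):=\int G(x,y)\,d\nu(y)$ and, for Borel sets $A$, $\operatorname{cap}A:=\sup\{\|\mu\|:\mu \text{ a finite Borel measure},\ \mu(A^c)=0,\ G\mu\le 1\}$. (G$_1$) There is $c_1\ge 1$ such that, for every bounded open $U$, $x\in U$, $\delta>0$ and closed $A\subset U$, there are a closed neighborhood $B\subset U$ of $A$ and a measure $\nu$ on $B$ such that $$\|\varepsilon_x^B\|-\delta<c_1\|\varepsilon_x^A\|\quad\text{and}\quad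 \|\varepsilon_y^A\|\le G\nu(y)\le c_1\|\varepsilon_y^B\|\quad\text{for all } y\in\mathbb R^d.$$ (G$_2$) There are a strictly decreasing continuous function $g:[0,\infty)\to(0,\infty]$ and constants $c,c_D\in[1,\infty)$, $M_0\in(1,\infty)$, $\alpha_0\in(0,1)$ such that $g(r/2)\le c_D\,g(r)$ and $M_0\,g(r)\le g(\alpha_0 r)$ for all $r>0$, and $c^{-1}g(|x-y|)\le G(x,y)\le c\,g(|x-y|)$ for all $x,y\in\mathbb R^d$. (G$_3$) There is $c_2\ge 1$ such that $\operatorname{cap}U(x,r)\ge c_2^{-1}g(r)^{-1}$ for all $x\in\mathbb R^d$ and $r>0$. Then the following hold. 1. There exist $\alpha\in(0,1)$ and $K\ge 1$ such that, for all $x\in\mathbb R^d$ and $R>0$, $$\sup h(U(x,\alpha R))\le K\inf h(U(x,\alpha R))\qquad\text{for all } h\in\mathcal H^+(U(x,R)).$$ 2. There exist $\beta\in(0,1)$ and $C\ge 1$ such that, for all $x\in\mathbb R^d$ and $R>0$, $$|h(y)-h(x)|\le C\,\|h\|_\infty\left(\frac{|x-y|}{R}\right)^{\beta}\qquad\text{for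 all } y\in U(x,R),\ h\in\mathcal H_b(U(x,R)).$$ 3. Every universally measurable function $h:\mathbb R^d\to\mathbb R$ which is harmonic on an open set $U\subset\mathbb R^d$ is continuous on $U$. -/

import Mathlib

open MeasureTheory ProbabilityTheory Filter Set
open scoped NNReal ENNReal Topology

namespace LevyHarnack

/-- `ℝ^d` with the Euclidean norm. -/
abbrev Euc (d : ℕ) : Type := EuclideanSpace ℝ (Fin d)

/-- `f` is universally measurable: for every finite Borel measure `μ`, preimages of Borel sets
belong to the `μ`-completion of the Borel `σ`-algebra. -/
def UniversallyMeasurable {d : ℕ} (f : Euc d → ℝ) : Prop :=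
  ∀ μ : Measure (Euc d), IsFiniteMeasure μ → NullMeasurable f μ

section Exits

variable {d : ℕ} {Ω : Type*} [MeasurableSpace Ω]

/-- `X` is a Lévy process on `ℝ^d` under the probability measure `P`: it starts almost surely
at `0`, has independent and stationary increments, and almost surely its paths are right continuous
with left limits. (Stochastic continuity is a consequence of these properties.) -/
structure IsLevyProcess (X : ℝ≥0 → Ω → Euc d) (P : Measure Ω) : Prop where
  isProbabilityMeasure : IsProbabilityMeasure P
  measurable : ∀ t, Measurable (X t)
  start_zero : ∀ᵐ ω ∂P, X 0 ω = 0
  indep_increments : HasIndepIncrements X P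
  stationary_increments : ∀ s t : ℝ≥0,
    IdentDistrib (fun ω => X (s + t) ω - X s ω) (fun ω => X t ω - X 0 ω) P P
  cadlag : ∀ᵐ ω ∂P, ∀ t : ℝ≥0,
    ContinuousWithinAt (fun s => X s ω) (Ici t) t ∧
      ∃ l : Euc d, Tendsto (fun s => X s ω) (𝓝[<] t) (𝓝 l)

/-- The process started at `x`. Its law under `P` is `ℙ^x`. -/
def startedAt (X : ℝ≥0 → Ω → Euc d) (x : Euc d) : ℝ≥0 → Ω → Euc d :=
  fun t ω => x + X t ω

/-- `τ_U = inf {t ≥ 0 : X_t ∉ U}` for the process started at `x`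
(it is `⊤` if the process never leaves `U`). -/
noncomputable def exitTime (X : ℝ≥0 → Ω → Euc d) (x : Euc d) (U : Set (Euc d)) :
    Ω → WithTop ℝ≥0 :=
  hittingAfter (startedAt X x) Uᶜ 0

/-- The harmonic measures `μ_x^U(E) = ℙ^x[X_{τ_U} ∈ E, τ_U < ∞]`, that is, the exit distributions
of the process. -/
noncomputable def harmonicMeasure (X : ℝ≥0 → Ω → Euc d) (P : Measure Ω)
    (U : Set (Euc d)) (x : Euc d) : Measure (Euc d) :=
  (P.restrict {ω | exitTime X x U ω < ⊤}).map (stoppedValue (startedAt X x) (exitTime X x U))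

/-- The reduced measures `ε_x^A = μ_x^{ℝ^d ∖ A}` (for closed `A`). -/
noncomputable def reducedMeasure (X : ℝ≥0 → Ω → Euc d) (P : Measure Ω)
    (A : Set (Euc d)) (x : Euc d) : Measure (Euc d) :=
  harmonicMeasure X P Aᶜ x

/-- The exit distributions of balls are given by the Lévy-system formula with density `n`:
`ℙ^x[X_τ ∈ A] = 𝔼^x ∫_0^τ ∫_A n(z - X_u) dz du` for `τ = τ_{U(x,r)}` and every Borel set `A` that
does not meet the closure of the ball `U(x,r)`. -/
def HasLevySystemDensity (X : ℝ≥0 → Ω → Euc d) (P : Measure Ω) (n : Euc d → ℝ≥0∞) : Prop :=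
  ∀ (x : Euc d) (r : ℝ), 0 < r → ∀ A : Set (Euc d), MeasurableSet A →
    A ⊆ (closure (Metric.ball x r))ᶜ →
    harmonicMeasure X P (Metric.ball x r) x A =
      ∫⁻ ω, (∫⁻ u in {u : ℝ | 0 ≤ u ∧
          ((u.toNNReal : ℝ≥0) : WithTop ℝ≥0) < exitTime X x (Metric.ball x r) ω},
        (∫⁻ z in A, n (z - startedAt X x u.toNNReal ω))) ∂P

/-- `h` is harmonic on the open set `U`: it is a universally measurable real function on `ℝ^d`
such that, for all open `V` with closure contained in `U` and all `x ∈ V`, it is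
`μ_x^V`-integrable with `∫ h dμ_x^V = h(x)`. -/
def IsHarmonicOn (X : ℝ≥0 → Ω → Euc d) (P : Measure Ω) (h : Euc d → ℝ) (U : Set (Euc d)) :
    Prop :=
  UniversallyMeasurable h ∧
    ∀ V : Set (Euc d), IsOpen V → closure V ⊆ U → ∀ x ∈ V,
      Integrable h (harmonicMeasure X P V x) ∧ ∫ y, h y ∂(harmonicMeasure X P V x) = h x

end Exits

section Green

variable {d : ℕ}

/-- The potential `Gν(x) = ∫ G(x,y) dν(y)`. -/
noncomputable def potential (G : Euc d → Euc d → ℝ≥0∞) (ν : Measure (Euc d)) (x : Euc d) : ℝ≥0∞ :=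
  ∫⁻ y, G x y ∂ν

/-- `cap A = sup {‖μ‖ : μ a finite measure, μ(Aᶜ) = 0, Gμ ≤ 1}`. -/
noncomputable def capacity (G : Euc d → Euc d → ℝ≥0∞) (A : Set (Euc d)) : ℝ≥0∞ :=
  sSup {m | ∃ μ : Measure (Euc d),
    IsFiniteMeasure μ ∧ μ Aᶜ = 0 ∧ (∀ x, potential G μ x ≤ 1) ∧ m = μ univ}

/-- Property (G₁), for bounded open sets `U`. -/
def PropertyG1 {Ω : Type*} [MeasurableSpace Ω] (X : ℝ≥0 → Ω → Euc d) (P : Measure Ω)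
    (G : Euc d → Euc d → ℝ≥0∞) : Prop :=
  ∃ c₁ : ℝ≥0, 1 ≤ c₁ ∧
    ∀ U : Set (Euc d), IsOpen U → Bornology.IsBounded U → ∀ x ∈ U, ∀ δ : ℝ≥0, 0 < δ →
      ∀ A : Set (Euc d), IsClosed A → A ⊆ U →
        ∃ (B : Set (Euc d)) (ν : Measure (Euc d)),
          IsClosed B ∧ A ⊆ interior B ∧ B ⊆ U ∧ ν Bᶜ = 0 ∧
          reducedMeasure X P B x univ < c₁ * reducedMeasure X P A x univ + δ ∧
          ∀ y, reducedMeasure X P A y univ ≤ potential G ν y ∧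
            potential G ν y ≤ c₁ * reducedMeasure X P B y univ

/-- Property (G₂), for a given strictly decreasing continuous function `g : [0,∞) → (0,∞]`. -/
def PropertyG2 (G : Euc d → Euc d → ℝ≥0∞) (g : ℝ≥0 → ℝ≥0∞) : Prop :=
  (∀ r, 0 < g r) ∧ StrictAnti g ∧ Continuous g ∧
    ∃ c c_D M₀ α₀ : ℝ≥0, 1 ≤ c ∧ 1 ≤ c_D ∧ 1 < M₀ ∧ 0 < α₀ ∧ α₀ < 1 ∧
      (∀ r : ℝ≥0, 0 < r → g (r / 2) ≤ c_D * g r ∧ M₀ * g r ≤ g (α₀ * r)) ∧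
      ∀ x y : Euc d, (c : ℝ≥0∞)⁻¹ * g (nndist x y) ≤ G x y ∧ G x y ≤ c * g (nndist x y)

/-- Property (G₃), for the function `g` in (G₂). -/
def PropertyG3 (G : Euc d → Euc d → ℝ≥0∞) (g : ℝ≥0 → ℝ≥0∞) : Prop :=
  ∃ c₂ : ℝ≥0, 1 ≤ c₂ ∧ ∀ (x : Euc d) (r : ℝ≥0), 0 < r →
    (c₂ : ℝ≥0∞)⁻¹ * (g r)⁻¹ ≤ capacity G (Metric.ball x r)

end Green

end LevyHarnack

open LevyHarnack

/-! Two estimates drive everything; once they are available, the Green function and the Lévy density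
play no further role.

Hitting (`exists_hittingEstimate`): for every universally measurable set `S` and every ball of
radius `r`, a compact part `A` of the ball lies in `S` or in its complement and is hit, from any
point of a ball of radius `R` containing the small one, before leaving the `M`-fold ball, with
probability at least `η φ(R) / φ(r)`, where `φ` is `g` with real values. This comes from (G₁)–(G₃):
the potential `Gν` in (G₁) squeezes the hitting probability of `A`, duality with a capacitary
measure bounds the mass of `ν` from below, and the growth of `g` makes the contribution of returns
from far away negligible.

Jumps (`exists_jumpEstimate`): far away, the exit distributions of two balls lying in a common ball
are comparable, because the Lévy density varies by a bounded factor and the exit time of a centred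
ball depends on its radius only.

Harnack: if `h(y)` is huge compared with `h(y₀)`, then the set where `h` exceeds a small multiple of
`h(y)` cannot contain `A`, as `h(y₀)` would be too large. So `A` lies in the complement. As `A` is
hit from `y` with probability at least `η` and large jumps contribute little, `h` must exceed `(1 +
η/2) h(y)` at a point near `y` (`Harm.exists_growth`). Iteration over geometrically decreasing radii
keeps the points together and contradicts boundedness; truncation removes that assumption.

Hölder: the same dichotomy, applied to the upper and lower half of the range of `h`, shrinks the
oscillation by a fixed factor from a ball to a smaller one (`le_of_integral_eq`), provided that exit
distributions have geometrically small tails (`exists_tail`). Continuity of a general `h` follows by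
splitting off a bounded part, which is Hölder, and controlling the rest by Harnack
(`continuousAt_toReal_lintegral`).

Before this, harmonic measures must be shown to form kernels with `μ^V μ^U = μ^U` for `V ⊆ U`. This
is the strong Markov property at exit times together with quasi-left-continuity, both derived here
from independent stationary increments. -/

open TopologicalSpace (denseSeq denseRange_denseSeq)

namespace LevyHarnack

/-! ### Debuts of right continuous paths as measurable functions on path space. -/

section Paths

variable {d : ℕ}

/-- Right continuity of a path. -/
def RightCont (p : ℝ≥0 → Euc d) : Prop := ∀ t, ContinuousWithinAt p (Ici t) t

/-- The point of the grid `ℕ / (n + 1)` next to `t` on the right. -/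
noncomputable def gridUp (n : ℕ) (t : ℝ≥0) : ℝ≥0 := (⌊(n + 1 : ℝ≥0) * t⌋₊ + 1) / (n + 1)

lemma lt_gridUp (n : ℕ) (t : ℝ≥0) : t < gridUp n t := by
  rw [gridUp, lt_div_iff₀ (by positivity), mul_comm]
  exact Nat.lt_floor_add_one _

lemma gridUp_le (n : ℕ) (t : ℝ≥0) : gridUp n t ≤ t + 1 / (n + 1) := by
  rw [gridUp, add_div, ← mul_div_cancel_left₀ t (show (n + 1 : ℝ≥0) ≠ 0 by positivity)]
  gcongr
  · rw [mul_div_cancel_left₀ t (show (n + 1 : ℝ≥0) ≠ 0 by positivity)]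
    exact Nat.floor_le zero_le

lemma tendsto_gridUp (t : ℝ≥0) : Tendsto (fun n => gridUp n t) atTop (𝓝 t) := by
  refine tendsto_of_tendsto_of_tendsto_of_le_of_le tendsto_const_nhds
    (h := fun n : ℕ => t + 1 / ((n : ℝ≥0) + 1)) ?_ (fun n => (lt_gridUp n t).le)
    (fun n => gridUp_le n t)
  have h : Tendsto (fun n : ℕ => t + 1 / ((n : ℝ≥0) + 1)) atTop (𝓝 (t + 0)) :=
    tendsto_const_nhds.add tendsto_one_div_add_atTop_nhds_zero_nat
  simpa using h

lemma RightCont.tendsto_gridUp_add {p : ℝ≥0 → Euc d} (hp : RightCont p) (t s : ℝ≥0) :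
    Tendsto (fun n => p (gridUp n t + s)) atTop (𝓝 (p (t + s))) := by
  refine (hp (t + s)).tendsto.comp (tendsto_nhdsWithin_iff.2 ⟨?_, ?_⟩)
  · exact (tendsto_gridUp t).add_const s
  · exact Eventually.of_forall fun n => add_le_add_left (lt_gridUp n t).le s

lemma RightCont.tendsto_gridUp {p : ℝ≥0 → Euc d} (hp : RightCont p) (t : ℝ≥0) :
    Tendsto (fun n => p (gridUp n t)) atTop (𝓝 (p t)) := by
  simpa using hp.tendsto_gridUp_add t 0

/-- A right continuous path in an open set at time `t` is in that set at times of a given countable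
dense set which are arbitrarily close to `t`. -/
lemma RightCont.exists_denseSeq {p : ℝ≥0 → Euc d} (hp : RightCont p) {V : Set (Euc d)}
    (hV : IsOpen V) {t u : ℝ≥0} (ht : p t ∈ V) (hu : t < u) :
    ∃ n, p (denseSeq ℝ≥0 n) ∈ V ∧ t < denseSeq ℝ≥0 n ∧ denseSeq ℝ≥0 n < u := by
  have h1 : ∀ᶠ s in 𝓝[>] t, p s ∈ V :=
    ((hp t).mono Ioi_subset_Ici_self).eventually (hV.mem_nhds ht)
  obtain ⟨v, hv, hv'⟩ := (mem_nhdsGT_iff_exists_Ioo_subset' hu).1 h1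
  have hlt : t < min u v := lt_min hu hv
  obtain ⟨n, hn⟩ := (denseRange_denseSeq ℝ≥0).exists_mem_open isOpen_Ioo (nonempty_Ioo.2 hlt)
  exact ⟨n, hv' ⟨hn.1, hn.2.trans_le (min_le_right _ _)⟩, hn.1, hn.2.trans_le (min_le_left _ _)⟩

/-- The entrance time of a path into the open `1 / (k + 1)`-neighbourhood of `F`, computed along a
countable dense set of times. -/
noncomputable def approxHit (F : Set (Euc d)) (k : ℕ) (p : ℝ≥0 → Euc d) : ℝ≥0∞ :=
  open scoped Classical in
  ⨅ n : ℕ, if p (denseSeq ℝ≥0 n) ∈ Metric.thickening (1 / (k + 1 : ℝ)) F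
    then (denseSeq ℝ≥0 n : ℝ≥0∞) else ⊤

/-- The limit of the entrance times into the neighbourhoods of `F`. -/
noncomputable def debut (F : Set (Euc d)) (p : ℝ≥0 → Euc d) : ℝ≥0∞ := ⨆ k, approxHit F k p

/-- The value of a right continuous path at its `debut`. -/
noncomputable def debutValue (F : Set (Euc d)) (p : ℝ≥0 → Euc d) : Euc d :=
  limUnder atTop fun n => p (gridUp n (debut F p).toNNReal)

variable {F : Set (Euc d)} {p : ℝ≥0 → Euc d}

lemma approxHit_lt_iff {k : ℕ} {t : ℝ≥0∞} :
    approxHit F k p < t ↔ ∃ n, p (denseSeq ℝ≥0 n) ∈ Metric.thickening (1 / (k + 1 : ℝ)) F ∧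
      (denseSeq ℝ≥0 n : ℝ≥0∞) < t := by
  classical
  unfold approxHit
  rw [iInf_lt_iff]
  refine exists_congr fun n => ?_
  split_ifs with h <;> simp [-one_div, h]

lemma RightCont.approxHit_le (hp : RightCont p) {k : ℕ} {t : ℝ≥0}
    (h : p t ∈ Metric.thickening (1 / (k + 1 : ℝ)) F) : approxHit F k p ≤ t := by
  refine le_of_forall_gt fun u hu => ?_
  obtain ⟨v, hv1, hv2⟩ := ENNReal.lt_iff_exists_nnreal_btwn.1 hu
  obtain ⟨n, h1, _, h3⟩ := hp.exists_denseSeq Metric.isOpen_thickening h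
    (ENNReal.coe_lt_coe.1 hv1)
  exact approxHit_lt_iff.2 ⟨n, h1, (ENNReal.coe_lt_coe.2 h3).trans hv2⟩

lemma RightCont.debut_le (hp : RightCont p) {t : ℝ≥0} (h : p t ∈ F) : debut F p ≤ t :=
  iSup_le fun _ => hp.approxHit_le (Metric.self_subset_thickening (by positivity) F h)

lemma approxHit_mono_right {k l : ℕ} (h : k ≤ l) : approxHit F k p ≤ approxHit F l p := by
  refine le_of_forall_gt fun u hu => ?_
  obtain ⟨n, h1, h2⟩ := approxHit_lt_iff.1 hu
  refine approxHit_lt_iff.2 ⟨n, Metric.thickening_mono ?_ F h1, h2⟩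
  gcongr

lemma approxHit_anti_set {F' : Set (Euc d)} (h : F' ⊆ F) (k : ℕ) :
    approxHit F k p ≤ approxHit F' k p := by
  refine le_of_forall_gt fun u hu => ?_
  obtain ⟨n, h1, h2⟩ := approxHit_lt_iff.1 hu
  exact approxHit_lt_iff.2 ⟨n, Metric.thickening_subset_of_subset _ h h1, h2⟩

lemma debut_anti_set {F' : Set (Euc d)} (h : F' ⊆ F) : debut F p ≤ debut F' p :=
  iSup_mono fun k => approxHit_anti_set h k

/-- If the distance at the entrance time were larger, right continuity would keep it larger for a
while, whereas entrance times along the dense set accumulate there from the right. -/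
lemma RightCont.infEDist_approxHit_le (hp : RightCont p) {k : ℕ} {t : ℝ≥0}
    (h : approxHit F k p = t) : Metric.infEDist (p t) F ≤ ENNReal.ofReal (1 / (k + 1 : ℝ)) := by
  by_contra! hlt
  have hopen : IsOpen {y : Euc d | ENNReal.ofReal (1 / (k + 1 : ℝ)) < Metric.infEDist y F} :=
    isOpen_lt continuous_const Metric.continuous_infEDist
  have h1 : ∀ᶠ s in 𝓝[>] t, ENNReal.ofReal (1 / (k + 1 : ℝ)) < Metric.infEDist (p s) F :=
    ((hp t).mono Ioi_subset_Ici_self).eventually (hopen.mem_nhds hlt)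
  obtain ⟨v, hv, hv'⟩ := (mem_nhdsGT_iff_exists_Ioo_subset' (lt_add_one t)).1 h1
  have h2 : approxHit F k p < v := h ▸ ENNReal.coe_lt_coe.2 hv
  obtain ⟨n, h3, h4⟩ := approxHit_lt_iff.1 h2
  have h5 : Metric.infEDist (p (denseSeq ℝ≥0 n)) F < ENNReal.ofReal (1 / (k + 1 : ℝ)) := h3
  have h6 : t ≤ denseSeq ℝ≥0 n := ENNReal.coe_le_coe.1 (h ▸ hp.approxHit_le h3)
  rcases h6.eq_or_lt with h7 | h7
  · exact (hlt.trans (h7 ▸ h5)).false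
  · exact ((hv' ⟨h7, ENNReal.coe_lt_coe.1 h4⟩ :
      ENNReal.ofReal (1 / (k + 1 : ℝ)) < Metric.infEDist (p _) F).trans h5).false

lemma RightCont.shift (hp : RightCont p) (t : ℝ≥0) : RightCont fun s => p (t + s) := fun s =>
  (hp (t + s)).comp (continuous_const.add continuous_id).continuousWithinAt
    fun _ hu => add_le_add_right (α := ℝ≥0) hu t

/-- The debut of a subset of `F` for the path shifted by the debut of `F`. -/
lemma RightCont.debut_shift (hp : RightCont p) {F' : Set (Euc d)} {t : ℝ≥0}
    (ht : t ≤ debut F' p) (hgood : ∀ s : ℝ≥0, debut F' p = s → p s ∈ F') :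
    t + debut F' (fun s => p (t + s)) = debut F' p := by
  apply le_antisymm
  · rcases eq_or_ne (debut F' p) ⊤ with h | h
    · simp [h]
    lift debut F' p to ℝ≥0 using h with s hs
    have hmem := hgood s rfl
    have hts : t ≤ s := ENNReal.coe_le_coe.1 ht
    have h1 : debut F' (fun s => p (t + s)) ≤ (s - t : ℝ≥0) :=
      (hp.shift t).debut_le (by simpa [add_tsub_cancel_of_le hts] using hmem)
    calc (t : ℝ≥0∞) + debut F' (fun s => p (t + s)) ≤ t + (s - t : ℝ≥0) := by gcongr
      _ = s := by rw [← ENNReal.coe_add, add_tsub_cancel_of_le hts]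
  · refine iSup_le fun k => ?_
    refine le_trans ?_ (add_le_add_right (le_iSup (fun k => approxHit F' k _) k) (t : ℝ≥0∞))
    refine le_of_forall_gt fun u hu => ?_
    have h1 : approxHit F' k (fun s => p (t + s)) < u - t := lt_tsub_iff_left.2 hu
    obtain ⟨n, h2, h3⟩ := approxHit_lt_iff.1 h1
    have h4 := hp.approxHit_le (k := k) (F := F') h2
    refine h4.trans_lt ?_
    rw [ENNReal.coe_add]
    exact lt_tsub_iff_left.1 h3

lemma RightCont.debutValue_eq (hp : RightCont p) : debutValue F p = p (debut F p).toNNReal :=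
  (hp.tendsto_gridUp _).limUnder_eq

lemma measurable_approxHit (k : ℕ) : Measurable (approxHit F k : (ℝ≥0 → Euc d) → ℝ≥0∞) := by
  classical
  unfold approxHit
  refine Measurable.iInf fun n => ?_
  exact Measurable.ite (measurable_pi_apply _ Metric.isOpen_thickening.measurableSet)
    measurable_const measurable_const

lemma measurable_debut : Measurable (debut F : (ℝ≥0 → Euc d) → ℝ≥0∞) :=
  Measurable.iSup fun k => measurable_approxHit k

/-- The grid is countable, so evaluation at a random grid time needs measurability at fixed times
only. The passage to arbitrary random times is by right continuity. -/
lemma measurable_eval_gridUp {Ω : Type*} [MeasurableSpace Ω] {Y : ℝ≥0 → Ω → Euc d}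
    (hY : ∀ t, Measurable (Y t)) {T : Ω → ℝ≥0} (hT : Measurable T) (n : ℕ) (s : ℝ≥0) :
    Measurable fun ω => Y (gridUp n (T ω) + s) ω := by
  have h1 : Measurable fun ω => ⌊(n + 1 : ℝ≥0) * T ω⌋₊ :=
    Nat.measurable_floor.comp (hT.const_mul _)
  have h2 : Measurable (Function.uncurry fun (k : ℕ) ω => Y (((k : ℝ≥0) + 1) / (n + 1) + s) ω) :=
    measurable_from_prod_countable_right fun k =>
      (hY (((k : ℝ≥0) + 1) / (n + 1) + s) :)
  have h3 := h2.comp (h1.prodMk measurable_id)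
  simp only [gridUp]
  simpa only [Function.comp_def, Function.uncurry, id] using h3

lemma measurable_eval_add {Ω : Type*} [MeasurableSpace Ω] {Y : ℝ≥0 → Ω → Euc d}
    (hY : ∀ t, Measurable (Y t)) (hc : ∀ ω, RightCont fun t => Y t ω) {T : Ω → ℝ≥0}
    (hT : Measurable T) (s : ℝ≥0) : Measurable fun ω => Y (T ω + s) ω :=
  measurable_of_tendsto_metrizable (fun n => measurable_eval_gridUp hY hT n s)
    (tendsto_pi_nhds.2 fun ω => (hc ω).tendsto_gridUp_add (T ω) s)

lemma measurable_debutValue : Measurable (debutValue F : (ℝ≥0 → Euc d) → Euc d) := by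
  refine (StronglyMeasurable.limUnder (l := atTop) fun n => ?_).measurable
  have := measurable_eval_gridUp (Y := fun t (p : ℝ≥0 → Euc d) => p t)
    (fun t => measurable_pi_apply t) (measurable_debut (F := F)).ennreal_toNNReal n 0
  simpa using this.stronglyMeasurable

/-- If the path is in the closed set `F` at its debut, then the debut is the hitting time. -/
lemma RightCont.hittingAfter_eq {Ω : Type*} {Z : ℝ≥0 → Ω → Euc d} {ω : Ω}
    (hp : RightCont fun t => Z t ω)
    (hgood : ∀ s : ℝ≥0, debut F (fun t => Z t ω) = s → Z s ω ∈ F) :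
    hittingAfter Z F 0 ω = debut F (fun t => Z t ω) := by
  rcases eq_or_ne (debut F (fun t => Z t ω)) ⊤ with h | h
  · rw [h]
    refine hittingAfter_eq_top_iff.2 fun j _ hj => ?_
    have := hp.debut_le hj
    rw [h] at this
    simp at this
  · obtain ⟨s, hs⟩ := WithTop.ne_top_iff_exists.1 h
    rw [← hs]
    have hmem := hgood s hs.symm
    apply le_antisymm
    · exact hittingAfter_le_of_mem zero_le hmem
    · refine le_of_not_gt fun hlt => ?_
      rw [hittingAfter_def] at hlt
      have hex : ∃ j : ℝ≥0, 0 ≤ j ∧ Z j ω ∈ F := ⟨s, zero_le, hmem⟩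
      simp only [if_pos hex] at hlt
      have hlt' : sInf {i : ℝ≥0 | 0 ≤ i ∧ Z i ω ∈ F} < s := ENNReal.coe_lt_coe.1 hlt
      obtain ⟨i, hi, his⟩ := exists_lt_of_csInf_lt (⟨s, zero_le, hmem⟩ : Set.Nonempty {i : ℝ≥0 | 0 ≤ i ∧ Z i ω ∈ F}) hlt'
      have := hp.debut_le hi.2
      rw [← hs] at this
      exact (ENNReal.coe_le_coe.1 this).not_gt his

end Paths

/-! ### The Markov property at fixed times. -/

section Markov

variable {d : ℕ} {Ω : Type*} [MeasurableSpace Ω]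

/-- A Lévy process all of whose paths start at `0` and are right continuous. -/
structure IsRegularLevy (Y : ℝ≥0 → Ω → Euc d) (P : Measure Ω) : Prop where
  isProbabilityMeasure : IsProbabilityMeasure P
  measurable : ∀ t, Measurable (Y t)
  start_zero : ∀ ω, Y 0 ω = 0
  indep_increments : HasIndepIncrements Y P
  stationary_increments : ∀ s t : ℝ≥0,
    IdentDistrib (fun ω => Y (s + t) ω - Y s ω) (fun ω => Y t ω - Y 0 ω) P P
  rightCont : ∀ ω, RightCont fun t => Y t ω

/-- Paths in a measurable null set containing all bad ones are replaced by zero. Increments change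
only on a null set, so their laws and independence survive. -/
lemma IsLevyProcess.exists_regular {X : ℝ≥0 → Ω → Euc d} {P : Measure Ω}
    (hX : IsLevyProcess X P) :
    ∃ Y : ℝ≥0 → Ω → Euc d, IsRegularLevy Y P ∧ ∀ᵐ ω ∂P, ∀ t, Y t ω = X t ω := by
  classical
  have hbad : ∀ᵐ ω ∂P, X 0 ω = 0 ∧ RightCont fun t => X t ω := by
    filter_upwards [hX.start_zero, hX.cadlag] with ω h0 h1 using ⟨h0, fun t => (h1 t).1⟩
  set N : Set Ω := toMeasurable P {ω | ¬ (X 0 ω = 0 ∧ RightCont fun t => X t ω)} with hN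
  have hN0 : P N = 0 := by rw [hN, measure_toMeasurable]; exact hbad
  have hNm : MeasurableSet N := measurableSet_toMeasurable _ _
  have hgood : ∀ ω ∉ N, X 0 ω = 0 ∧ RightCont fun t => X t ω := fun ω hω => by
    by_contra h
    exact hω (subset_toMeasurable _ _ h)
  let Y : ℝ≥0 → Ω → Euc d := fun t => N.piecewise (fun _ => 0) (X t)
  have hYX : ∀ᵐ ω ∂P, ∀ t, Y t ω = X t ω := by
    have : ∀ᵐ ω ∂P, ω ∉ N := measure_eq_zero_iff_ae_notMem.1 hN0
    filter_upwards [this] with ω hω t using Set.piecewise_eq_of_notMem _ _ _ hω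
  refine ⟨Y, ⟨hX.isProbabilityMeasure, fun t => Measurable.piecewise hNm measurable_const
    (hX.measurable t), fun ω => ?_, fun n t ht => ?_, fun s t => ?_, fun ω => ?_⟩, hYX⟩
  · by_cases h : ω ∈ N
    · exact Set.piecewise_eq_of_mem _ _ _ h
    · exact (Set.piecewise_eq_of_notMem _ _ _ h).trans (hgood ω h).1
  · refine (hX.indep_increments n t ht).congr fun i => ?_
    filter_upwards [hYX] with ω hω
    simp [hω]
  · have hm : ∀ u v, AEMeasurable (fun ω => X u ω - X v ω) P := fun u v =>
      ((hX.measurable u).sub (hX.measurable v)).aemeasurable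
    have he : ∀ u v, (fun ω => X u ω - X v ω) =ᵐ[P] fun ω => Y u ω - Y v ω := fun u v => by
      filter_upwards [hYX] with ω hω
      simp [hω]
    exact ((IdentDistrib.of_ae_eq (hm _ _) (he _ _)).symm.trans
      (hX.stationary_increments s t)).trans (IdentDistrib.of_ae_eq (hm _ _) (he _ _))
  · by_cases h : ω ∈ N
    · have : (fun t => Y t ω) = fun _ => 0 := funext fun t => Set.piecewise_eq_of_mem _ _ _ h
      rw [this]
      exact fun t => continuousWithinAt_const
    · have : (fun t => Y t ω) = fun t => X t ω :=
        funext fun t => Set.piecewise_eq_of_notMem _ _ _ h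
      rw [this]
      exact (hgood ω h).2

/-- Finitely many times become an infinite monotone sequence by repeating the largest one, which is
the form in which independence of increments is used. -/
lemma exists_monotone_enumeration {α : Type*} [LinearOrder α] (K : Finset α) (hK : K.Nonempty) :
    ∃ τ : ℕ → α, Monotone τ ∧ ∀ x ∈ K, ∃ i, τ i = x := by
  have hc : 0 < K.card := hK.card_pos
  refine ⟨fun i => K.orderEmbOfFin rfl ⟨min i (K.card - 1), by omega⟩, fun i j hij => ?_,
    fun x hx => ?_⟩
  · refine (K.orderEmbOfFin rfl).monotone (Fin.mk_le_mk.2 ?_)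
    omega
  · have : x ∈ Set.range (K.orderEmbOfFin rfl) := by simpa using hx
    obtain ⟨i, hi⟩ := this
    have h : (⟨min i (K.card - 1), by omega⟩ : Fin K.card) = i :=
      Fin.ext (min_eq_left (by have := i.2; omega))
    exact ⟨i, (congrArg (K.orderEmbOfFin rfl) h).trans hi⟩

variable {Y : ℝ≥0 → Ω → Euc d} {P : Measure Ω}

namespace IsRegularLevy

/-- The past up to a fixed time is independent of the increments after that time. -/
lemma indepFun_past_future (hY : IsRegularLevy Y P) (s : ℝ≥0) :
    IndepFun (fun ω (u : Iic s) => Y u ω) (fun ω (v : ℝ≥0) => Y (s + v) ω - Y s ω) P := by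
  classical
  have := hY.isProbabilityMeasure
  refine IndepFun.process_indepFun_process (fun i => hY.measurable _)
    (fun v => (hY.measurable _).sub (hY.measurable _)) fun I J => ?_
  obtain ⟨τ, hτ, hK⟩ := exists_monotone_enumeration
    (insert 0 (insert s (I.image Subtype.val ∪ J.image (fun v => s + v)))) (by simp)
  have hτ0 : τ 0 = 0 := by
    obtain ⟨i, hi⟩ := hK 0 (by simp)
    exact le_antisymm (hi ▸ hτ (Nat.zero_le i)) zero_le
  obtain ⟨m, hm⟩ := hK s (by simp)
  have hI : ∀ u : I, ∃ j ≤ m, τ j = u := fun u => by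
    obtain ⟨j, hj⟩ := hK u (Finset.mem_insert_of_mem (Finset.mem_insert_of_mem
      (Finset.mem_union_left _ (Finset.mem_image_of_mem _ u.2))))
    rcases le_total j m with h | h
    · exact ⟨j, h, hj⟩
    · refine ⟨m, le_rfl, le_antisymm (hj ▸ hτ h) ?_⟩
      rw [hm]
      exact u.1.2
  have hJ : ∀ v : J, ∃ j ≥ m, τ j = s + v := fun v => by
    obtain ⟨j, hj⟩ := hK (s + v) (by simp)
    rcases le_total m j with h | h
    · exact ⟨j, h, hj⟩
    · refine ⟨m, le_rfl, le_antisymm ?_ (hj ▸ hτ h)⟩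
      rw [hm]
      exact le_self_add
  choose j hjm hj using hI
  choose k hkm hk using hJ
  have hbdd : ∃ N, ∀ v, k v ≤ N := ⟨Finset.univ.sup k, fun v => Finset.le_sup (Finset.mem_univ v)⟩
  obtain ⟨N, hN⟩ := hbdd
  have hind := (hY.indep_increments.nat hτ).indepFun_finset (Finset.range m) (Finset.Ico m N)
    (by
      rw [Finset.disjoint_left]
      intro a ha hb
      simp only [Finset.mem_range, Finset.mem_Ico] at ha hb
      omega)
    (fun i => (hY.measurable _).sub (hY.measurable _))
  -- Past values and future increments are sums of disjoint blocks of consecutive increments along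
  -- `τ`: indices below `m` for the past, from `m` on for the future.
  let φ : (Finset.range m → Euc d) → I → Euc d := fun p u =>
    ∑ i : Finset.range m, if (i : ℕ) < j u then p i else 0
  let ψ : (Finset.Ico m N → Euc d) → J → Euc d := fun p v =>
    ∑ i : Finset.Ico m N, if (i : ℕ) < k v then p i else 0
  have hφ : Measurable φ := by
    refine measurable_pi_lambda _ fun u => Finset.measurable_fun_sum _ fun i _ => ?_
    split_ifs
    · exact measurable_pi_apply _
    · exact measurable_const
  have hψ : Measurable ψ := by
    refine measurable_pi_lambda _ fun u => Finset.measurable_fun_sum _ fun i _ => ?_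
    split_ifs
    · exact measurable_pi_apply _
    · exact measurable_const
  convert! hind.comp hφ hψ using 1
  · ext1 ω
    ext1 u
    simp only [Function.comp, φ]
    rw [Finset.sum_coe_sort (Finset.range m)
      (fun i => if i < j u then Y (τ (i + 1)) ω - Y (τ i) ω else 0), ← Finset.sum_filter]
    have : (Finset.range m).filter (· < j u) = Finset.range (j u) := by
      ext i
      have := hjm u
      simp only [Finset.mem_filter, Finset.mem_range]
      omega
    rw [this, Finset.sum_range_sub (fun i => Y (τ i) ω), hj, hτ0, hY.start_zero, sub_zero]
  · ext1 ω
    ext1 v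
    simp only [Function.comp, ψ]
    rw [Finset.sum_coe_sort (Finset.Ico m N)
      (fun i => if i < k v then Y (τ (i + 1)) ω - Y (τ i) ω else 0), ← Finset.sum_filter]
    have : (Finset.Ico m N).filter (· < k v) = Finset.Ico m (k v) := by
      ext i
      have := hN v
      simp only [Finset.mem_filter, Finset.mem_Ico]
      omega
    rw [this, Finset.sum_Ico_sub (fun i => Y (τ i) ω) (hkm v), hk, hm]

lemma identDistrib_increment (hY : IsRegularLevy Y P) {s t : ℝ≥0} (hst : s ≤ t) (r : ℝ≥0) :
    IdentDistrib (fun ω => Y (r + t) ω - Y (r + s) ω) (fun ω => Y t ω - Y s ω) P P := by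
  have h1 := hY.stationary_increments (r + s) (t - s)
  have h2 := hY.stationary_increments s (t - s)
  rw [add_assoc, add_tsub_cancel_of_le hst] at h1
  rw [add_tsub_cancel_of_le hst] at h2
  exact h1.trans h2.symm

/-- The increments after a fixed time have the law of the process. -/
lemma identDistrib_future (hY : IsRegularLevy Y P) (s : ℝ≥0) :
    IdentDistrib (fun ω (v : ℝ≥0) => Y (s + v) ω - Y s ω) (fun ω v => Y v ω) P P := by
  classical
  have := hY.isProbabilityMeasure
  have hm1 : Measurable (fun ω (v : ℝ≥0) => Y (s + v) ω - Y s ω) :=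
    measurable_pi_lambda _ fun v => (hY.measurable _).sub (hY.measurable _)
  have hm2 : Measurable (fun ω (v : ℝ≥0) => Y v ω) :=
    measurable_pi_lambda _ fun v => hY.measurable _
  refine (identDistrib_iff_forall_finset_identDistrib (X := fun v ω => Y (s + v) ω - Y s ω)
    hm1.aemeasurable hm2.aemeasurable).2 fun J => ?_
  obtain ⟨τ, hτ, hK⟩ := exists_monotone_enumeration (insert 0 J) (by simp)
  have hτ0 : τ 0 = 0 := by
    obtain ⟨i, hi⟩ := hK 0 (by simp)
    exact le_antisymm (hi ▸ hτ (Nat.zero_le i)) zero_le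
  choose k hk using fun v : J => hK v (by simp)
  have h1 := hY.indep_increments.nat hτ
  have h2 := hY.indep_increments.nat (t := fun i => s + τ i) (fun i l h => by
    have := hτ h
    simpa using this)
  have h3 := IdentDistrib.pi (fun i => hY.identDistrib_increment (hτ (Nat.le_succ i)) s) h2 h1
  let φ : (ℕ → Euc d) → J → Euc d := fun p v => ∑ i ∈ Finset.range (k v), p i
  have hφ : Measurable φ := measurable_pi_lambda _ fun u =>
    Finset.measurable_fun_sum _ fun i _ => measurable_pi_apply _
  convert! h3.comp hφ using 1
  · ext1 ω
    ext1 v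
    simp only [Function.comp, φ, Nat.succ_eq_add_one, Finset.restrict]
    rw [Finset.sum_range_sub (fun i => Y (s + τ i) ω), hk, hτ0, add_zero]
  · ext1 ω
    ext1 v
    simp only [Function.comp, φ, Nat.succ_eq_add_one, Finset.restrict]
    rw [Finset.sum_range_sub (fun i => Y (τ i) ω), hk, hτ0, hY.start_zero, sub_zero]

end IsRegularLevy

end Markov

/-! ### Path kernel, optional times and the strong Markov property. -/

section StrongMarkov

variable {d : ℕ} {Ω : Type*} [MeasurableSpace Ω]

/-- The law on path space of the process started at `x`, as a kernel in `x`. -/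
noncomputable def pathKernel (Y : ℝ≥0 → Ω → Euc d) (P : Measure Ω) :
    Kernel (Euc d) (ℝ≥0 → Euc d) :=
  (Kernel.id ×ₖ Kernel.const (Euc d) P).map fun q t => q.1 + Y t q.2

end StrongMarkov

section OptionalTimes

variable {d : ℕ} {Ω : Type*}

/-- The `σ`-algebra generated by the process up to time `s`. -/
@[reducible]
def pastSigma (Y : ℝ≥0 → Ω → Euc d) (s : ℝ≥0) : MeasurableSpace Ω :=
  MeasurableSpace.comap (fun ω (u : Iic s) => Y u ω) MeasurableSpace.pi

lemma pastSigma_mono (Y : ℝ≥0 → Ω → Euc d) {s t : ℝ≥0} (h : s ≤ t) :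
    pastSigma Y s ≤ pastSigma Y t := by
  have hr : Measurable fun (p : Iic t → Euc d) (u : Iic s) => p ⟨u, u.2.trans h⟩ :=
    measurable_pi_lambda _ fun u => measurable_pi_apply _
  rintro _ ⟨B, hB, rfl⟩
  exact ⟨_, hr hB, rfl⟩

lemma measurableSet_pastSigma (Y : ℝ≥0 → Ω → Euc d) {s t : ℝ≥0} (h : s ≤ t) {B : Set (Euc d)}
    (hB : MeasurableSet B) : MeasurableSet[pastSigma Y t] {ω | Y s ω ∈ B} :=
  ⟨(fun p : Iic t → Euc d => p ⟨s, h⟩) ⁻¹' B, measurable_pi_apply _ hB, rfl⟩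

/-- `T` is an optional time of the process `Y`. -/
def IsOptionalTime (Y : ℝ≥0 → Ω → Euc d) (T : Ω → ℝ≥0∞) : Prop :=
  ∀ t : ℝ≥0, MeasurableSet[pastSigma Y t] {ω | T ω < t}

end OptionalTimes

section StrongMarkov

variable {d : ℕ} {Ω : Type*} [MeasurableSpace Ω] {Y : ℝ≥0 → Ω → Euc d} {P : Measure Ω}

namespace IsRegularLevy

lemma measurable_path (hY : IsRegularLevy Y P) (x : Euc d) :
    Measurable fun ω (t : ℝ≥0) => x + Y t ω :=
  measurable_pi_lambda _ fun t => (hY.measurable t).const_add x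

lemma measurable_path_uncurry (hY : IsRegularLevy Y P) :
    Measurable fun (q : Euc d × Ω) (t : ℝ≥0) => q.1 + Y t q.2 :=
  measurable_pi_lambda _ fun t => measurable_fst.add ((hY.measurable t).comp measurable_snd)

lemma pathKernel_apply (hY : IsRegularLevy Y P) (x : Euc d) :
    pathKernel Y P x = P.map fun ω t => x + Y t ω := by
  have := hY.isProbabilityMeasure
  rw [pathKernel, Kernel.map_apply _ hY.measurable_path_uncurry, Kernel.prod_apply,
    Kernel.id_apply, Kernel.const_apply, Measure.dirac_prod,
    Measure.map_map hY.measurable_path_uncurry measurable_prodMk_left]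
  rfl

lemma isMarkovKernel_pathKernel (hY : IsRegularLevy Y P) : IsMarkovKernel (pathKernel Y P) := by
  have := hY.isProbabilityMeasure
  exact Kernel.IsMarkovKernel.map _ hY.measurable_path_uncurry

lemma pastSigma_le (hY : IsRegularLevy Y P) (s : ℝ≥0) : pastSigma Y s ≤ ‹MeasurableSpace Ω› :=
  Measurable.comap_le (measurable_pi_lambda _ fun _ => hY.measurable _)

lemma measurable_optional (hY : IsRegularLevy Y P) {T : Ω → ℝ≥0∞} (hT : IsOptionalTime Y T) :
    Measurable T := by
  refine measurable_of_Iio fun a => ?_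
  have : T ⁻¹' Iio a = ⋃ n : ℕ, if (denseSeq ℝ≥0 n : ℝ≥0∞) ≤ a
      then {ω | T ω < denseSeq ℝ≥0 n} else ∅ := by
    ext ω
    simp only [mem_preimage, mem_Iio, mem_iUnion]
    constructor
    · intro h
      obtain ⟨u, hu1, hu2⟩ := ENNReal.lt_iff_exists_nnreal_btwn.1 h
      obtain ⟨v, hv1, hv2⟩ := ENNReal.lt_iff_exists_nnreal_btwn.1 hu2
      obtain ⟨n, hn⟩ := (denseRange_denseSeq ℝ≥0).exists_mem_open isOpen_Ioo
        (nonempty_Ioo.2 (ENNReal.coe_lt_coe.1 hv1))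
      refine ⟨n, ?_⟩
      rw [if_pos ((ENNReal.coe_lt_coe.2 hn.2).trans hv2).le]
      exact hu1.trans (ENNReal.coe_lt_coe.2 hn.1)
    · rintro ⟨n, hn⟩
      split_ifs at hn with h
      · exact lt_of_lt_of_le hn h
      · exact hn.elim
  rw [this]
  refine MeasurableSet.iUnion fun n => ?_
  split_ifs
  · exact hY.pastSigma_le _ _ (hT _)
  · exact MeasurableSet.empty

lemma markov_lintegral (hY : IsRegularLevy Y P) (x : Euc d) (s : ℝ≥0) {A : Set Ω}
    (hA : MeasurableSet[pastSigma Y s] A) {Φ : (ℝ≥0 → Euc d) → ℝ≥0∞} (hΦ : Measurable Φ) :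
    ∫⁻ ω in A, Φ (fun t => x + Y (s + t) ω) ∂P =
      ∫⁻ ω in A, ∫⁻ p, Φ p ∂(pathKernel Y P (x + Y s ω)) ∂P := by
  have := hY.isProbabilityMeasure
  obtain ⟨B, hB, rfl⟩ := hA
  have hm1 : Measurable (fun ω (u : Iic s) => Y u ω) :=
    measurable_pi_lambda _ fun u => hY.measurable _
  have hm2 : Measurable (fun ω (v : ℝ≥0) => Y (s + v) ω - Y s ω) :=
    measurable_pi_lambda _ fun v => (hY.measurable _).sub (hY.measurable _)
  have hm3 : Measurable (fun ω (v : ℝ≥0) => Y v ω) :=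
    measurable_pi_lambda _ fun v => hY.measurable _
  have hprod := (hY.indepFun_past_future s).map_prod_eq_prod_map_map hm1.aemeasurable
    hm2.aemeasurable
  rw [(hY.identDistrib_future s).map_eq] at hprod
  let e : (Iic s → Euc d) × (ℝ≥0 → Euc d) → ℝ≥0 → Euc d := fun q t =>
    (x + q.1 ⟨s, self_mem_Iic⟩) + q.2 t
  have he : Measurable e := measurable_pi_lambda _ fun t => by
    simp only [e]
    fun_prop
  let f : (Iic s → Euc d) × (ℝ≥0 → Euc d) → ℝ≥0∞ := (Prod.fst ⁻¹' B).indicator (fun q => Φ (e q))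
  have hf : Measurable f := (hΦ.comp he).indicator (measurable_fst hB)
  have hf1 : ∀ q, q.1 ∈ B → f q = Φ (e q) := fun q h => indicator_of_mem (s := Prod.fst ⁻¹' B) h _
  have hf0 : ∀ q, q.1 ∉ B → f q = 0 := fun q h => indicator_of_notMem (s := Prod.fst ⁻¹' B) h _
  set A : Set Ω := (fun ω (u : Iic s) => Y u ω) ⁻¹' B with hA
  have hAm : MeasurableSet A := hm1 hB
  calc _ = ∫⁻ ω, f (fun u : Iic s => Y u ω, fun v => Y (s + v) ω - Y s ω) ∂P := by
        rw [← lintegral_indicator hAm]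
        refine lintegral_congr fun ω => ?_
        by_cases h : ω ∈ A
        · rw [indicator_of_mem h, hf1 (fun u : Iic s => Y u ω, fun v => Y (s + v) ω - Y s ω) h]
          simp [e]
        · rw [indicator_of_notMem h, hf0 (fun u : Iic s => Y u ω, fun v => Y (s + v) ω - Y s ω) h]
    _ = ∫⁻ q, f q ∂(P.map fun ω => (fun u : Iic s => Y u ω, fun v => Y (s + v) ω - Y s ω)) := by
        rw [lintegral_map hf (hm1.prodMk hm2)]
    _ = ∫⁻ a, ∫⁻ b, f (a, b) ∂(P.map (fun ω v => Y v ω)) ∂(P.map (fun ω (u : Iic s) => Y u ω)) := by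
        rw [hprod, lintegral_prod _ hf.aemeasurable]
    _ = ∫⁻ ω, ∫⁻ b, f (fun u : Iic s => Y u ω, b) ∂(P.map (fun ω v => Y v ω)) ∂P := by
        rw [lintegral_map hf.lintegral_prod_right' hm1]
    _ = _ := by
        rw [← lintegral_indicator hAm]
        refine lintegral_congr fun ω => ?_
        rw [lintegral_map (f := fun b => f (fun u : Iic s => Y u ω, b))
          (hf.comp measurable_prodMk_left) hm3]
        by_cases h : ω ∈ A
        · rw [indicator_of_mem h, hY.pathKernel_apply, lintegral_map hΦ (hY.measurable_path _)]
          exact lintegral_congr fun ω' => hf1 (fun u : Iic s => Y u ω, fun v => Y v ω') h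
        · rw [indicator_of_notMem h, ← lintegral_zero (μ := P)]
          exact lintegral_congr fun ω' => hf0 (fun u : Iic s => Y u ω, fun v => Y v ω') h

/-- The grid time takes countably many values, and the Markov property applies on each level set. As
the grid time is strictly later than `T`, its level sets are differences of sets `{T < t}`, which
are known to belong to the past. -/
lemma strongMarkov_gridUp (hY : IsRegularLevy Y P) (x : Euc d) {T : Ω → ℝ≥0∞}
    (hT : IsOptionalTime Y T) (n : ℕ) {Φ : (ℝ≥0 → Euc d) → ℝ≥0∞} (hΦ : Measurable Φ) :
    ∫⁻ ω in {ω | T ω < ⊤}, Φ (fun t => x + Y (gridUp n (T ω).toNNReal + t) ω) ∂P =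
      ∫⁻ ω in {ω | T ω < ⊤}, ∫⁻ p, Φ p ∂(pathKernel Y P (x + Y (gridUp n (T ω).toNNReal) ω)) ∂P := by
  let s : ℕ → ℝ≥0 := fun k => (k : ℝ≥0) / (n + 1)
  have hs : Monotone s := fun i j hij => by
    simp only [s]
    gcongr
  let A : ℕ → Set Ω := fun k => {ω | T ω < s (k + 1)} \ {ω | T ω < s k}
  have hA : ∀ k, MeasurableSet[pastSigma Y (s (k + 1))] (A k) := fun k =>
    MeasurableSet.diff (hT _) (pastSigma_mono Y (hs (Nat.le_succ k)) _ (hT _))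
  have hAk : ∀ k ω, ω ∈ A k ↔ T ω < ⊤ ∧ ⌊(n + 1 : ℝ≥0) * (T ω).toNNReal⌋₊ = k := by
    intro k ω
    simp only [A, Set.mem_sdiff, mem_ofPred_eq, not_lt]
    constructor
    · rintro ⟨h1, h2⟩
      have h3 : T ω < ⊤ := h1.trans ENNReal.coe_lt_top
      refine ⟨h3, ?_⟩
      lift T ω to ℝ≥0 using h3.ne with u
      rw [ENNReal.coe_lt_coe, lt_div_iff₀ (by positivity)] at h1
      rw [ENNReal.coe_le_coe, div_le_iff₀ (by positivity)] at h2
      rw [ENNReal.toNNReal_coe, Nat.floor_eq_iff zero_le, mul_comm]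
      exact ⟨h2, by exact_mod_cast h1⟩
    · rintro ⟨h3, h4⟩
      lift T ω to ℝ≥0 using h3.ne with u
      rw [ENNReal.toNNReal_coe, Nat.floor_eq_iff zero_le, mul_comm] at h4
      rw [ENNReal.coe_lt_coe, lt_div_iff₀ (by positivity), ENNReal.coe_le_coe,
        div_le_iff₀ (by positivity)]
      exact ⟨by exact_mod_cast h4.2, h4.1⟩
  have hgrid : ∀ k, ∀ ω ∈ A k, gridUp n (T ω).toNNReal = s (k + 1) := fun k ω h => by
    simp only [gridUp, ((hAk k ω).1 h).2, s]
    push_cast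
    rfl
  have hU : {ω | T ω < ⊤} = ⋃ k, A k := by
    ext ω
    simp [hAk]
  have hdisj : Pairwise (Function.onFun Disjoint A) := fun i j hij => by
    refine Set.disjoint_left.2 fun ω h1 h2 => hij ?_
    rw [← ((hAk i ω).1 h1).2, ((hAk j ω).1 h2).2]
  have hAm : ∀ k, MeasurableSet (A k) := fun k => hY.pastSigma_le _ _ (hA k)
  rw [hU, lintegral_iUnion hAm hdisj, lintegral_iUnion hAm hdisj]
  refine tsum_congr fun k => ?_
  rw [setLIntegral_congr_fun (hAm k) (g := fun ω => Φ (fun t => x + Y (s (k + 1) + t) ω))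
    (fun ω h => by beta_reduce; rw [hgrid k ω h]), hY.markov_lintegral x _ (hA k) hΦ]
  exact setLIntegral_congr_fun (hAm k) (fun ω h => by beta_reduce; rw [hgrid k ω h])

/-- A Feller property on finitely many coordinates: starting points act by translation, so dominated
convergence suffices. It permits the passage from grid times to `T`. -/
lemma continuous_lintegral_pathKernel (hY : IsRegularLevy Y P) (I : Finset ℝ≥0)
    (f : BoundedContinuousFunction (I → Euc d) ℝ≥0) :
    Continuous fun w => ∫⁻ p, f (I.restrict p) ∂(pathKernel Y P w) := by
  have := hY.isProbabilityMeasure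
  have hm : Measurable fun p : ℝ≥0 → Euc d => (f (I.restrict p) : ℝ≥0∞) :=
    (f.continuous.measurable.comp (Finset.measurable_restrict I)).coe_nnreal_ennreal
  have heq : (fun w => ∫⁻ p, f (I.restrict p) ∂(pathKernel Y P w)) =
      fun w => ∫⁻ ω, f (I.restrict fun t => w + Y t ω) ∂P := funext fun w => by
    rw [hY.pathKernel_apply, lintegral_map hm (hY.measurable_path w)]
  rw [heq]
  refine continuous_iff_continuousAt.2 fun w => ?_
  refine tendsto_lintegral_filter_of_dominated_convergence (fun _ => (nndist 0 f : ℝ≥0∞)) ?_ ?_ ?_ ?_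
  · exact Eventually.of_forall fun v => hm.comp (hY.measurable_path v)
  · refine Eventually.of_forall fun v => ae_of_all _ fun ω => ?_
    exact ENNReal.coe_le_coe.2 (f.apply_le_nndist_zero _)
  · rw [lintegral_const]
    exact ENNReal.mul_ne_top ENNReal.coe_ne_top (measure_ne_top _ _)
  · refine ae_of_all _ fun ω => ?_
    refine (ENNReal.continuous_coe.comp (f.continuous.comp ?_)).tendsto w
    exact continuous_pi fun t => continuous_id.add continuous_const

/-- The strong Markov property at optional times. -/
theorem strongMarkov (hY : IsRegularLevy Y P) (x : Euc d) {T : Ω → ℝ≥0∞}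
    (hT : IsOptionalTime Y T) :
    (P.restrict {ω | T ω < ⊤}).map (fun ω t => x + Y ((T ω).toNNReal + t) ω) =
      (pathKernel Y P) ∘ₘ ((P.restrict {ω | T ω < ⊤}).map fun ω => x + Y (T ω).toNNReal ω) := by
  have := hY.isProbabilityMeasure
  have := hY.isMarkovKernel_pathKernel
  have hTm := (hY.measurable_optional hT).ennreal_toNNReal
  have hmt : ∀ t, Measurable fun ω => x + Y ((T ω).toNNReal + t) ω := fun t =>
    (measurable_eval_add hY.measurable hY.rightCont hTm t).const_add x
  have hm1 : Measurable fun ω (t : ℝ≥0) => x + Y ((T ω).toNNReal + t) ω :=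
    measurable_pi_lambda _ hmt
  have hm2 : Measurable fun ω => x + Y (T ω).toNNReal ω := by simpa using hmt 0
  set μ₁ := (P.restrict {ω | T ω < ⊤}).map (fun ω t => x + Y ((T ω).toNNReal + t) ω) with hμ₁
  set μ₂ := (pathKernel Y P) ∘ₘ ((P.restrict {ω | T ω < ⊤}).map fun ω => x + Y (T ω).toNNReal ω)
    with hμ₂
  -- Finite measures on path space are determined by their finite-dimensional marginals, and there
  -- bounded continuous test functions suffice. For these, both sides of the grid identity converge.
  have hfin : ∀ I : Finset ℝ≥0, μ₁.map I.restrict = μ₂.map I.restrict := by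
    intro I
    have hr : Measurable (I.restrict : (ℝ≥0 → Euc d) → (I → Euc d)) := Finset.measurable_restrict I
    refine ext_of_forall_lintegral_eq_of_IsFiniteMeasure fun f => ?_
    have hfm : Measurable fun p : I → Euc d => (f p : ℝ≥0∞) :=
      f.continuous.measurable.coe_nnreal_ennreal
    have hΦ : Measurable fun p : ℝ≥0 → Euc d => (f (I.restrict p) : ℝ≥0∞) := hfm.comp hr
    have hcont := hY.continuous_lintegral_pathKernel I f
    rw [lintegral_map hfm hr, lintegral_map hfm hr, hμ₁, lintegral_map hΦ hm1, hμ₂,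
      Measure.lintegral_bind (Kernel.aemeasurable _) hΦ.aemeasurable,
      lintegral_map hcont.measurable hm2]
    have h1 : Tendsto (fun n => ∫⁻ ω in {ω | T ω < ⊤},
        f (I.restrict (fun t => x + Y (gridUp n (T ω).toNNReal + t) ω)) ∂P) atTop
        (𝓝 (∫⁻ ω in {ω | T ω < ⊤}, f (I.restrict (fun t => x + Y ((T ω).toNNReal + t) ω)) ∂P)) := by
      refine tendsto_lintegral_of_dominated_convergence (fun _ => (nndist 0 f : ℝ≥0∞)) ?_ ?_ ?_ ?_
      · exact fun n => hΦ.comp (measurable_pi_lambda _ fun t =>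
          (measurable_eval_gridUp hY.measurable hTm n t).const_add x)
      · exact fun n => ae_of_all _ fun ω => ENNReal.coe_le_coe.2 (f.apply_le_nndist_zero _)
      · rw [lintegral_const]
        exact ENNReal.mul_ne_top ENNReal.coe_ne_top (measure_ne_top _ _)
      · refine ae_of_all _ fun ω => (ENNReal.continuous_coe.tendsto _).comp
          ((f.continuous.tendsto _).comp (tendsto_pi_nhds.2 fun t => ?_))
        exact ((hY.rightCont ω).tendsto_gridUp_add _ _).const_add x
    have h2 : Tendsto (fun n => ∫⁻ ω in {ω | T ω < ⊤},
        ∫⁻ p, f (I.restrict p) ∂(pathKernel Y P (x + Y (gridUp n (T ω).toNNReal) ω)) ∂P) atTop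
        (𝓝 (∫⁻ ω in {ω | T ω < ⊤},
          ∫⁻ p, f (I.restrict p) ∂(pathKernel Y P (x + Y (T ω).toNNReal ω)) ∂P)) := by
      refine tendsto_lintegral_of_dominated_convergence (fun _ => (nndist 0 f : ℝ≥0∞)) ?_ ?_ ?_ ?_
      · exact fun n => hcont.measurable.comp (by
          simpa using (measurable_eval_gridUp hY.measurable hTm n 0).const_add x)
      · refine fun n => ae_of_all _ fun ω => ?_
        refine (lintegral_mono fun p => ENNReal.coe_le_coe.2 (f.apply_le_nndist_zero _)).trans ?_
        simp
      · rw [lintegral_const]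
        exact ENNReal.mul_ne_top ENNReal.coe_ne_top (measure_ne_top _ _)
      · refine ae_of_all _ fun ω => (hcont.tendsto _).comp ?_
        exact ((hY.rightCont ω).tendsto_gridUp _).const_add x
    refine tendsto_nhds_unique h1 (h2.congr fun n => ?_)
    exact (hY.strongMarkov_gridUp x hT n hΦ).symm
  exact IsProjectiveLimit.unique (P := fun I : Finset ℝ≥0 => μ₁.map I.restrict)
    (fun I => rfl) (fun I => (hfin I).symm)

end IsRegularLevy

end StrongMarkov

/-! ### Quasi-left-continuity: the process belongs to a closed set at its debut. -/

section QuasiLeftContinuity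

variable {d : ℕ} {Ω : Type*}

lemma isOptionalTime_approxHit (Y : ℝ≥0 → Ω → Euc d) (F : Set (Euc d)) (x : Euc d) (k : ℕ) :
    IsOptionalTime Y fun ω => approxHit F k fun t => x + Y t ω := by
  intro t
  have : {ω | approxHit F k (fun t => x + Y t ω) < t} =
      ⋃ n : {n : ℕ // denseSeq ℝ≥0 n < t},
        {ω | Y (denseSeq ℝ≥0 n) ω ∈ (x + ·) ⁻¹' Metric.thickening (1 / (k + 1 : ℝ)) F} := by
    ext ω
    simp only [mem_ofPred_eq, approxHit_lt_iff, ENNReal.coe_lt_coe, mem_iUnion, mem_preimage,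
      Subtype.exists, exists_prop]
    exact exists_congr fun n => and_comm
  rw [this]
  refine MeasurableSet.iUnion fun n => measurableSet_pastSigma Y n.2.le ?_
  exact (Metric.isOpen_thickening.preimage (continuous_const.add continuous_id)).measurableSet

lemma isOptionalTime_debut (Y : ℝ≥0 → Ω → Euc d) (F : Set (Euc d)) (x : Euc d) :
    IsOptionalTime Y fun ω => debut F fun t => x + Y t ω := by
  intro t
  have : {ω | debut F (fun t => x + Y t ω) < t} =
      ⋃ n : {n : ℕ // denseSeq ℝ≥0 n < t}, ⋂ k : ℕ,
        {ω | approxHit F k (fun t => x + Y t ω) < denseSeq ℝ≥0 n} := by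
    ext ω
    simp only [mem_ofPred_eq, mem_iUnion, mem_iInter, Subtype.exists, exists_prop]
    constructor
    · intro h
      obtain ⟨u, hu1, hu2⟩ := ENNReal.lt_iff_exists_nnreal_btwn.1 h
      obtain ⟨n, hn⟩ := (denseRange_denseSeq ℝ≥0).exists_mem_open isOpen_Ioo
        (nonempty_Ioo.2 (ENNReal.coe_lt_coe.1 hu2))
      exact ⟨n, hn.2, fun k => (le_iSup (fun k => approxHit F k _) k).trans_lt
        (hu1.trans (ENNReal.coe_lt_coe.2 hn.1))⟩
    · rintro ⟨n, hn, h⟩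
      exact (iSup_le fun k => (h k).le).trans_lt (ENNReal.coe_lt_coe.2 hn)
  rw [this]
  refine MeasurableSet.iUnion fun n => MeasurableSet.iInter fun k => ?_
  exact pastSigma_mono Y n.2.le _ (isOptionalTime_approxHit Y F x k _)

variable [MeasurableSpace Ω] {Y : ℝ≥0 → Ω → Euc d} {P : Measure Ω}

namespace IsRegularLevy

/-- By the strong Markov property the increment after `T` has the law of `Y t`. The bound does not
depend on `T`, which is what quasi-left-continuity needs. -/
lemma lintegral_increment_optional_le (hY : IsRegularLevy Y P) {T : Ω → ℝ≥0∞}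
    (hT : IsOptionalTime Y T) (t : ℝ≥0) :
    ∫⁻ ω in {ω | T ω < ⊤}, min ‖Y ((T ω).toNNReal + t) ω - Y (T ω).toNNReal ω‖ₑ 1 ∂P ≤
      ∫⁻ ω, min ‖Y t ω‖ₑ 1 ∂P := by
  have := hY.isProbabilityMeasure
  have hTm := (hY.measurable_optional hT).ennreal_toNNReal
  have hmt : ∀ t, Measurable fun ω => 0 + Y ((T ω).toNNReal + t) ω := fun t =>
    (measurable_eval_add hY.measurable hY.rightCont hTm t).const_add 0
  have hm1 : Measurable fun ω (t : ℝ≥0) => 0 + Y ((T ω).toNNReal + t) ω :=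
    measurable_pi_lambda _ hmt
  have hm2 : Measurable fun ω => 0 + Y (T ω).toNNReal ω := by simpa using hmt 0
  let Φ : (ℝ≥0 → Euc d) → ℝ≥0∞ := fun p => min ‖p t - p 0‖ₑ 1
  have hΦ : Measurable Φ :=
    ((measurable_pi_apply t).sub (measurable_pi_apply 0)).enorm.min measurable_const
  have hconst : ∀ w, ∫⁻ p, Φ p ∂(pathKernel Y P w) = ∫⁻ ω, min ‖Y t ω‖ₑ 1 ∂P := fun w => by
    rw [hY.pathKernel_apply, lintegral_map hΦ (hY.measurable_path w)]
    simp [Φ, hY.start_zero]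
  have key : ∫⁻ p, Φ p ∂_ = ∫⁻ p, Φ p ∂_ :=
    congrArg (fun μ => ∫⁻ p, Φ p ∂μ) (hY.strongMarkov 0 hT)
  rw [lintegral_map hΦ hm1, Measure.lintegral_bind (Kernel.aemeasurable _) hΦ.aemeasurable] at key
  simp only [hconst, lintegral_const] at key
  have h1 : ∫⁻ ω in {ω | T ω < ⊤}, min ‖Y ((T ω).toNNReal + t) ω - Y (T ω).toNNReal ω‖ₑ 1 ∂P =
      ∫⁻ ω in {ω | T ω < ⊤}, Φ (fun t => 0 + Y ((T ω).toNNReal + t) ω) ∂P := by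
    simp [Φ]
  rw [h1, key, Measure.map_apply hm2 MeasurableSet.univ, preimage_univ, Measure.restrict_apply_univ]
  exact mul_le_of_le_one_right zero_le prob_le_one

lemma tendsto_lintegral_increment (hY : IsRegularLevy Y P) :
    Tendsto (fun k : ℕ => ∫⁻ ω, min ‖Y (1 / ((k : ℝ≥0) + 1)) ω‖ₑ 1 ∂P) atTop (𝓝 0) := by
  have := hY.isProbabilityMeasure
  rw [← lintegral_zero (μ := P)]
  refine tendsto_lintegral_of_dominated_convergence (fun _ => 1) ?_ ?_ ?_ ?_
  · exact fun n => (hY.measurable _).enorm.min measurable_const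
  · exact fun n => ae_of_all _ fun ω => min_le_right _ _
  · simp
  · refine ae_of_all _ fun ω => ?_
    have h1 : Tendsto (fun k : ℕ => 1 / ((k : ℝ≥0) + 1)) atTop (𝓝[≥] 0) :=
      tendsto_nhdsWithin_iff.2 ⟨tendsto_one_div_add_atTop_nhds_zero_nat,
        Eventually.of_forall fun n => Set.mem_Ici.2 zero_le⟩
    have h2 := ((hY.rightCont ω) 0).tendsto.comp h1
    rw [hY.start_zero] at h2
    have h3 := (h2.enorm).min (tendsto_const_nhds (x := (1 : ℝ≥0∞)))
    simpa using h3

/-- Quasi-left-continuity: almost surely, the process is in the closed set `F` at its debut. -/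
theorem ae_mem_of_debut_eq (hY : IsRegularLevy Y P) {F : Set (Euc d)} (hF : IsClosed F)
    (x : Euc d) : ∀ᵐ ω ∂P, ∀ s : ℝ≥0, debut F (fun t => x + Y t ω) = s → x + Y s ω ∈ F := by
  have := hY.isProbabilityMeasure
  set D : Ω → ℝ≥0∞ := fun ω => debut F fun t => x + Y t ω with hD
  set T : ℕ → Ω → ℝ≥0∞ := fun k ω => approxHit F k fun t => x + Y t ω with hT
  have hDm : Measurable D := hY.measurable_optional (isOptionalTime_debut Y F x)
  have hTm : ∀ k, Measurable (T k) := fun k =>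
    hY.measurable_optional (isOptionalTime_approxHit Y F x k)
  have hTD : ∀ k ω, T k ω ≤ D ω := fun k ω => le_iSup (fun k => approxHit F k _) k
  have hrc : ∀ ω, RightCont fun t => x + Y t ω := fun ω t =>
    continuousWithinAt_const.add (hY.rightCont ω t)
  let ψ : Ω → ℝ≥0∞ := fun ω => min (Metric.infEDist (x + Y (D ω).toNNReal ω) F) 1
  have hψ : Measurable ψ := by
    have h := measurable_eval_add hY.measurable hY.rightCont hDm.ennreal_toNNReal 0
    simp only [add_zero] at h
    exact (Metric.continuous_infEDist.measurable.comp (h.const_add x)).min measurable_const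
  let v : ℕ → ℕ → Ω → ℝ≥0∞ := fun k n ω =>
    min ‖Y ((T n ω).toNNReal + 1 / ((k : ℝ≥0) + 1)) ω - Y (T n ω).toNNReal ω‖ₑ 1
  have hv : ∀ k n, Measurable (v k n) := fun k n => by
    have h1 := measurable_eval_add hY.measurable hY.rightCont (hTm n).ennreal_toNNReal
    have h2 := h1 0
    simp only [add_zero] at h2
    exact ((h1 _).sub h2).enorm.min measurable_const
  -- For large `n` the debut `D` is less than `1/(k+1)` after the entrance time `T n`. Then `T n +
  -- 1/(k+1)` is shortly after `D`, so the path there is close to its value at `D`, while at `T n`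
  -- it is close to `F`. Hence the distance to `F` at `D` is at most the increment `v k n` plus a
  -- small error.
  have hpt : ∀ ω, D ω < ⊤ →
      ψ ω ≤ liminf (fun k => liminf (fun n => v k n ω) atTop) atTop := by
    intro ω hω
    refine ENNReal.le_of_forall_pos_le_add fun ε hε _ => ?_
    rw [← tsub_le_iff_right]
    obtain ⟨s, hs⟩ := WithTop.ne_top_iff_exists.1 hω.ne
    have hsD : D ω = (s : ℝ≥0∞) := hs.symm
    have hε2 : (0 : ℝ≥0∞) < ε / 2 := by simpa using hε.ne'
    have h1 : ∀ᶠ u in 𝓝[≥] s, edist (Y u ω) (Y s ω) < ε / 2 :=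
      (hY.rightCont ω s).tendsto (Metric.eball_mem_nhds _ hε2)
    have h1' : ∃ u > s, Ico s u ⊆ {u | edist (Y u ω) (Y s ω) < ε / 2} :=
      (mem_nhdsGE_iff_exists_Ico_subset' (lt_add_one s)).1 h1
    obtain ⟨δ, hδ, hδ'⟩ := h1'
    have h2 : ∀ᶠ k : ℕ in atTop, 1 / ((k : ℝ≥0) + 1) < δ - s :=
      (tendsto_order.1 tendsto_one_div_add_atTop_nhds_zero_nat).2 _ (tsub_pos_of_lt hδ)
    refine le_liminf_of_le (by isBoundedDefault) (h2.mono fun k hk => ?_)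
    refine le_liminf_of_le (by isBoundedDefault) ?_
    have hkpos : (0 : ℝ≥0) < 1 / ((k : ℝ≥0) + 1) := by positivity
    have hconv : Tendsto (fun n => T n ω) atTop (𝓝 (D ω)) :=
      tendsto_atTop_iSup fun n m h => approxHit_mono_right h
    have h3 : ∀ᶠ n in atTop, D ω < T n ω + (1 / ((k : ℝ≥0) + 1) : ℝ≥0) := by
      refine (tendsto_order.1 (hconv.add_const ((1 / ((k : ℝ≥0) + 1) : ℝ≥0) : ℝ≥0∞))).1 _ ?_
      rw [hsD, ← ENNReal.coe_add]
      exact ENNReal.coe_lt_coe.2 (lt_add_of_pos_right s hkpos)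
    have h4 : ∀ᶠ n : ℕ in atTop, ENNReal.ofReal (1 / ((n : ℝ) + 1)) < ε / 2 := by
      have h5 : Tendsto (fun n : ℕ => ENNReal.ofReal (1 / ((n : ℝ) + 1))) atTop (𝓝 0) := by
        have := ENNReal.tendsto_ofReal (tendsto_one_div_add_atTop_nhds_zero_nat (𝕜 := ℝ))
        simpa using this
      exact (tendsto_order.1 h5).2 _ hε2
    filter_upwards [h3, h4] with n hn3 hn4
    obtain ⟨t, ht⟩ := WithTop.ne_top_iff_exists.1 ((hTD n ω).trans_lt hω).ne
    have htT : T n ω = (t : ℝ≥0∞) := ht.symm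
    have hts : t ≤ s := ENNReal.coe_le_coe.1 (htT ▸ hsD ▸ hTD n ω)
    rw [hsD, htT, ← ENNReal.coe_add, ENNReal.coe_lt_coe] at hn3
    have h5 : edist (Y (t + 1 / ((k : ℝ≥0) + 1)) ω) (Y s ω) < ε / 2 := by
      refine hδ' ⟨hn3.le, ?_⟩
      calc t + 1 / ((k : ℝ≥0) + 1) < s + (δ - s) := add_lt_add_of_le_of_lt hts hk
        _ = δ := add_tsub_cancel_of_le hδ.le
    have h6 : Metric.infEDist (x + Y t ω) F < ε / 2 :=
      ((hrc ω).infEDist_approxHit_le htT).trans_lt hn4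
    have h7 : Metric.infEDist (x + Y s ω) F ≤
        ‖Y (t + 1 / ((k : ℝ≥0) + 1)) ω - Y t ω‖ₑ + ε := by
      calc Metric.infEDist (x + Y s ω) F
          ≤ Metric.infEDist (x + Y t ω) F + edist (x + Y s ω) (x + Y t ω) :=
            Metric.infEDist_le_infEDist_add_edist
        _ ≤ ε / 2 + (edist (Y s ω) (Y (t + 1 / ((k : ℝ≥0) + 1)) ω) +
            edist (Y (t + 1 / ((k : ℝ≥0) + 1)) ω) (Y t ω)) := by
            rw [edist_add_left]
            exact add_le_add h6.le (edist_triangle _ _ _)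
        _ ≤ ε / 2 + (ε / 2 + edist (Y (t + 1 / ((k : ℝ≥0) + 1)) ω) (Y t ω)) := by
            rw [edist_comm (Y s ω)]
            gcongr
        _ = _ := by
            rw [← add_assoc, ENNReal.add_halves, add_comm, edist_eq_enorm_sub]
    simp only [ψ, v, hsD, htT, ENNReal.toNNReal_coe, tsub_le_iff_right]
    rw [← min_add_add_right]
    exact min_le_min h7 le_self_add
  -- Fatou's lemma in `n`, then in `k`: the expected increments over time `1/(k+1)` are bounded
  -- uniformly in `n` and tend to zero as `k → ∞`.
  have hzero : ∫⁻ ω in {ω | D ω < ⊤}, ψ ω ∂P = 0 := by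
    refine le_antisymm ?_ zero_le
    calc ∫⁻ ω in {ω | D ω < ⊤}, ψ ω ∂P
        ≤ ∫⁻ ω in {ω | D ω < ⊤}, liminf (fun k => liminf (fun n => v k n ω) atTop) atTop ∂P :=
          setLIntegral_mono' (measurableSet_lt hDm measurable_const) hpt
      _ ≤ liminf (fun k => ∫⁻ ω in {ω | D ω < ⊤}, liminf (fun n => v k n ω) atTop ∂P) atTop :=
          lintegral_liminf_le fun k => Measurable.liminf (hv k)
      _ ≤ liminf (fun k : ℕ => ∫⁻ ω, min ‖Y (1 / ((k : ℝ≥0) + 1)) ω‖ₑ 1 ∂P) atTop := by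
          refine liminf_le_liminf (Eventually.of_forall fun k => ?_)
          refine (lintegral_liminf_le (hv k)).trans ?_
          refine liminf_le_of_le (by isBoundedDefault) fun b hb => ?_
          obtain ⟨n, hn⟩ := hb.exists
          refine hn.trans ((lintegral_mono_set fun ω (hω : D ω < ⊤) =>
            (hTD n ω).trans_lt hω).trans ?_)
          exact hY.lintegral_increment_optional_le (isOptionalTime_approxHit Y F x n) _
      _ = 0 := hY.tendsto_lintegral_increment.liminf_eq
  rw [lintegral_eq_zero_iff hψ] at hzero
  have hzero' := (ae_restrict_iff' (measurableSet_lt hDm measurable_const)).1 hzero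
  filter_upwards [hzero'] with ω hω s hs
  have h1 : ψ ω = 0 := hω (show D ω < ⊤ by rw [hD]; simp only [hs]; exact ENNReal.coe_lt_top)
  have h2 : D ω = s := hs
  simp only [ψ, h2, ENNReal.toNNReal_coe] at h1
  rcases min_eq_iff.1 h1 with h | h
  · exact hF.closure_eq ▸ Metric.mem_closure_iff_infEDist_zero.2 h.1
  · exact absurd h.1 one_ne_zero

end IsRegularLevy

end QuasiLeftContinuity

/-! ### Harmonic measures as kernels. -/

section HarmonicKernel

variable {d : ℕ} {Ω : Type*} [MeasurableSpace Ω]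

/-- The law of the value at the debut of `F`. -/
noncomputable def debutKernel (Y : ℝ≥0 → Ω → Euc d) (P : Measure Ω) (F : Set (Euc d)) :
    Kernel (Euc d) (Euc d) :=
  ((pathKernel Y P).restrict
    (measurableSet_lt (measurable_debut (F := F)) measurable_const : MeasurableSet
      {p : ℝ≥0 → Euc d | debut F p < ⊤})).map (debutValue F)

variable {X Y : ℝ≥0 → Ω → Euc d} {P : Measure Ω}

lemma debutKernel_apply (F : Set (Euc d)) (x : Euc d) :
    debutKernel Y P F x =
      ((pathKernel Y P x).restrict {p | debut F p < ⊤}).map (debutValue F) := by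
  rw [debutKernel, Kernel.map_apply _ measurable_debutValue, Kernel.restrict_apply]

lemma IsRegularLevy.isFiniteKernel_debutKernel (hY : IsRegularLevy Y P) (F : Set (Euc d)) :
    IsFiniteKernel (debutKernel Y P F) := by
  have := hY.isMarkovKernel_pathKernel
  unfold debutKernel
  infer_instance

lemma IsRegularLevy.rightCont_add (hY : IsRegularLevy Y P) (x : Euc d) (ω : Ω) :
    RightCont fun t => x + Y t ω := fun t => continuousWithinAt_const.add (hY.rightCont ω t)

lemma IsRegularLevy.exitTime_eq_debut (hY : IsRegularLevy Y P) {U : Set (Euc d)} (hU : IsOpen U)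
    (x : Euc d) : ∀ᵐ ω ∂P, exitTime Y x U ω = debut Uᶜ (fun t => x + Y t ω) := by
  filter_upwards [hY.ae_mem_of_debut_eq hU.isClosed_compl x] with ω hω
  exact (hY.rightCont_add x ω).hittingAfter_eq (Z := startedAt Y x) hω

/-- By quasi-left-continuity the debut is almost surely the exit time. This transfers the
measurability of debuts to hitting times, for which no measurability is known a priori. -/
lemma IsRegularLevy.debutKernel_eq (hY : IsRegularLevy Y P)
    (hYX : ∀ᵐ ω ∂P, ∀ t, Y t ω = X t ω) {U : Set (Euc d)} (hU : IsOpen U) (x : Euc d) :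
    debutKernel Y P Uᶜ x = harmonicMeasure X P U x := by
  have hms : MeasurableSet {p : ℝ≥0 → Euc d | debut Uᶜ p < ⊤} :=
    measurableSet_lt measurable_debut measurable_const
  have hexit : ∀ᵐ ω ∂P, exitTime X x U ω = debut Uᶜ (fun t => x + Y t ω) := by
    filter_upwards [hY.exitTime_eq_debut hU x, hYX] with ω h1 h2
    rw [← h1]
    have h3 : (fun t (_ : Unit) => startedAt X x t ω) = fun t (_ : Unit) => startedAt Y x t ω := by
      simp only [startedAt, h2]
    change hittingAfter (fun t (_ : Unit) => startedAt X x t ω) Uᶜ 0 () =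
      hittingAfter (fun t (_ : Unit) => startedAt Y x t ω) Uᶜ 0 ()
    rw [h3]
  rw [debutKernel_apply, hY.pathKernel_apply, Measure.restrict_map (hY.measurable_path x) hms,
    Measure.map_map measurable_debutValue (hY.measurable_path x), harmonicMeasure]
  have hset : {ω | exitTime X x U ω < ⊤} =ᵐ[P]
      (fun ω t => x + Y t ω) ⁻¹' {p | debut Uᶜ p < ⊤} := by
    filter_upwards [hexit] with ω hω
    exact propext (by
      change exitTime X x U ω < ⊤ ↔ debut Uᶜ (fun t => x + Y t ω) < ⊤
      rw [hω]; rfl)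
  rw [Measure.restrict_congr_set hset]
  refine Measure.map_congr ((ae_restrict_iff' (hY.measurable_path x hms)).2 ?_)
  filter_upwards [hexit, hYX] with ω h1 h2 h3
  have h4 : debut Uᶜ (fun t => x + Y t ω) ≠ ⊤ := ne_of_lt h3
  simp only [Function.comp]
  rw [(hY.rightCont_add x ω).debutValue_eq, stoppedValue, h1]
  obtain ⟨s, hs⟩ := WithTop.ne_top_iff_exists.1 h4
  rw [← hs]
  change x + Y s ω = x + X _ ω
  rw [h2]
  rfl

/-- Strong Markov property at the exit time `T` of `V`: as `V ⊆ U`, the exit time of `U` is `T` plus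
the exit time of `U` for the path restarted at `T`. -/
lemma IsRegularLevy.debutKernel_comp (hY : IsRegularLevy Y P) {U V : Set (Euc d)} (hU : IsOpen U)
    (hVU : V ⊆ U) (x : Euc d) :
    debutKernel Y P Uᶜ ∘ₘ debutKernel Y P Vᶜ x = debutKernel Y P Uᶜ x := by
  have := hY.isMarkovKernel_pathKernel
  set T : Ω → ℝ≥0∞ := fun ω => debut Vᶜ fun t => x + Y t ω with hT
  have hTo : IsOptionalTime Y T := isOptionalTime_debut Y Vᶜ x
  have hTm := hY.measurable_optional hTo
  have hsm := hY.strongMarkov x hTo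
  have hms : ∀ F : Set (Euc d), MeasurableSet {p : ℝ≥0 → Euc d | debut F p < ⊤} := fun F =>
    measurableSet_lt measurable_debut measurable_const
  have hmt : ∀ t, Measurable fun ω => x + Y ((T ω).toNNReal + t) ω := fun t =>
    (measurable_eval_add hY.measurable hY.rightCont hTm.ennreal_toNNReal t).const_add x
  have hm1 : Measurable fun ω (t : ℝ≥0) => x + Y ((T ω).toNNReal + t) ω :=
    measurable_pi_lambda _ hmt
  have hlaw : debutKernel Y P Vᶜ x =
      (P.restrict {ω | T ω < ⊤}).map fun ω => x + Y (T ω).toNNReal ω := by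
    rw [debutKernel_apply, hY.pathKernel_apply, Measure.restrict_map (hY.measurable_path x) (hms _),
      Measure.map_map measurable_debutValue (hY.measurable_path x)]
    congr 1
    funext ω
    exact (hY.rightCont_add x ω).debutValue_eq
  ext E hE
  have hval : MeasurableSet (debutValue Uᶜ ⁻¹' E : Set (ℝ≥0 → Euc d)) := measurable_debutValue hE
  rw [Measure.bind_apply hE (Kernel.aemeasurable _), hlaw]
  have h1 : ∀ z, debutKernel Y P Uᶜ z E =
      pathKernel Y P z (debutValue Uᶜ ⁻¹' E ∩ {p | debut Uᶜ p < ⊤}) := fun z => by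
    rw [debutKernel_apply, Measure.map_apply measurable_debutValue hE, Measure.restrict_apply hval]
  have hmE : MeasurableSet (debutValue Uᶜ ⁻¹' E ∩ {p : ℝ≥0 → Euc d | debut Uᶜ p < ⊤}) :=
    hval.inter (hms _)
  simp only [h1]
  rw [← Measure.bind_apply hmE (Kernel.aemeasurable _), ← hsm, Measure.map_apply hm1 hmE,
    Measure.restrict_apply (hm1 hmE), hY.pathKernel_apply,
    Measure.map_apply (hY.measurable_path x) hmE]
  refine measure_congr ?_
  filter_upwards [hY.ae_mem_of_debut_eq hU.isClosed_compl x] with ω hω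
  have hanti : T ω ≤ debut Uᶜ (fun t => x + Y t ω) := debut_anti_set (compl_subset_compl.2 hVU)
  refine propext ?_
  change ((debutValue Uᶜ (fun t => x + Y ((T ω).toNNReal + t) ω) ∈ E ∧
    debut Uᶜ (fun t => x + Y ((T ω).toNNReal + t) ω) < ⊤) ∧ T ω < ⊤) ↔
    debutValue Uᶜ (fun t => x + Y t ω) ∈ E ∧ debut Uᶜ (fun t => x + Y t ω) < ⊤
  have hrc := hY.rightCont_add x ω
  rcases eq_or_ne (T ω) ⊤ with h | h
  · have h2 : debut Uᶜ (fun t => x + Y t ω) = ⊤ := top_le_iff.1 (h ▸ hanti)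
    simp [h, h2]
  · obtain ⟨s, hs⟩ := WithTop.ne_top_iff_exists.1 h
    have hsT : T ω = (s : ℝ≥0∞) := hs.symm
    have h3 := hrc.debut_shift (F' := Uᶜ) (t := s) (hsT ▸ hanti) hω
    rw [hsT, ENNReal.toNNReal_coe, (hrc.shift s).debutValue_eq, hrc.debutValue_eq, ← h3]
    have h4 : (s : ℝ≥0∞) < ⊤ := ENNReal.coe_lt_top
    simp only [ENNReal.add_lt_top, h4, true_and, and_true]
    refine and_congr_left fun h5 => ?_
    rw [ENNReal.toNNReal_add h4.ne h5.ne, ENNReal.toNNReal_coe]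

namespace IsLevyProcess

/-- The harmonic measures of an open set form a finite kernel. -/
lemma exists_kernel (hX : IsLevyProcess X P) :
    ∃ κ : Set (Euc d) → Kernel (Euc d) (Euc d), (∀ U, IsFiniteKernel (κ U)) ∧
      (∀ U, IsOpen U → ∀ x, κ U x = harmonicMeasure X P U x) ∧
      ∀ U V, IsOpen U → IsOpen V → V ⊆ U → ∀ x, κ U ∘ₘ κ V x = κ U x := by
  obtain ⟨Y, hY, hYX⟩ := hX.exists_regular
  refine ⟨fun U => debutKernel Y P Uᶜ, fun U => hY.isFiniteKernel_debutKernel _,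
    fun U hU x => hY.debutKernel_eq hYX hU x, fun U V hU _ hVU x => hY.debutKernel_comp hU hVU x⟩

end IsLevyProcess

end HarmonicKernel

/-! ### Basic properties of harmonic measures. -/

section HarmonicMeasure

variable {d : ℕ} {Ω : Type*} [MeasurableSpace Ω] {X : ℝ≥0 → Ω → Euc d} {P : Measure Ω}

namespace IsLevyProcess

lemma harmonicMeasure_eq_map (hX : IsLevyProcess X P) :
    ∃ Y : ℝ≥0 → Ω → Euc d, IsRegularLevy Y P ∧ ∀ U, IsOpen U → ∀ x E, MeasurableSet E →
      harmonicMeasure X P U x E =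
        P {ω | debut Uᶜ (fun t => x + Y t ω) < ⊤ ∧ debutValue Uᶜ (fun t => x + Y t ω) ∈ E} := by
  obtain ⟨Y, hY, hYX⟩ := hX.exists_regular
  refine ⟨Y, hY, fun U hU x E hE => ?_⟩
  have hval : MeasurableSet (debutValue Uᶜ ⁻¹' E : Set (ℝ≥0 → Euc d)) := measurable_debutValue hE
  have hms : MeasurableSet {p : ℝ≥0 → Euc d | debut Uᶜ p < ⊤} :=
    measurableSet_lt measurable_debut measurable_const
  rw [← hY.debutKernel_eq hYX hU, debutKernel_apply, Measure.map_apply measurable_debutValue hE,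
    Measure.restrict_apply hval, hY.pathKernel_apply,
    Measure.map_apply (hY.measurable_path x) (hval.inter hms), inter_comm]
  rfl

lemma isFiniteMeasure_harmonicMeasure (hX : IsLevyProcess X P) (U : Set (Euc d)) (x : Euc d) :
    IsFiniteMeasure (harmonicMeasure X P U x) := by
  have := hX.isProbabilityMeasure
  unfold harmonicMeasure
  infer_instance

lemma measurable_harmonicMeasure (hX : IsLevyProcess X P) {U : Set (Euc d)} (hU : IsOpen U) :
    Measurable (harmonicMeasure X P U) := by
  obtain ⟨κ, -, h, -⟩ := hX.exists_kernel
  rw [← funext (h U hU)]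
  exact (κ U).measurable

lemma bind_harmonicMeasure (hX : IsLevyProcess X P) {U V : Set (Euc d)} (hU : IsOpen U)
    (hV : IsOpen V) (hVU : V ⊆ U) (x : Euc d) :
    (harmonicMeasure X P V x).bind (harmonicMeasure X P U) = harmonicMeasure X P U x := by
  obtain ⟨κ, -, h, h2⟩ := hX.exists_kernel
  rw [← funext (h U hU), ← h V hV]
  exact h2 U V hU hV hVU x

lemma harmonicMeasure_univ_le_one (hX : IsLevyProcess X P) {U : Set (Euc d)} (hU : IsOpen U)
    (x : Euc d) : harmonicMeasure X P U x univ ≤ 1 := by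
  have := hX.isProbabilityMeasure
  obtain ⟨Y, -, h⟩ := hX.harmonicMeasure_eq_map
  rw [h U hU x univ MeasurableSet.univ]
  exact prob_le_one

lemma harmonicMeasure_le_one (hX : IsLevyProcess X P) {U : Set (Euc d)} (hU : IsOpen U)
    (x : Euc d) (E : Set (Euc d)) : harmonicMeasure X P U x E ≤ 1 :=
  (measure_mono (subset_univ E)).trans (hX.harmonicMeasure_univ_le_one hU x)

lemma harmonicMeasure_self (hX : IsLevyProcess X P) {U : Set (Euc d)} (hU : IsOpen U)
    (x : Euc d) : harmonicMeasure X P U x U = 0 := by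
  obtain ⟨Y, hY, h⟩ := hX.harmonicMeasure_eq_map
  rw [h U hU x U hU.measurableSet, measure_eq_zero_iff_ae_notMem]
  filter_upwards [hY.ae_mem_of_debut_eq hU.isClosed_compl x] with ω hω
  rintro ⟨h1, h2⟩
  obtain ⟨s, hs⟩ := WithTop.ne_top_iff_exists.1 h1.ne
  rw [(hY.rightCont_add x ω).debutValue_eq, ← hs] at h2
  exact hω s hs.symm h2

lemma harmonicMeasure_of_notMem (hX : IsLevyProcess X P) {U : Set (Euc d)} (hU : IsOpen U)
    {x : Euc d} (hx : x ∉ U) : harmonicMeasure X P U x = Measure.dirac x := by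
  have := hX.isProbabilityMeasure
  obtain ⟨Y, hY, h⟩ := hX.harmonicMeasure_eq_map
  ext E hE
  have h0 : ∀ ω, debut Uᶜ (fun t => x + Y t ω) = 0 := fun ω => by
    have := (hY.rightCont_add x ω).debut_le (F := Uᶜ) (t := 0) (by simpa [hY.start_zero] using hx)
    simpa using this
  rw [h U hU x E hE, Measure.dirac_apply' _ hE]
  have h1 : ∀ ω, debutValue Uᶜ (fun t => x + Y t ω) = x := fun ω => by
    rw [(hY.rightCont_add x ω).debutValue_eq, h0]
    simp [hY.start_zero]
  by_cases hxE : x ∈ E <;> simp [h0, h1, hxE]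

lemma harmonicMeasure_apply_bind (hX : IsLevyProcess X P) {U V : Set (Euc d)} (hU : IsOpen U)
    (hV : IsOpen V) (hVU : V ⊆ U) (x : Euc d) {E : Set (Euc d)} (hE : MeasurableSet E) :
    harmonicMeasure X P U x E = ∫⁻ z, harmonicMeasure X P U z E ∂harmonicMeasure X P V x := by
  conv_lhs => rw [← hX.bind_harmonicMeasure hU hV hVU x]
  rw [Measure.bind_apply hE (hX.measurable_harmonicMeasure hU).aemeasurable]

/-- Exit distributions from a smaller open set are dominated outside the larger one. -/
lemma harmonicMeasure_mono (hX : IsLevyProcess X P) {U V : Set (Euc d)} (hU : IsOpen U)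
    (hV : IsOpen V) (hVU : V ⊆ U) (x : Euc d) {E : Set (Euc d)} (hE : MeasurableSet E)
    (hEU : Disjoint E U) : harmonicMeasure X P V x E ≤ harmonicMeasure X P U x E := by
  rw [hX.harmonicMeasure_apply_bind hU hV hVU x hE, ← setLIntegral_one]
  refine (setLIntegral_mono' hE fun z hz => ?_).trans (setLIntegral_le_lintegral E _)
  rw [hX.harmonicMeasure_of_notMem hU (Set.disjoint_left.1 hEU hz)]
  simp [hz]

lemma harmonicMeasure_univ_anti (hX : IsLevyProcess X P) {U V : Set (Euc d)} (hU : IsOpen U)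
    (hV : IsOpen V) (hVU : V ⊆ U) (x : Euc d) :
    harmonicMeasure X P U x univ ≤ harmonicMeasure X P V x univ := by
  rw [hX.harmonicMeasure_apply_bind hU hV hVU x MeasurableSet.univ, ← lintegral_one]
  exact lintegral_mono fun z => hX.harmonicMeasure_univ_le_one hU z

/-- If the process can leave every ball then it leaves every ball almost surely. -/
lemma harmonicMeasure_ball_univ (hX : IsLevyProcess X P)
    (hpos : ∀ r : ℝ, 0 < r → harmonicMeasure X P (Metric.ball 0 r) 0 univ ≠ 0)
    (x : Euc d) {r : ℝ} (hr : 0 < r) : harmonicMeasure X P (Metric.ball x r) x univ = 1 := by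
  have := hX.isProbabilityMeasure
  obtain ⟨Y, hY, h⟩ := hX.harmonicMeasure_eq_map
  -- Otherwise the path is almost surely bounded by `2r` at all times of the dense set, hence at all
  -- times, and cannot leave the ball of radius `4r`.
  obtain ⟨q, hq⟩ : ∃ q : ℝ≥0, P {ω | 2 * r < ‖Y q ω‖} ≠ 0 := by
    by_contra! hcon
    refine hpos (4 * r) (by positivity) ?_
    rw [h _ Metric.isOpen_ball _ _ MeasurableSet.univ, measure_eq_zero_iff_ae_notMem]
    have h1 : ∀ᵐ ω ∂P, ∀ n, ω ∉ {ω | 2 * r < ‖Y (denseSeq ℝ≥0 n) ω‖} :=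
      ae_all_iff.2 fun n => measure_eq_zero_iff_ae_notMem.1 (hcon _)
    filter_upwards [hY.ae_mem_of_debut_eq (Metric.isOpen_ball (x := (0 : Euc d))
      (ε := 4 * r)).isClosed_compl 0, h1] with ω hω h1ω
    rintro ⟨h2, -⟩
    obtain ⟨s, hs⟩ := WithTop.ne_top_iff_exists.1 h2.ne
    have h3 := hω s hs.symm
    simp only [zero_add, mem_compl_iff, mem_ball_zero_iff, not_lt] at h3
    have hopen : IsOpen {y : Euc d | 2 * r < ‖y‖} := isOpen_lt continuous_const continuous_norm
    obtain ⟨n, hn, -⟩ := RightCont.exists_denseSeq (hY.rightCont ω) hopen (t := s)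
      (show 2 * r < ‖Y s ω‖ by linarith) (lt_add_one s)
    exact h1ω n hn
  have hqm : MeasurableSet {ω | 2 * r < ‖Y q ω‖} :=
    measurableSet_lt measurable_const (hY.measurable q).norm
  set A : Set (Euc d) := {y | ‖y‖ ≤ 2 * r} with hA
  have hAm : MeasurableSet A := measurableSet_le measurable_norm measurable_const
  have hlt : P (Y q ⁻¹' A) < 1 := by
    have : Y q ⁻¹' A = {ω | 2 * r < ‖Y q ω‖}ᶜ := by
      ext ω
      simp [hA]
    rw [this, prob_compl_eq_one_sub hqm]
    exact ENNReal.sub_lt_self ENNReal.one_ne_top one_ne_zero hq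
  have hmono : Monotone fun k : ℕ => (k : ℝ≥0) * q := fun i j hij => by
    simp only
    gcongr
  have hind := hY.indep_increments.nat hmono
  have hinc : ∀ k : ℕ, P ((fun ω => Y (((k + 1 : ℕ) : ℝ≥0) * q) ω - Y ((k : ℝ≥0) * q) ω) ⁻¹' A) =
      P (Y q ⁻¹' A) := fun k => by
    have h1 := (hY.identDistrib_increment (zero_le (a := q)) ((k : ℝ≥0) * q)).measure_mem_eq hAm
    simp only [add_zero, hY.start_zero, sub_zero] at h1
    rw [← h1]
    push_cast
    rw [add_mul, one_mul]
  rw [h _ Metric.isOpen_ball _ _ MeasurableSet.univ]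
  have hD : MeasurableSet {ω | debut (Metric.ball x r)ᶜ (fun t => x + Y t ω) < ⊤ ∧
      debutValue (Metric.ball x r)ᶜ (fun t => x + Y t ω) ∈ univ} := by
    simp only [mem_univ, and_true]
    exact measurableSet_lt (measurable_debut.comp (hY.measurable_path x)) measurable_const
  rw [← prob_compl_eq_zero_iff hD]
  -- A path that stays in the ball has all increments over the intervals `[kq, (k+1)q]` bounded by
  -- `2r`. These are independent, and each bound has the same probability `< 1`.
  refine le_antisymm (ge_of_tendsto' (ENNReal.tendsto_pow_atTop_nhds_zero_of_lt_one hlt)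
    fun N => ?_) zero_le
  have hprod := hind.measure_inter_preimage_eq_mul (Finset.range N) (sets := fun _ => A)
    (fun _ _ => hAm)
  simp only [hinc, Finset.prod_const, Finset.card_range] at hprod
  rw [← hprod]
  refine measure_mono fun ω hω => ?_
  simp only [mem_univ, and_true, mem_compl_iff, mem_ofPred_eq, not_lt, top_le_iff] at hω
  have hin : ∀ t, ‖Y t ω‖ < r := fun t => by
    by_contra hcon
    have := (hY.rightCont_add x ω).debut_le (F := (Metric.ball x r)ᶜ) (t := t) (by
      simpa [Metric.mem_ball, dist_eq_norm] using hcon)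
    rw [hω] at this
    simp at this
  refine mem_iInter₂.2 fun k _ => ?_
  change ‖_‖ ≤ 2 * r
  refine (norm_sub_le _ _).trans ?_
  linarith [hin (((k + 1 : ℕ) : ℝ≥0) * q), hin ((k : ℝ≥0) * q)]

end IsLevyProcess

end HarmonicMeasure

/-! ### Hitting probabilities, capacity and the Green function. -/

section Hitting

variable {d : ℕ} {Ω : Type*} [MeasurableSpace Ω] {X : ℝ≥0 → Ω → Euc d} {P : Measure Ω}
  {G : Euc d → Euc d → ℝ≥0∞} {g : ℝ≥0 → ℝ≥0∞}

lemma pow_mul_le_of_scaling {M₀ α₀ : ℝ≥0} (hα : 0 < α₀)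
    (h : ∀ r : ℝ≥0, 0 < r → (M₀ : ℝ≥0∞) * g r ≤ g (α₀ * r)) (k : ℕ) {r : ℝ≥0} (hr : 0 < r) :
    (M₀ : ℝ≥0∞) ^ k * g r ≤ g (α₀ ^ k * r) := by
  induction k with
  | zero => simp
  | succ k ih =>
    calc (M₀ : ℝ≥0∞) ^ (k + 1) * g r = M₀ * (M₀ ^ k * g r) := by ring
      _ ≤ M₀ * g (α₀ ^ k * r) := by gcongr
      _ ≤ g (α₀ * (α₀ ^ k * r)) := h _ (by positivity)
      _ = g (α₀ ^ (k + 1) * r) := by congr 1; ring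

/-- In the application `γ = g(2R)`, `σ = g(ρ)` at a large radius `ρ`, `b = g(R)`, `m = ‖μ‖` and `N =
‖ν‖`; `e` is the probability of ever hitting `A`, and `a` that of hitting it before leaving the
large ball. Half of `γN` absorbs the error `δ`, and half of the rest absorbs the late hits `cσN`. -/
lemma hitting_arith {c c₁ c_D γ m N σ b e a δ : ℝ} (hc : 0 < c) (hc₁ : 0 < c₁) (hcD : 0 < c_D)
    (hγ : 0 < γ) (hm : 0 < m) (hN : 0 ≤ N) (hmN : m ≤ c ^ 2 * N)
    (h1 : γ * N ≤ c * (c₁ * (c₁ * e + δ))) (h2 : 4 * c ^ 2 * c₁ ^ 2 * σ ≤ γ)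
    (h3 : e ≤ a + c * σ * N) (hb : b ≤ c_D * γ) (hδ : δ = γ * m / (2 * c ^ 3 * c₁)) :
    1 / (4 * c ^ 3 * c₁ ^ 2 * c_D) * b * m ≤ a := by
  have t1 : c * (c₁ * δ) ≤ γ * N / 2 := by
    rw [hδ, show c * (c₁ * (γ * m / (2 * c ^ 3 * c₁))) = γ * m / (2 * c ^ 2) by
      field_simp, div_le_div_iff₀ (by positivity) two_pos]
    have := mul_le_mul_of_nonneg_left hmN hγ.le
    linarith
  have t2 : γ * N ≤ 2 * c * c₁ ^ 2 * e := by linarith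
  have t4 : 4 * c * c₁ ^ 2 * (c * σ * N) ≤ γ * N := by
    have := mul_le_mul_of_nonneg_right h2 hN
    linarith
  have t5 : 4 * c * c₁ ^ 2 * e ≤ 4 * c * c₁ ^ 2 * (a + c * σ * N) :=
    mul_le_mul_of_nonneg_left h3 (by positivity)
  have t6 : γ * N ≤ 4 * c * c₁ ^ 2 * a := by linarith
  rw [one_div, inv_mul_eq_div, div_mul_eq_mul_div, div_le_iff₀ (by positivity)]
  calc b * m ≤ (c_D * γ) * (c ^ 2 * N) := mul_le_mul hb hmN hm.le (by positivity)
    _ = c_D * c ^ 2 * (γ * N) := by ring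
    _ ≤ c_D * c ^ 2 * (4 * c * c₁ ^ 2 * a) := mul_le_mul_of_nonneg_left t6 (by positivity)
    _ = _ := by ring

/-- The probability of hitting `A` before leaving a large ball is bounded below by the capacity
of `A`. -/
theorem exists_hitting_bound (hX : IsLevyProcess X P)
    (hG : Measurable (fun p : Euc d × Euc d => G p.1 p.2))
    (hG1 : PropertyG1 X P G) (hG2 : PropertyG2 G g) :
    ∃ (M η : ℝ≥0), 1 < M ∧ 0 < η ∧ ∀ (x : Euc d) (R : ℝ≥0), 0 < R → ∀ A : Set (Euc d),
      IsClosed A → A ⊆ Metric.ball x R → ∀ μ : Measure (Euc d), IsFiniteMeasure μ → μ Aᶜ = 0 →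
      (∀ z, potential G μ z ≤ 1) → ∀ y ∈ Metric.ball x R,
      η * g R * μ univ ≤ harmonicMeasure X P (Metric.ball x (M * R) \ A) y A := by
  obtain ⟨c₁, hc₁, hG1⟩ := hG1
  obtain ⟨hgpos, hganti, -, c, c_D, M₀, α₀, hc, hcD, hM₀, hα₀, hα₁, hscale, hGg⟩ := hG2
  have hGm : ∀ w, Measurable fun z => G w z := fun w => hG.comp measurable_prodMk_left
  have hgfin : ∀ r : ℝ≥0, 0 < r → g r ≠ ⊤ := fun r hr => ne_top_of_lt (hganti hr)
  have hc0 : (c : ℝ≥0∞) ≠ 0 := by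
    have := zero_lt_one.trans_le hc
    exact_mod_cast this.ne'
  have hgG : ∀ x y, g (nndist x y) ≤ c * G x y := fun x y => by
    have h := (hGg x y).1
    calc g (nndist x y) = c * ((c : ℝ≥0∞)⁻¹ * g (nndist x y)) := by
          rw [← mul_assoc, ENNReal.mul_inv_cancel hc0 ENNReal.coe_ne_top, one_mul]
      _ ≤ _ := by gcongr
  have hsymm : ∀ x y, G x y ≤ c ^ 2 * G y x := fun x y => by
    calc G x y ≤ c * g (nndist x y) := (hGg x y).2
      _ ≤ c * (c * G y x) := by
        gcongr
        rw [nndist_comm]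
        exact hgG y x
      _ = _ := by ring
  -- The number of scaling steps after which `g` has dropped so far below `g(2R)` that late hits are
  -- negligible. Then `M` is such that `(M - 1) R = ρ` satisfies `α₀ ^ k * ρ = 2R`.
  obtain ⟨k, hk⟩ : ∃ k : ℕ, 4 * c ^ 2 * c₁ ^ 2 < M₀ ^ k := pow_unbounded_of_one_lt _ hM₀
  have hc0' : 0 < c := zero_lt_one.trans_le hc
  have hc10' : 0 < c₁ := zero_lt_one.trans_le hc₁
  have hcD0' : 0 < c_D := zero_lt_one.trans_le hcD
  refine ⟨1 + 2 / α₀ ^ k, 1 / (4 * c ^ 3 * c₁ ^ 2 * c_D), ?_, by positivity, ?_⟩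
  · exact lt_add_of_pos_right _ (by positivity)
  intro x R hR A hA hAR μ hμ hμA hGμ y hy
  set M : ℝ≥0 := 1 + 2 / α₀ ^ k with hM
  have hM1 : (1 : ℝ) < M := by
    have : (1 : ℝ≥0) < M := lt_add_of_pos_right _ (by positivity)
    exact_mod_cast this
  have hR' : (0 : ℝ) < R := by exact_mod_cast hR
  rcases eq_or_ne (μ univ) 0 with hm0 | hm0
  · simp [hm0]
  set m : ℝ≥0 := (μ univ).toNNReal with hmdef
  have hm : (m : ℝ≥0∞) = μ univ := ENNReal.coe_toNNReal (measure_ne_top μ _)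
  have hmpos : 0 < m := ENNReal.toNNReal_pos hm0 (measure_ne_top μ _)
  have h2R : 0 < 2 * R := by positivity
  set γ : ℝ≥0 := (g (2 * R)).toNNReal with hγdef
  have hγ : (γ : ℝ≥0∞) = g (2 * R) := ENNReal.coe_toNNReal (hgfin _ h2R)
  have hγpos : 0 < γ := ENNReal.toNNReal_pos (hgpos _).ne' (hgfin _ h2R)
  -- The error admitted in (G₁) must be chosen before `ν` is known, hence in terms of `m`; `m ≤ c²
  -- N` then gives `c c₁ δ ≤ γN / 2`.
  set δ : ℝ≥0 := γ * m / (2 * c ^ 3 * c₁) with hδ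
  obtain ⟨B, ν, hB, -, hBR, hνB, hlt, hGν⟩ := hG1 (Metric.ball x R) Metric.isOpen_ball
    Metric.isBounded_ball y hy δ (by positivity) A hA hAR
  have hνae : ∀ᵐ w ∂ν, w ∈ Metric.ball x R := by
    have : ∀ᵐ w ∂ν, w ∈ B := hνB
    filter_upwards [this] with w hw using hBR hw
  -- lower bound of the potential in the ball
  have hlow : g (2 * R) * ν univ ≤ c * potential G ν y := by
    rw [potential, ← lintegral_const_mul _ (hGm _), ← lintegral_const]
    refine lintegral_mono_ae ?_
    filter_upwards [hνae] with w hw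
    refine (hganti.antitone ?_).trans (hgG y w)
    rw [← NNReal.coe_le_coe, coe_nndist]
    have := dist_triangle_right y w x
    simp only [Metric.mem_ball] at hy hw
    push_cast
    linarith
  have hεB := (hGν y).2
  have hB1 : reducedMeasure X P B y univ ≤ 1 := hX.harmonicMeasure_univ_le_one hB.isOpen_compl y
  have hNtop : ν univ ≠ ⊤ := by
    intro htop
    rw [htop, ENNReal.mul_top (hgpos _).ne'] at hlow
    have : (c : ℝ≥0∞) * potential G ν y ≤ c * (c₁ * 1) := by
      gcongr
      exact hεB.trans (by gcongr)
    exact (top_le_iff.1 (hlow.trans this)).not_lt (by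
      rw [mul_one]
      exact ENNReal.mul_lt_top ENNReal.coe_lt_top ENNReal.coe_lt_top)
  have : IsFiniteMeasure ν := ⟨hNtop.lt_top⟩
  set N : ℝ≥0 := (ν univ).toNNReal with hNdef
  have hN : (N : ℝ≥0∞) = ν univ := ENNReal.coe_toNNReal hNtop
  -- Duality: `Gν ≥ 1` on `A`, which carries `μ`, and `Gμ ≤ 1`; `G` is symmetric up to the factor
  -- `c²`.
  have hmN : m ≤ c ^ 2 * N := by
    rw [← ENNReal.coe_le_coe]
    push_cast
    rw [hm, hN]
    have hae : ∀ᵐ z ∂μ, z ∈ A := hμA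
    calc μ univ = ∫⁻ _, 1 ∂μ := lintegral_one.symm
      _ ≤ ∫⁻ z, potential G ν z ∂μ := by
          refine lintegral_mono_ae ?_
          filter_upwards [hae] with z hz
          refine le_trans ?_ (hGν z).1
          rw [reducedMeasure, hX.harmonicMeasure_of_notMem hA.isOpen_compl (by simpa using hz)]
          simp
      _ ≤ ∫⁻ z, ∫⁻ w, c ^ 2 * G w z ∂ν ∂μ :=
          lintegral_mono fun z => lintegral_mono fun w => hsymm z w
      _ = ∫⁻ w, ∫⁻ z, c ^ 2 * G w z ∂μ ∂ν :=
          lintegral_lintegral_swap ((hG.comp measurable_swap).const_mul _).aemeasurable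
      _ ≤ ∫⁻ w, c ^ 2 ∂ν := by
          refine lintegral_mono fun w => ?_
          rw [lintegral_const_mul _ (hGm _)]
          exact mul_le_of_le_one_right zero_le (hGμ w)
      _ = c ^ 2 * ν univ := lintegral_const _
  set e : ℝ≥0 := (reducedMeasure X P A y univ).toNNReal with hedef
  have hA1 : reducedMeasure X P A y univ ≤ 1 := hX.harmonicMeasure_univ_le_one hA.isOpen_compl y
  have he : (e : ℝ≥0∞) = reducedMeasure X P A y univ :=
    ENNReal.coe_toNNReal (ne_top_of_le_ne_top ENNReal.one_ne_top hA1)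
  have hkey1 : γ * N ≤ c * (c₁ * (c₁ * e + δ)) := by
    rw [← ENNReal.coe_le_coe]
    push_cast
    rw [hγ, hN, he]
    refine hlow.trans ?_
    gcongr
    refine hεB.trans ?_
    gcongr
  -- upper bound far away
  set ρ : ℝ≥0 := 2 / α₀ ^ k * R with hρ
  have hρpos : 0 < ρ := by positivity
  set σ : ℝ≥0 := (g ρ).toNNReal with hσdef
  have hσ : (σ : ℝ≥0∞) = g ρ := ENNReal.coe_toNNReal (hgfin _ hρpos)
  have hσγ : M₀ ^ k * σ ≤ γ := by
    rw [← ENNReal.coe_le_coe]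
    push_cast
    rw [hσ, hγ]
    refine (pow_mul_le_of_scaling hα₀ (fun r hr => (hscale r hr).2) k hρpos).trans (le_of_eq ?_)
    congr 1
    rw [hρ]
    field_simp
  have hfar : ∀ z ∉ Metric.ball x (M * R : ℝ), reducedMeasure X P A z univ ≤ (c * σ * N : ℝ≥0) := by
    intro z hz
    refine (hGν z).1.trans ?_
    push_cast
    rw [hN, hσ, potential, ← lintegral_const]
    refine lintegral_mono_ae ?_
    filter_upwards [hνae] with w hw
    refine (hGg z w).2.trans ?_
    gcongr
    refine hganti.antitone ?_
    rw [← NNReal.coe_le_coe, coe_nndist]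
    simp only [Metric.mem_ball, not_lt] at hw hz
    have h1 := dist_triangle z w x
    have h2 : (M * R : ℝ) = R + ρ := by
      rw [hM, hρ]
      push_cast
      ring
    linarith
  set V : Set (Euc d) := Metric.ball x (M * R : ℝ) \ A with hV
  have hVo : IsOpen V := Metric.isOpen_ball.sdiff hA
  -- At the exit from the large ball minus `A`, the process is in `A` or outside the large ball.
  -- From there, hitting `A` has probability at most `cσN` by `hfar`.
  have hsplit : reducedMeasure X P A y univ ≤
      harmonicMeasure X P V y A + (c * σ * N : ℝ≥0) := by
    rw [reducedMeasure, hX.harmonicMeasure_apply_bind hA.isOpen_compl hVo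
      (fun z hz => hz.2) y MeasurableSet.univ]
    have hVae : ∀ᵐ z ∂harmonicMeasure X P V y, z ∉ V :=
      measure_eq_zero_iff_ae_notMem.1 (hX.harmonicMeasure_self hVo y)
    calc ∫⁻ z, harmonicMeasure X P Aᶜ z univ ∂harmonicMeasure X P V y
        ≤ ∫⁻ z, A.indicator 1 z + (c * σ * N : ℝ≥0) ∂harmonicMeasure X P V y := by
          refine lintegral_mono_ae ?_
          filter_upwards [hVae] with z hz
          by_cases hzA : z ∈ A
          · rw [indicator_of_mem hzA]
            exact (hX.harmonicMeasure_univ_le_one hA.isOpen_compl z).trans le_self_add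
          · rw [indicator_of_notMem hzA, zero_add]
            exact hfar z fun h => hz ⟨h, hzA⟩
      _ = harmonicMeasure X P V y A +
            (c * σ * N : ℝ≥0) * harmonicMeasure X P V y univ := by
          rw [lintegral_add_right _ measurable_const, lintegral_indicator_one hA.measurableSet,
            lintegral_const]
      _ ≤ _ := by
          gcongr
          exact mul_le_of_le_one_right zero_le (hX.harmonicMeasure_univ_le_one hVo y)
  set a : ℝ≥0 := (harmonicMeasure X P V y A).toNNReal with hadef
  have ha : (a : ℝ≥0∞) = harmonicMeasure X P V y A :=
    ENNReal.coe_toNNReal (ne_top_of_le_ne_top ENNReal.one_ne_top (hX.harmonicMeasure_le_one hVo y A))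
  have hkey2 : e ≤ a + c * σ * N := by
    rw [← ENNReal.coe_le_coe, ENNReal.coe_add, he, ha]
    exact hsplit
  set b : ℝ≥0 := (g R).toNNReal with hbdef
  have hb : (b : ℝ≥0∞) = g R := ENNReal.coe_toNNReal (hgfin _ hR)
  have hbγ : b ≤ c_D * γ := by
    rw [← ENNReal.coe_le_coe]
    push_cast
    rw [hb, hγ]
    refine le_trans (le_of_eq ?_) (hscale (2 * R) h2R).1
    congr 1
    field_simp
  rw [← ha, ← hm, ← hb]
  norm_cast
  rw [← NNReal.coe_le_coe] at hmN hkey1 hσγ hkey2 hbγ ⊢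
  rw [← NNReal.coe_lt_coe] at hk
  have hδ' : (δ : ℝ) = γ * m / (2 * c ^ 3 * c₁) := by rw [hδ]; push_cast; rfl
  push_cast at hmN hkey1 hσγ hkey2 hbγ hk ⊢
  exact hitting_arith hc0' hc10' hcD0' hγpos hmpos N.2 hmN hkey1
    ((mul_le_mul_of_nonneg_right hk.le σ.2).trans hσγ) hkey2 hbγ hδ'

/-- Every universally measurable set or its complement contains a large compact part of a given
ball. -/
lemma exists_compact_subset_capacity (hG2 : PropertyG2 G g) {c₂ : ℝ≥0} (hc₂ : 1 ≤ c₂)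
    {x : Euc d} {r : ℝ≥0} (hr : 0 < r)
    (hcap : (c₂ : ℝ≥0∞)⁻¹ * (g r)⁻¹ ≤ capacity G (Metric.ball x r)) {S : Set (Euc d)}
    (hS : ∀ μ : Measure (Euc d), IsFiniteMeasure μ → NullMeasurableSet S μ) :
    ∃ A : Set (Euc d), IsCompact A ∧ A ⊆ Metric.ball x r ∧ (A ⊆ S ∨ A ⊆ Sᶜ) ∧
      ∃ μ : Measure (Euc d), IsFiniteMeasure μ ∧ μ Aᶜ = 0 ∧ (∀ z, potential G μ z ≤ 1) ∧
        1 ≤ (8 * c₂ : ℝ≥0) * g r * μ univ := by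
  have hgfin : g r ≠ ⊤ := ne_top_of_lt (hG2.2.1 hr)
  have hgpos : g r ≠ 0 := (hG2.1 r).ne'
  have hc₂0 : (c₂ : ℝ≥0∞) ≠ 0 := by
    have := zero_lt_one.trans_le hc₂
    exact_mod_cast this.ne'
  set q : ℝ≥0∞ := (c₂ : ℝ≥0∞)⁻¹ * (g r)⁻¹ with hq
  have hq0 : q ≠ 0 := mul_ne_zero (ENNReal.inv_ne_zero.2 ENNReal.coe_ne_top)
    (ENNReal.inv_ne_zero.2 hgfin)
  have hqtop : q ≠ ⊤ := ENNReal.mul_ne_top (ENNReal.inv_ne_top.2 hc₂0) (ENNReal.inv_ne_top.2 hgpos)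
  -- Half of the lower bound, since the supremum in the capacity need not be attained. Splitting the
  -- measure between `S` and its complement costs another factor `2`, and inner regularity makes the
  -- part compact.
  have hlt : q / 2 < capacity G (Metric.ball x r) := (ENNReal.half_lt_self hq0 hqtop).trans_le hcap
  obtain ⟨_, ⟨μ, hμ, hμb, hGμ, rfl⟩, hmq⟩ := lt_sSup_iff.1 hlt
  have hball : MeasurableSet (Metric.ball x (r : ℝ)) := measurableSet_ball
  have hor : q / 4 < μ (S ∩ Metric.ball x r) ∨ q / 4 < μ (Sᶜ ∩ Metric.ball x r) := by
    by_contra! hcon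
    have h1 : μ univ ≤ μ (S ∩ Metric.ball x r) + μ (Sᶜ ∩ Metric.ball x r) + μ (Metric.ball x r)ᶜ := by
      refine (measure_mono ?_).trans ((measure_union_le _ _).trans
        (add_le_add_left (measure_union_le _ _) _))
      intro z _
      by_cases hz : z ∈ Metric.ball x (r : ℝ) <;> by_cases hzS : z ∈ S <;> simp_all
    have h2 : μ univ ≤ q / 4 + q / 4 := by
      rw [hμb, add_zero] at h1
      exact h1.trans (add_le_add hcon.1 hcon.2)
    have h3 : q / 4 + q / 4 = q / 2 := by
      have h4 : (4 : ℝ≥0∞)⁻¹ + 4⁻¹ = 2⁻¹ := by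
        rw [show (4 : ℝ≥0∞) = 2 * 2 by norm_num, ENNReal.mul_inv (by simp) (by simp), ← mul_add,
          ENNReal.inv_two_add_inv_two, mul_one]
      rw [div_eq_mul_inv, ← mul_add, h4, div_eq_mul_inv]
    exact (h2.trans h3.le).not_gt hmq
  have hfinish : ∀ T : Set (Euc d), NullMeasurableSet T μ → q / 4 < μ (T ∩ Metric.ball x r) →
      ∃ A : Set (Euc d), IsCompact A ∧ A ⊆ Metric.ball x r ∧ A ⊆ T ∧
      ∃ μ : Measure (Euc d), IsFiniteMeasure μ ∧ μ Aᶜ = 0 ∧ (∀ z, potential G μ z ≤ 1) ∧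
        1 ≤ (8 * c₂ : ℝ≥0) * g r * μ univ := by
    intro T hT hlt
    obtain ⟨T', hT'T, hT'm, hT'e⟩ := (hT.inter hball.nullMeasurableSet).exists_measurable_subset_ae_eq
    rw [← measure_congr hT'e] at hlt
    obtain ⟨A, hAT', hA, hAlt⟩ := hT'm.exists_lt_isCompact hlt
    refine ⟨A, hA, fun z hz => (hT'T (hAT' hz)).2, fun z hz => (hT'T (hAT' hz)).1, μ.restrict A,
      inferInstance, ?_, fun z => ?_, ?_⟩
    · rw [Measure.restrict_apply hA.measurableSet.compl]
      simp
    · exact (lintegral_mono' Measure.restrict_le_self le_rfl).trans (hGμ z)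
    · rw [Measure.restrict_apply_univ]
      have h4 : ((8 * c₂ : ℝ≥0) : ℝ≥0∞) * g r * (q / 4) = 2 := by
        rw [hq]
        push_cast
        calc (8 : ℝ≥0∞) * c₂ * g r * ((c₂ : ℝ≥0∞)⁻¹ * (g r)⁻¹ / 4)
            = (c₂ * (c₂ : ℝ≥0∞)⁻¹) * (g r * (g r)⁻¹) * (8 / 4) := by
              simp only [div_eq_mul_inv]; ring
          _ = 2 := by
              rw [ENNReal.mul_inv_cancel hc₂0 ENNReal.coe_ne_top,
                ENNReal.mul_inv_cancel hgpos hgfin, one_mul, one_mul,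
                show (8 : ℝ≥0∞) = 2 * 4 by norm_num, ENNReal.mul_div_cancel_right (by simp) (by simp)]
      calc (1 : ℝ≥0∞) ≤ 2 := by norm_num
        _ = ((8 * c₂ : ℝ≥0) : ℝ≥0∞) * g r * (q / 4) := h4.symm
        _ ≤ _ := by gcongr
  rcases hor with h | h
  · obtain ⟨A, hA, hAb, hAS, hrest⟩ := hfinish S (hS μ hμ) h
    exact ⟨A, hA, hAb, Or.inl hAS, hrest⟩
  · obtain ⟨A, hA, hAb, hAS, hrest⟩ := hfinish Sᶜ (hS μ hμ).compl h
    exact ⟨A, hA, hAb, Or.inr hAS, hrest⟩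

/-- The hitting estimate used in the proofs of the Harnack inequality and of Hölder continuity:
a universally measurable set or its complement contains a compact part of a ball which is hit, from
any larger ball, with a probability that is controlled by `φ`. -/
def HittingEstimate (X : ℝ≥0 → Ω → Euc d) (P : Measure Ω) (φ : ℝ → ℝ) (M η : ℝ) : Prop :=
  ∀ (x : Euc d) (r : ℝ), 0 < r → ∀ S : Set (Euc d),
    (∀ μ : Measure (Euc d), IsFiniteMeasure μ → NullMeasurableSet S μ) →
    ∃ A : Set (Euc d), IsCompact A ∧ A ⊆ Metric.ball x r ∧ (A ⊆ S ∨ A ⊆ Sᶜ) ∧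
      ∀ (x' : Euc d) (R : ℝ), Metric.ball x r ⊆ Metric.ball x' R → 0 < R →
        ∀ y ∈ Metric.ball x' R,
          η * φ R ≤ φ r * (harmonicMeasure X P (Metric.ball x' (M * R) \ A) y).real A

/-- `φ` is a positive decreasing function on `(0, ∞)` with the doubling property. -/
structure IsScale (φ : ℝ → ℝ) (b : ℝ) : Prop where
  one_le : 1 ≤ b
  pos : ∀ r, 0 < r → 0 < φ r
  anti : ∀ r s, 0 < r → r ≤ s → φ s ≤ φ r
  doubling : ∀ r, 0 < r → φ (r / 2) ≤ b * φ r

/-- By (G₃), the set `A` chosen above carries a measure with potential at most `1` and mass of order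
at least `1 / g(r)`. Inserting this mass in `exists_hitting_bound` gives the ratio `g(R) / g(r)`. -/
theorem exists_hittingEstimate (hX : IsLevyProcess X P)
    (hG : Measurable (fun p : Euc d × Euc d => G p.1 p.2))
    (hG1 : PropertyG1 X P G) (hG2 : PropertyG2 G g) (hG3 : PropertyG3 G g) :
    ∃ (φ : ℝ → ℝ) (M η b : ℝ), 1 < M ∧ 0 < η ∧ IsScale φ b ∧ HittingEstimate X P φ M η := by
  obtain ⟨M, η, hM, hη, hhit⟩ := exists_hitting_bound hX hG hG1 hG2
  obtain ⟨c₂, hc₂, hcap⟩ := hG3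
  obtain ⟨hgpos, hganti, -, c, c_D, M₀, α₀, hc, hcD, -, -, -, hscale, -⟩ := id hG2
  have hgfin : ∀ r : ℝ≥0, 0 < r → g r ≠ ⊤ := fun r hr => ne_top_of_lt (hganti hr)
  have hc₂0 : 0 < c₂ := zero_lt_one.trans_le hc₂
  refine ⟨fun r => (g r.toNNReal).toReal, M, η / (8 * c₂), c_D, by exact_mod_cast hM,
    by positivity, ⟨by exact_mod_cast hcD, fun r hr => ?_, fun r s hr hrs => ?_, fun r hr => ?_⟩, ?_⟩
  · exact ENNReal.toReal_pos (hgpos _).ne' (hgfin _ (Real.toNNReal_pos.2 hr))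
  · exact ENNReal.toReal_mono (hgfin _ (Real.toNNReal_pos.2 hr))
      (hganti.antitone (Real.toNNReal_le_toNNReal hrs))
  · have hr' : 0 < r.toNNReal := Real.toNNReal_pos.2 hr
    have h1 := (hscale _ hr').1
    have h2 : (r / 2).toNNReal = r.toNNReal / 2 := by
      rw [Real.toNNReal_div hr.le]
      simp
    have h3 := ENNReal.toReal_mono (ENNReal.mul_ne_top ENNReal.coe_ne_top (hgfin _ hr')) h1
    rw [ENNReal.toReal_mul] at h3
    simpa [h2] using h3
  · intro x r hr S hS
    lift r to ℝ≥0 using hr.le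
    have hr' : 0 < r := by exact_mod_cast hr
    obtain ⟨A, hA, hAb, hAS, μ, hμ, hμA, hGμ, hμ1⟩ :=
      exists_compact_subset_capacity hG2 hc₂ hr' (hcap x r hr') hS
    refine ⟨A, hA, hAb, hAS, fun x' R hsub hR y hy => ?_⟩
    lift R to ℝ≥0 using hR.le
    have hR' : 0 < R := by exact_mod_cast hR
    have h1 := hhit x' R hR' A hA.isClosed (hAb.trans hsub) μ hμ hμA hGμ y hy
    have hVo : IsOpen (Metric.ball x' (M * R : ℝ) \ A) := Metric.isOpen_ball.sdiff hA.isClosed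
    have hfin := ne_top_of_le_ne_top ENNReal.one_ne_top (hX.harmonicMeasure_le_one hVo y A)
    have h2 := ENNReal.toReal_mono hfin h1
    rw [ENNReal.toReal_mul, ENNReal.toReal_mul] at h2
    have h3 := ENNReal.toReal_mono (ENNReal.mul_ne_top (ENNReal.mul_ne_top ENNReal.coe_ne_top
      (hgfin r hr')) (measure_ne_top μ univ)) hμ1
    rw [ENNReal.toReal_mul, ENNReal.toReal_mul] at h3
    simp only [ENNReal.toReal_one, ENNReal.coe_toReal, Real.toNNReal_coe] at h2 h3 ⊢
    push_cast at h3
    change _ ≤ _ * (harmonicMeasure X P (Metric.ball x' (M * R : ℝ) \ A) y A).toReal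
    have pg : 0 < (g r).toReal := ENNReal.toReal_pos (hgpos _).ne' (hgfin _ hr')
    have pg' : 0 ≤ (g R).toReal := ENNReal.toReal_nonneg
    have pη : (0 : ℝ) < η := hη
    have pc : (0 : ℝ) < c₂ := hc₂0
    rw [div_mul_eq_mul_div, div_le_iff₀ (by positivity)]
    calc (η : ℝ) * (g R).toReal ≤ η * (g R).toReal * (8 * c₂ * (g r).toReal * (μ univ).toReal) :=
          le_mul_of_one_le_right (by positivity) h3
      _ = 8 * c₂ * (g r).toReal * (η * (g R).toReal * (μ univ).toReal) := by ring
      _ ≤ 8 * c₂ * (g r).toReal *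
          (harmonicMeasure X P (Metric.ball x' (M * R : ℝ) \ A) y A).toReal := by gcongr
      _ = _ := by ring

end Hitting

/-! ### Comparison of exit distributions far away. -/

section Jumps

variable {d : ℕ} {Ω : Type*} {X : ℝ≥0 → Ω → Euc d}

/-- All starting points are realised by translating the same path, so the exit time from a ball
about the starting point depends on the radius only. -/
lemma exitTime_ball_le (X : ℝ≥0 → Ω → Euc d) (x y : Euc d) {r r' : ℝ} (h : r ≤ r') (ω : Ω) :
    exitTime X x (Metric.ball x r) ω ≤ exitTime X y (Metric.ball y r') ω := by
  by_cases htop : exitTime X y (Metric.ball y r') ω = ⊤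
  · rw [htop]; exact le_top
  refine le_of_not_gt fun hlt => ?_
  rw [exitTime, hittingAfter_eq_top_iff] at htop
  push Not at htop
  have hlt' : hittingAfter (startedAt X y) (Metric.ball y r')ᶜ 0 ω <
    exitTime X x (Metric.ball x r) ω := hlt
  obtain ⟨j, hj, hjm⟩ := htop
  rw [hittingAfter_def] at hlt'
  have hex : ∃ j : ℝ≥0, 0 ≤ j ∧ startedAt X y j ω ∈ (Metric.ball y r')ᶜ := ⟨j, hj, hjm⟩
  simp only [if_pos hex] at hlt'
  by_cases htop' : exitTime X x (Metric.ball x r) ω = ⊤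
  · rw [exitTime, hittingAfter_eq_top_iff] at htop'
    refine htop' j hj fun hmem => hjm ?_
    simp only [startedAt, Metric.mem_ball, dist_eq_norm, add_sub_cancel_left] at hmem ⊢
    exact hmem.trans_le h
  obtain ⟨s, hs⟩ := WithTop.ne_top_iff_exists.1 htop'
  rw [← hs] at hlt'
  have hlt2 : sInf {i : ℝ≥0 | 0 ≤ i ∧ startedAt X y i ω ∈ (Metric.ball y r')ᶜ} < s :=
    WithTop.coe_lt_coe.1 hlt'
  obtain ⟨i, hi, his⟩ := exists_lt_of_csInf_lt
    (⟨j, hj, hjm⟩ : Set.Nonempty {i : ℝ≥0 | 0 ≤ i ∧ startedAt X y i ω ∈ (Metric.ball y r')ᶜ}) hlt2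
  refine notMem_of_lt_hittingAfter (u := startedAt X x) (s := (Metric.ball x r)ᶜ) (n := 0) (ω := ω)
    (k := i) (lt_of_lt_of_eq (WithTop.coe_lt_coe.2 his) hs) zero_le fun hmem => hi.2 ?_
  simp only [startedAt, Metric.mem_ball, dist_eq_norm, add_sub_cancel_left] at hmem ⊢
  exact hmem.trans_le h

lemma startedAt_mem_of_lt_exitTime {x : Euc d} {U : Set (Euc d)} {u : ℝ≥0} {ω : Ω}
    (h : (u : WithTop ℝ≥0) < exitTime X x U ω) : startedAt X x u ω ∈ U := by
  have := notMem_of_lt_hittingAfter h zero_le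
  simpa using this

variable [MeasurableSpace Ω] {P : Measure Ω}

/-- Exit distributions of balls are comparable far away from the balls. -/
def JumpEstimate (X : ℝ≥0 → Ω → Euc d) (P : Measure Ω) (L C : ℝ) : Prop :=
  ∀ (x₀ x y : Euc d) (s r r' : ℝ), 0 < r → r ≤ r' → Metric.ball x r ⊆ Metric.ball x₀ s →
    Metric.ball y r' ⊆ Metric.ball x₀ s → ∀ A : Set (Euc d), MeasurableSet A →
    Disjoint A (Metric.ball x₀ (L * s)) →
    harmonicMeasure X P (Metric.ball x r) x A ≤
      ENNReal.ofReal C * harmonicMeasure X P (Metric.ball y r') y A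

/-- In the Lévy-system formula the time intervals compare pathwise by `exitTime_ball_le`, and both
densities compare with `n (z - x₀)`; each comparison costs a factor `c_J`, whence `C = c_J²`. -/
theorem exists_jumpEstimate {n : Euc d → ℝ≥0∞} (hsys : HasLevySystemDensity X P n)
    (hnJ : ∃ (α : ℝ) (c_J : ℝ≥0), 0 < α ∧ α < 1 / 2 ∧ 1 ≤ c_J ∧
      ∀ y z : Euc d, ‖y‖ < 2 * α * ‖z‖ → n z ≤ c_J * n (z + y)) :
    ∃ L C : ℝ, 1 < L ∧ 1 ≤ C ∧ JumpEstimate X P L C := by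
  obtain ⟨α, c_J, hα, hα2, hcJ, hn⟩ := hnJ
  have hcJ' : (1 : ℝ) ≤ c_J := by exact_mod_cast hcJ
  refine ⟨1 + 1 / α, c_J ^ 2, by simpa using hα, one_le_pow₀ hcJ', ?_⟩
  intro x₀ x y s r r' hr hrr' hx hy A hA hdisj
  have hs : 0 < s := by
    have := hx (Metric.mem_ball_self hr)
    exact dist_nonneg.trans_lt this
  have hα' : 0 < 1 / α := by positivity
  have hcl : ∀ {z : Euc d} {t : ℝ}, Metric.ball z t ⊆ Metric.ball x₀ s →
      A ⊆ (closure (Metric.ball z t))ᶜ := by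
    intro z t hzt a ha hcl
    have h1 : a ∈ Metric.closedBall x₀ s :=
      (closure_mono hzt).trans Metric.closure_ball_subset_closedBall hcl
    refine Set.disjoint_left.1 hdisj ha ?_
    simp only [Metric.mem_closedBall, Metric.mem_ball] at h1 ⊢
    nlinarith
  -- With `L = 1 + 1/α` one has `|z - w| > s/α` on `A`, so `|w - w'| < 2s < 2α |z - w|`, exactly the
  -- range in which `n` is controlled.
  have hcomp : ∀ w ∈ Metric.ball x₀ s, ∀ w' ∈ Metric.ball x₀ s, ∀ z ∈ A,
      n (z - w) ≤ c_J * n (z - w') := by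
    intro w hw w' hw' z hz
    have h1 : z ∉ Metric.ball x₀ ((1 + 1 / α) * s) := Set.disjoint_left.1 hdisj hz
    simp only [Metric.mem_ball, not_lt] at hw hw' h1
    have h2 : z - w' = z - w + (w - w') := by abel
    rw [h2]
    refine hn _ _ ?_
    rw [← dist_eq_norm, ← dist_eq_norm]
    have h3 := dist_triangle_right w w' x₀
    have h4 := dist_triangle z w x₀
    have h5 : s / α < dist z w := by
      have : (1 + 1 / α) * s = s + s / α := by ring
      linarith
    rw [div_lt_iff₀ hα] at h5
    nlinarith
  rw [hsys x r hr A hA (hcl hx), hsys y r' (hr.trans_le hrr') A hA (hcl hy)]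
  have hC : ENNReal.ofReal ((c_J : ℝ) ^ 2) = (c_J : ℝ≥0∞) ^ 2 := by
    rw [ENNReal.ofReal_pow (NNReal.coe_nonneg c_J), ENNReal.ofReal_coe_nnreal]
  have hCtop : (c_J : ℝ≥0∞) ^ 2 ≠ ⊤ := ENNReal.pow_ne_top ENNReal.coe_ne_top
  rw [hC, ← lintegral_const_mul' _ _ hCtop]
  refine lintegral_mono fun ω => ?_
  set I : ℝ≥0∞ := ∫⁻ z in A, n (z - x₀) with hI
  have hx0 : x₀ ∈ Metric.ball x₀ s := Metric.mem_ball_self hs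
  set E₁ : Set ℝ := {u : ℝ | 0 ≤ u ∧
    ((u.toNNReal : ℝ≥0) : WithTop ℝ≥0) < exitTime X x (Metric.ball x r) ω} with hE₁
  set E₂ : Set ℝ := {u : ℝ | 0 ≤ u ∧
    ((u.toNNReal : ℝ≥0) : WithTop ℝ≥0) < exitTime X y (Metric.ball y r') ω} with hE₂
  have hE : E₁ ⊆ E₂ := fun u hu => ⟨hu.1, hu.2.trans_le (exitTime_ball_le X x y hrr' ω)⟩
  have hE₁m : MeasurableSet E₁ := by
    have : OrdConnected E₁ := ⟨fun a ha b hb u hu => ⟨ha.1.trans hu.1,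
      lt_of_le_of_lt (WithTop.coe_le_coe.2 (Real.toNNReal_le_toNNReal hu.2)) hb.2⟩⟩
    exact this.measurableSet
  have hE₂m : MeasurableSet E₂ := by
    have : OrdConnected E₂ := ⟨fun a ha b hb u hu => ⟨ha.1.trans hu.1,
      lt_of_le_of_lt (WithTop.coe_le_coe.2 (Real.toNNReal_le_toNNReal hu.2)) hb.2⟩⟩
    exact this.measurableSet
  have hcc : (c_J : ℝ≥0∞) ≠ ⊤ := ENNReal.coe_ne_top
  calc ∫⁻ u in E₁, ∫⁻ z in A, n (z - startedAt X x u.toNNReal ω)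
      ≤ ∫⁻ u in E₁, c_J * I := by
        refine setLIntegral_mono' hE₁m fun u hu => ?_
        rw [hI, ← lintegral_const_mul' _ _ hcc]
        exact setLIntegral_mono' hA fun z hz =>
          hcomp _ (hx (startedAt_mem_of_lt_exitTime hu.2)) _ hx0 z hz
    _ ≤ ∫⁻ u in E₂, c_J * I := lintegral_mono_set hE
    _ ≤ ∫⁻ u in E₂, c_J ^ 2 * ∫⁻ z in A, n (z - startedAt X y u.toNNReal ω) := by
        refine setLIntegral_mono' hE₂m fun u hu => ?_
        rw [sq, mul_assoc]
        gcongr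
        rw [hI, ← lintegral_const_mul' _ _ hcc]
        exact setLIntegral_mono' hA fun z hz =>
          hcomp _ hx0 _ (hy (startedAt_mem_of_lt_exitTime hu.2)) z hz
    _ = _ := by rw [lintegral_const_mul' _ _ hCtop]

end Jumps

/-! ### Tails of exit distributions. -/

section Tails

variable {d : ℕ} {Ω : Type*} [MeasurableSpace Ω] {X : ℝ≥0 → Ω → Euc d} {P : Measure Ω}
  {φ : ℝ → ℝ} {M η b L C : ℝ}

lemma IsScale.le_four (hφ : IsScale φ b) {r : ℝ} (hr : 0 < r) : φ r ≤ b ^ 2 * φ (4 * r) := by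
  have h1 := hφ.doubling (2 * r) (by positivity)
  have h2 := hφ.doubling (4 * r) (by positivity)
  rw [show 2 * r / 2 = r by ring] at h1
  rw [show 4 * r / 2 = 2 * r by ring] at h2
  have hb : 0 ≤ b := zero_le_one.trans hφ.one_le
  calc φ r ≤ b * φ (2 * r) := h1
    _ ≤ b * (b * φ (4 * r)) := by gcongr
    _ = _ := by ring

lemma Euc.exists_dist_eq (hd : 1 ≤ d) (x : Euc d) {r : ℝ} (hr : 0 ≤ r) :
    ∃ y : Euc d, dist y x = r := by
  refine ⟨x + EuclideanSpace.single ⟨0, hd⟩ r, ?_⟩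
  rw [dist_eq_norm, add_sub_cancel_left, PiLp.norm_single, Real.norm_of_nonneg hr]

/-- With a probability bounded from below, the process leaves a ball without a very large jump. -/
theorem exists_exit_near (hX : IsLevyProcess X P) (hd : 1 ≤ d) (hM : 1 < M) (hη : 0 < η)
    (hφ : IsScale φ b) (hH : HittingEstimate X P φ M η) :
    ∃ L₁ η₁ : ℝ, 1 < L₁ ∧ 0 < η₁ ∧ ∀ (x : Euc d) (r : ℝ), 0 < r →
      η₁ ≤ (harmonicMeasure X P (Metric.ball x r) x).real (Metric.ball x (L₁ * r)) := by
  have hb := hφ.one_le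
  refine ⟨4 * M + 2, η / b ^ 2, by linarith, by positivity, fun x r hr => ?_⟩
  -- The balls of radius `r` about `x` and `x'` are disjoint. So in order to hit `A` near `x'`
  -- before leaving the ball of radius `4Mr` about `x'`, the process must leave the ball about `x`
  -- without jumping further than `(4M + 2) r` from `x`.
  obtain ⟨x', hx'⟩ := Euc.exists_dist_eq hd x (show 0 ≤ 2 * r by positivity)
  obtain ⟨A, hA, hAb, -, hhit⟩ := hH x' r hr univ fun _ _ => nullMeasurableSet_univ
  have hxb : x ∈ Metric.ball x' (4 * r) := by
    rw [Metric.mem_ball, dist_comm, hx']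
    linarith
  have h1 := hhit x' (4 * r) (Metric.ball_subset_ball (by linarith)) (by positivity) x hxb
  set W : Set (Euc d) := Metric.ball x' (M * (4 * r)) \ A with hW
  have hWo : IsOpen W := Metric.isOpen_ball.sdiff hA.isClosed
  have hsub : Metric.ball x r ⊆ W := by
    intro z hz
    rw [Metric.mem_ball] at hz
    refine ⟨?_, fun hzA => ?_⟩
    · rw [Metric.mem_ball]
      have := dist_triangle_right z x' x
      nlinarith
    · have h2 := hAb hzA
      rw [Metric.mem_ball] at h2
      have := dist_triangle_left x' x z
      linarith
  have hle : harmonicMeasure X P W x A ≤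
      harmonicMeasure X P (Metric.ball x r) x (Metric.ball x ((4 * M + 2) * r)) := by
    rw [hX.harmonicMeasure_apply_bind hWo Metric.isOpen_ball hsub x hA.measurableSet,
      ← lintegral_indicator_one measurableSet_ball]
    refine lintegral_mono fun z => ?_
    by_cases hz : z ∈ Metric.ball x ((4 * M + 2) * r)
    · rw [indicator_of_mem hz]
      exact hX.harmonicMeasure_le_one hWo z A
    · rw [indicator_of_notMem hz]
      have hzb : z ∉ Metric.ball x' (M * (4 * r)) := fun h => hz (by
        rw [Metric.mem_ball] at h ⊢
        have := dist_triangle z x' x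
        linarith)
      have hzA : z ∉ A := fun h => hzb (Metric.ball_subset_ball (by nlinarith) (hAb h))
      rw [hX.harmonicMeasure_of_notMem hWo fun h => hzb h.1, Measure.dirac_apply' _ hA.measurableSet,
        indicator_of_notMem hzA]
  have := hX.isFiniteMeasure_harmonicMeasure (Metric.ball x r) x
  have h2 : (harmonicMeasure X P W x).real A ≤
      (harmonicMeasure X P (Metric.ball x r) x).real (Metric.ball x ((4 * M + 2) * r)) :=
    ENNReal.toReal_mono (measure_ne_top _ _) hle
  refine le_trans ?_ h2
  have h4 := hφ.le_four hr
  have p4 := hφ.pos (4 * r) (by positivity)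
  rw [div_le_iff₀ (by positivity)]
  refine le_of_mul_le_mul_right ?_ p4
  calc η * φ (4 * r) ≤ φ r * (harmonicMeasure X P W x).real A := h1
    _ ≤ b ^ 2 * φ (4 * r) * (harmonicMeasure X P W x).real A := by gcongr
    _ = _ := by ring

/-- The process leaves bounded open sets almost surely. -/
lemma harmonicMeasure_univ_of_bounded (hX : IsLevyProcess X P) {L₁ η₁ : ℝ} (hη₁ : 0 < η₁)
    (hE : ∀ (x : Euc d) (r : ℝ), 0 < r →
      η₁ ≤ (harmonicMeasure X P (Metric.ball x r) x).real (Metric.ball x (L₁ * r)))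
    {W : Set (Euc d)} (hW : IsOpen W) (hWb : Bornology.IsBounded W) (y : Euc d) :
    harmonicMeasure X P W y univ = 1 := by
  obtain ⟨r, hr, hWr⟩ := hWb.subset_ball_lt 0 y
  refine le_antisymm (hX.harmonicMeasure_univ_le_one hW y) ?_
  rw [← hX.harmonicMeasure_ball_univ (fun r hr h0 => ?_) y hr]
  · exact hX.harmonicMeasure_univ_anti Metric.isOpen_ball hW hWr y
  · have h1 := hE 0 r hr
    have h2 : (harmonicMeasure X P (Metric.ball 0 r) 0).real (Metric.ball 0 (L₁ * r)) = 0 := by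
      rw [measureReal_def, measure_mono_null (subset_univ _) h0, ENNReal.toReal_zero]
    linarith

/-- Geometric decay of the exit distributions of a ball. -/
lemma harmonicMeasure_tail (hX : IsLevyProcess X P) (hC : 1 ≤ C) (hL : 1 < L)
    (hJ : JumpEstimate X P L C) {L₁ η₁ : ℝ} (hL₁ : 1 < L₁)
    (hη₁ : 0 < η₁) (hE : ∀ (x : Euc d) (r : ℝ), 0 < r →
      η₁ ≤ (harmonicMeasure X P (Metric.ball x r) x).real (Metric.ball x (L₁ * r)))
    (x : Euc d) (i : ℕ) : ∀ (r t : ℝ), 0 < r → L * ((2 * L₁) ^ i * r) ≤ t →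
      (1 + η₁ / C) ^ i * (harmonicMeasure X P (Metric.ball x r) x).real (Metric.ball x t)ᶜ ≤ 1 := by
  induction i with
  | zero =>
    intro r t _ _
    rw [pow_zero, one_mul]
    exact ENNReal.toReal_le_of_le_ofReal zero_le_one
      (by simpa using hX.harmonicMeasure_le_one Metric.isOpen_ball x _)
  | succ i ih =>
    intro r t hr ht
    set A : Set (Euc d) := (Metric.ball x t)ᶜ with hA
    have hAm : MeasurableSet A := measurableSet_ball.compl
    set R : ℝ := 2 * L₁ * r with hR
    have hR0 : 0 < R := by positivity
    have hrR : r ≤ R := by nlinarith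
    have hRt : L * ((2 * L₁) ^ i * R) ≤ t := by
      rw [hR]
      refine le_trans (le_of_eq ?_) ht
      ring
    have hone : (1 : ℝ) ≤ (2 * L₁) ^ i := one_le_pow₀ (by linarith)
    have hLRt : L * R ≤ t := by
      refine le_trans ?_ hRt
      gcongr
      exact le_mul_of_one_le_left hR0.le hone
    have hRt' : R ≤ t := by nlinarith
    set μ := harmonicMeasure X P (Metric.ball x r) x with hμ
    have := hX.isFiniteMeasure_harmonicMeasure (Metric.ball x r) x
    have := hX.isFiniteMeasure_harmonicMeasure (Metric.ball x R) x
    have hCpos : 0 < C := zero_lt_one.trans_le hC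
    -- There are two disjoint ways of leaving the ball of radius `R = 2L₁r` into `A`: directly upon
    -- leaving the ball of radius `r`, or after landing at some `z` within `L₁r`. The ball of radius
    -- `L₁r` about `z` is still inside, and by the jump estimate its exit distribution charges `A`
    -- with at least `μ A / C`. Thus enlarging the radius multiplies the mass of `A` by `1 + η₁/C`,
    -- while it never exceeds `1`.
    have hstep : μ A + (ENNReal.ofReal C)⁻¹ * μ A * μ (Metric.ball x (L₁ * r)) ≤
        harmonicMeasure X P (Metric.ball x R) x A := by
      rw [hX.harmonicMeasure_apply_bind Metric.isOpen_ball Metric.isOpen_ball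
        (Metric.ball_subset_ball hrR) x hAm]
      have h1 : μ A + (ENNReal.ofReal C)⁻¹ * μ A * μ (Metric.ball x (L₁ * r)) =
          ∫⁻ z, A.indicator 1 z +
            (Metric.ball x (L₁ * r)).indicator (fun _ => (ENNReal.ofReal C)⁻¹ * μ A) z ∂μ := by
        rw [lintegral_add_left (measurable_one.indicator hAm), lintegral_indicator_one hAm,
          lintegral_indicator_const measurableSet_ball]
      rw [h1]
      refine lintegral_mono fun z => ?_
      by_cases hzA : z ∈ A
      · have hzb : z ∉ Metric.ball x (L₁ * r) := fun h =>
          hzA (Metric.ball_subset_ball (by nlinarith) h)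
        rw [indicator_of_mem hzA, indicator_of_notMem hzb, add_zero,
          hX.harmonicMeasure_of_notMem Metric.isOpen_ball
            (fun h => hzA (Metric.ball_subset_ball hRt' h)), Measure.dirac_apply' _ hAm,
          indicator_of_mem hzA]
      · rw [indicator_of_notMem hzA, zero_add]
        by_cases hzb : z ∈ Metric.ball x (L₁ * r)
        · rw [indicator_of_mem hzb]
          have hsub : Metric.ball z (L₁ * r) ⊆ Metric.ball x R := by
            refine Metric.ball_subset_ball' ?_
            rw [Metric.mem_ball] at hzb
            rw [hR]
            linarith
          have hdisj : ∀ {u}, u ≤ t → Disjoint A (Metric.ball x u) := fun hu =>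
            Set.disjoint_left.2 fun a ha hb => ha (Metric.ball_subset_ball hu hb)
          have h2 := hJ x x z R r (L₁ * r) hr (by nlinarith) (Metric.ball_subset_ball hrR) hsub A
            hAm (hdisj hLRt)
          have h3 := hX.harmonicMeasure_mono Metric.isOpen_ball Metric.isOpen_ball hsub z hAm
            (hdisj hRt')
          rw [ENNReal.inv_mul_le_iff (by simpa using hCpos) ENNReal.ofReal_ne_top]
          exact h2.trans (by gcongr)
        · rw [indicator_of_notMem hzb]
          exact zero_le
    have hreal : (1 + η₁ / C) * μ.real A ≤ (harmonicMeasure X P (Metric.ball x R) x).real A := by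
      have h2 := ENNReal.toReal_mono (measure_ne_top _ _) hstep
      rw [ENNReal.toReal_add (measure_ne_top _ _) (ENNReal.mul_ne_top (ENNReal.mul_ne_top
        (ENNReal.inv_ne_top.2 (by simpa using hCpos)) (measure_ne_top _ _)) (measure_ne_top _ _)),
        ENNReal.toReal_mul, ENNReal.toReal_mul, ENNReal.toReal_inv,
        ENNReal.toReal_ofReal hCpos.le] at h2
      refine le_trans ?_ h2
      have h3 := hE x r hr
      change _ ≤ μ.real A + C⁻¹ * μ.real A * μ.real (Metric.ball x (L₁ * r))
      have h4 : C⁻¹ * μ.real A * η₁ ≤ C⁻¹ * μ.real A * μ.real (Metric.ball x (L₁ * r)) := by gcongr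
      calc (1 + η₁ / C) * μ.real A = μ.real A + C⁻¹ * μ.real A * η₁ := by field_simp
        _ ≤ _ := by linarith
    calc (1 + η₁ / C) ^ (i + 1) * μ.real A = (1 + η₁ / C) ^ i * ((1 + η₁ / C) * μ.real A) := by ring
      _ ≤ (1 + η₁ / C) ^ i * (harmonicMeasure X P (Metric.ball x R) x).real A := by gcongr
      _ ≤ 1 := ih R t hR0 hRt

/-- Exit distributions of subsets of a ball charge the complements of large concentric balls only
little. -/
theorem exists_tail (hX : IsLevyProcess X P) (hM : 1 < M) (hC : 1 ≤ C) (hL : 1 < L)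
    (hJ : JumpEstimate X P L C) {L₁ η₁ : ℝ} (hL₁ : 1 < L₁)
    (hη₁ : 0 < η₁) (hE : ∀ (x : Euc d) (r : ℝ), 0 < r →
      η₁ ≤ (harmonicMeasure X P (Metric.ball x r) x).real (Metric.ball x (L₁ * r)))
    {θ : ℝ} (hθ : 0 < θ) :
    ∃ K : ℝ, 4 ≤ K ∧ M < K ∧ ∀ (x : Euc d) (r : ℝ), 0 < r → ∀ y ∈ Metric.ball x r,
      ∀ W : Set (Euc d), IsOpen W → W ⊆ Metric.ball x (M * r) → ∀ i : ℕ, 1 ≤ i →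
        (harmonicMeasure X P W y).real (Metric.ball x (K ^ i * r))ᶜ ≤ θ ^ i := by
  have hCpos : 0 < C := zero_lt_one.trans_le hC
  have hq : 1 < 1 + η₁ / C := by
    have : 0 < η₁ / C := by positivity
    linarith
  -- Each factor `K` leaves room for `p` enlargements of the radius, which together gain a factor
  -- `1/θ`; the remaining `4ML` in `K` pays for `W` being compared with the ball of radius `2Mr`
  -- about `y`.
  obtain ⟨p, hp⟩ := pow_unbounded_of_one_lt (1 / θ) hq
  have h2L : (1 : ℝ) ≤ 2 * L₁ := by linarith
  have hpow : (1 : ℝ) ≤ (2 * L₁) ^ p := one_le_pow₀ h2L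
  set K : ℝ := 4 * M * L * (2 * L₁) ^ p with hK
  have hMpos : 0 < M := by linarith
  have hLpos : 0 < L := by linarith
  have hK4 : 4 * M ≤ K := by
    rw [hK, mul_assoc]
    exact le_mul_of_one_le_right (by positivity) (one_le_mul_of_one_le_of_one_le hL.le hpow)
  have hK1 : 1 ≤ K := by linarith
  refine ⟨K, by linarith, by linarith, fun x r hr y hy W hWo hW i hi => ?_⟩
  rw [Metric.mem_ball] at hy
  set A : Set (Euc d) := (Metric.ball x (K ^ i * r))ᶜ with hA
  have hAm : MeasurableSet A := measurableSet_ball.compl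
  have hKi : K ≤ K ^ i := le_self_pow₀ hK1 (by omega)
  have hKir : 4 * M * r ≤ K ^ i * r := by gcongr; linarith
  have hsub : W ⊆ Metric.ball y (2 * M * r) := hW.trans (Metric.ball_subset_ball' (by
    rw [dist_comm]
    nlinarith))
  have hdisj : Disjoint A (Metric.ball y (2 * M * r)) :=
    Set.disjoint_left.2 fun a ha hb => ha (by
      rw [Metric.mem_ball] at hb ⊢
      have := dist_triangle a y x
      nlinarith)
  have := hX.isFiniteMeasure_harmonicMeasure (Metric.ball y (2 * M * r)) y
  have h1 : (harmonicMeasure X P W y).real A ≤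
      (harmonicMeasure X P (Metric.ball y (2 * M * r)) y).real A :=
    ENNReal.toReal_mono (measure_ne_top _ _)
      (hX.harmonicMeasure_mono Metric.isOpen_ball hWo hsub y hAm hdisj)
  have h2 : (harmonicMeasure X P (Metric.ball y (2 * M * r)) y).real A ≤
      (harmonicMeasure X P (Metric.ball y (2 * M * r)) y).real
        (Metric.ball y (K ^ i * r / 2))ᶜ := by
    refine measureReal_mono (compl_subset_compl.2 (Metric.ball_subset_ball' ?_))
    nlinarith
  have hKpow : 4 * M * L * (2 * L₁) ^ (p * i) ≤ K ^ i := by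
    have hML : 1 ≤ 4 * M * L := by nlinarith
    rw [hK, mul_pow _ _ i, ← pow_mul]
    exact mul_le_mul_of_nonneg_right (le_self_pow₀ hML (by omega)) (by positivity)
  have h3 := harmonicMeasure_tail hX hC hL hJ hL₁ hη₁ hE y (p * i) (2 * M * r) (K ^ i * r / 2)
    (by positivity) (by
      have := mul_le_mul_of_nonneg_right hKpow hr.le
      linarith)
  have hθi : (1 / θ) ^ i ≤ (1 + η₁ / C) ^ (p * i) := by
    rw [pow_mul]
    gcongr
  refine h1.trans (h2.trans ?_)
  set m := (harmonicMeasure X P (Metric.ball y (2 * M * r)) y).real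
    (Metric.ball y (K ^ i * r / 2))ᶜ with hm
  have hm0 : 0 ≤ m := measureReal_nonneg
  have h4 : (1 / θ) ^ i * m ≤ 1 := (mul_le_mul_of_nonneg_right hθi hm0).trans h3
  rw [one_div, inv_pow, inv_mul_le_iff₀ (by positivity), mul_one] at h4
  exact h4

end Tails

/-! ### Harmonic functions with values in `[0, ∞]`. -/

section HarmonicFunctions

variable {d : ℕ} {Ω : Type*} [MeasurableSpace Ω] {X : ℝ≥0 → Ω → Euc d} {P : Measure Ω}
  {U V : Set (Euc d)} {H : Euc d → ℝ≥0∞}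

/-- Universal measurability for functions with values in `[0, ∞]`. -/
def UMeas (H : Euc d → ℝ≥0∞) : Prop :=
  ∀ μ : Measure (Euc d), IsFiniteMeasure μ → AEMeasurable H μ

/-- `H : ℝ^d → [0, ∞]` is harmonic on `U`. -/
structure Harm (X : ℝ≥0 → Ω → Euc d) (P : Measure Ω) (H : Euc d → ℝ≥0∞) (U : Set (Euc d)) :
    Prop where
  umeas : UMeas H
  lintegral_eq : ∀ V : Set (Euc d), IsOpen V → closure V ⊆ U → ∀ x,
    ∫⁻ y, H y ∂(harmonicMeasure X P V x) = H x

lemma UniversallyMeasurable.aemeasurable {h : Euc d → ℝ} (hh : UniversallyMeasurable h)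
    (μ : Measure (Euc d)) [IsFiniteMeasure μ] : AEMeasurable h μ :=
  (hh μ inferInstance).aemeasurable

lemma UniversallyMeasurable.umeas_ofReal {h : Euc d → ℝ} (hh : UniversallyMeasurable h) :
    UMeas fun y => ENNReal.ofReal (h y) :=
  fun μ _ => (hh.aemeasurable μ).ennreal_ofReal

lemma UMeas.toReal (hH : UMeas H) : UniversallyMeasurable fun y => (H y).toReal :=
  fun μ _ => (hH μ inferInstance).ennreal_toReal.nullMeasurable

lemma IsHarmonicOn.harm (hX : IsLevyProcess X P) {h : Euc d → ℝ} (hh : IsHarmonicOn X P h U)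
    (h0 : ∀ z, 0 ≤ h z) : Harm X P (fun y => ENNReal.ofReal (h y)) U := by
  refine ⟨hh.1.umeas_ofReal, fun V hV hVU x => ?_⟩
  by_cases hx : x ∈ V
  · obtain ⟨h1, h2⟩ := hh.2 V hV hVU x hx
    rw [← ofReal_integral_eq_lintegral_ofReal h1 (ae_of_all _ h0), h2]
  · rw [hX.harmonicMeasure_of_notMem hV hx, lintegral_dirac]

lemma lintegral_harmonicMeasure_bind (hX : IsLevyProcess X P) (hU : IsOpen U) (hV : IsOpen V)
    (hVU : V ⊆ U) (hH : UMeas H) (x : Euc d) :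
    ∫⁻ y, ∫⁻ z, H z ∂(harmonicMeasure X P U y) ∂(harmonicMeasure X P V x) =
      ∫⁻ z, H z ∂(harmonicMeasure X P U x) := by
  have := hX.isFiniteMeasure_harmonicMeasure U x
  rw [← hX.bind_harmonicMeasure hU hV hVU x, Measure.lintegral_bind
    (hX.measurable_harmonicMeasure hU).aemeasurable]
  rw [hX.bind_harmonicMeasure hU hV hVU x]
  exact hH _ inferInstance

/-- Integration with respect to the harmonic measures of `U` yields harmonic functions on `U`. -/
lemma UMeas.harm_lintegral (hX : IsLevyProcess X P) (hU : IsOpen U) (hH : UMeas H) :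
    Harm X P (fun y => ∫⁻ z, H z ∂(harmonicMeasure X P U y)) U := by
  refine ⟨fun μ _ => ?_, fun V hV hVU x =>
    lintegral_harmonicMeasure_bind hX hU hV (subset_closure.trans hVU) hH x⟩
  have hκ := hX.measurable_harmonicMeasure hU
  -- Universal measurability is used for the mixture of the harmonic measures under `μ`: a Borel
  -- version of `H` for the mixture is a version for `μ`-almost every harmonic measure.
  have hfin : IsFiniteMeasure (μ.bind (harmonicMeasure X P U)) := by
    refine ⟨?_⟩
    rw [Measure.bind_apply MeasurableSet.univ hκ.aemeasurable]
    calc _ ≤ ∫⁻ _, 1 ∂μ := lintegral_mono fun y => hX.harmonicMeasure_univ_le_one hU y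
      _ < ⊤ := by simp [measure_lt_top]
  obtain ⟨H', hH', hae⟩ := hH _ hfin
  refine ⟨fun y => ∫⁻ z, H' z ∂(harmonicMeasure X P U y),
    (Measure.measurable_lintegral hH').comp hκ, ?_⟩
  filter_upwards [Measure.ae_ae_of_ae_bind hκ.aemeasurable hae] with y hy
  exact lintegral_congr_ae hy

lemma Harm.isHarmonicOn (hX : IsLevyProcess X P) (hH : Harm X P H U) {B : ℝ≥0}
    (hB : ∀ z, H z ≤ B) : IsHarmonicOn X P (fun y => (H y).toReal) U := by
  refine ⟨hH.umeas.toReal, fun V hV hVU x _ => ?_⟩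
  have := hX.isFiniteMeasure_harmonicMeasure V x
  have hm := hH.umeas (harmonicMeasure X P V x) inferInstance
  have hlt : ∀ z, H z < ⊤ := fun z => (hB z).trans_lt ENNReal.coe_lt_top
  refine ⟨integrable_toReal_of_lintegral_ne_top hm ?_, ?_⟩
  · rw [hH.lintegral_eq V hV hVU x]
    exact (hlt x).ne
  · rw [integral_toReal hm (ae_of_all _ hlt), hH.lintegral_eq V hV hVU x]

end HarmonicFunctions

/-! ### The Harnack inequality. -/

section Harnack

variable {d : ℕ} {Ω : Type*} [MeasurableSpace Ω] {X : ℝ≥0 → Ω → Euc d} {P : Measure Ω}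
  {φ : ℝ → ℝ} {M η b L C : ℝ} {H : Euc d → ℝ≥0∞}

/-- With equal radii, the estimate bounds a probability from below by `η`. -/
lemma HittingEstimate.le_one (hX : IsLevyProcess X P) (hφ : IsScale φ b)
    (hH : HittingEstimate X P φ M η) : η ≤ 1 := by
  obtain ⟨A, hA, -, -, hhit⟩ := hH (0 : Euc d) 1 one_pos univ fun _ _ => nullMeasurableSet_univ
  have h1 := hhit 0 1 le_rfl one_pos 0 (Metric.mem_ball_self one_pos)
  have h2 : (harmonicMeasure X P (Metric.ball 0 (M * 1) \ A) 0).real A ≤ 1 :=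
    ENNReal.toReal_le_of_le_ofReal zero_le_one (by
      simpa using hX.harmonicMeasure_le_one (Metric.isOpen_ball.sdiff hA.isClosed) 0 A)
  have hp := hφ.pos 1 one_pos
  nlinarith

lemma IsScale.le_half_pow (hφ : IsScale φ b) (m : ℕ) {ρ : ℝ} (hρ : 0 < ρ) :
    φ ((1 / 2) ^ m * ρ) ≤ b ^ m * φ ρ := by
  have hb := hφ.one_le
  induction m with
  | zero => simp
  | succ m ih =>
    calc φ ((1 / 2) ^ (m + 1) * ρ) = φ ((1 / 2) ^ m * ρ / 2) := by ring_nf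
      _ ≤ b * φ ((1 / 2) ^ m * ρ) := hφ.doubling _ (by positivity)
      _ ≤ b * (b ^ m * φ ρ) := by gcongr
      _ = b ^ (m + 1) * φ ρ := by ring

/-- A scale grows slowly along a suitable geometric sequence of radii. -/
lemma IsScale.exists_ratio (hφ : IsScale φ b) {β : ℝ} (hβ : 1 < β) :
    ∃ q : ℝ, 0 < q ∧ q < 1 ∧ ∀ (ρ : ℝ) (j : ℕ), 0 < ρ → φ (q ^ j * ρ) ≤ b * β ^ j * φ ρ := by
  have hb := hφ.one_le
  -- With `q = 1 - 1/(2p)`, Bernoulli's inequality gives `q ^ p ≥ 1/2`. So `p` factors `q` amount to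
  -- at most one halving, which costs `b < β ^ p`; the incomplete last block costs the extra factor
  -- `b`.
  obtain ⟨p, hp⟩ := pow_unbounded_of_one_lt b hβ
  have hp0 : p ≠ 0 := by
    rintro rfl
    rw [pow_zero] at hp
    linarith
  have hp1 : (1 : ℝ) ≤ p := by exact_mod_cast Nat.one_le_iff_ne_zero.2 hp0
  have hfrac : 1 / (2 * (p : ℝ)) ≤ 1 / 2 := by
    apply one_div_le_one_div_of_le <;> linarith
  have hfrac0 : 0 < 1 / (2 * (p : ℝ)) := by positivity
  set q : ℝ := 1 - 1 / (2 * (p : ℝ)) with hq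
  have hq0 : 0 < q := by linarith
  have hq1 : q < 1 := by linarith
  have hqp : 1 / 2 ≤ q ^ p := by
    have := one_add_mul_le_pow (a := -(1 / (2 * (p : ℝ)))) (by linarith) p
    rw [← sub_eq_add_neg, ← hq] at this
    refine le_trans (le_of_eq ?_) this
    field_simp
    norm_num
  refine ⟨q, hq0, hq1, fun ρ j hρ => ?_⟩
  have hpρ := hφ.pos ρ hρ
  have hj : j ≤ p * (j / p + 1) := by
    have := Nat.lt_mul_div_succ j (Nat.pos_of_ne_zero hp0)
    exact this.le
  calc φ (q ^ j * ρ) ≤ φ ((1 / 2) ^ (j / p + 1) * ρ) := by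
        refine hφ.anti _ _ (by positivity) ?_
        gcongr
        calc (1 / 2 : ℝ) ^ (j / p + 1) ≤ (q ^ p) ^ (j / p + 1) := by gcongr
          _ = q ^ (p * (j / p + 1)) := by rw [pow_mul]
          _ ≤ q ^ j := pow_le_pow_of_le_one hq0.le hq1.le hj
    _ ≤ b ^ (j / p + 1) * φ ρ := hφ.le_half_pow _ hρ
    _ ≤ b * β ^ j * φ ρ := by
        gcongr
        rw [pow_succ, mul_comm]
        gcongr
        calc b ^ (j / p) ≤ (β ^ p) ^ (j / p) := by gcongr
          _ = β ^ (p * (j / p)) := by rw [pow_mul]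
          _ ≤ β ^ j := pow_le_pow_right₀ hβ.le (Nat.mul_div_le j p)

/-- If a harmonic function is large at `y` compared with its value at `y₀`, then it is even larger
at a point close to `y`. -/
lemma Harm.exists_growth (hX : IsLevyProcess X P) (hM : 1 < M) (hη : 0 < η) (hC : 1 ≤ C)
    (hL : 1 < L) (hJ : JumpEstimate X P L C) (hφ : IsScale φ b) (hHE : HittingEstimate X P φ M η)
    {x₀ y₀ y : Euc d} {R r t v : ℝ} (hr : 0 < r) (hv : 0 < v)
    (hH : Harm X P H (Metric.ball x₀ (4 * M * R))) (hy₀ : y₀ ∈ Metric.ball x₀ R)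
    (hy₀t : H y₀ < ENNReal.ofReal t) (hyr : dist y x₀ + r ≤ R) (hyv : ENNReal.ofReal v ≤ H y)
    (ht : t * φ r ≤ η / (4 * (1 + C)) * v * (η * φ R)) :
    ∃ y' ∈ Metric.ball y (L * (M + 1) * r), ENNReal.ofReal ((1 + η / 2) * v) ≤ H y' := by
  set ζ : ℝ := η / (4 * (1 + C)) with hζ
  have hCpos : 0 < C := by linarith
  have hζpos : 0 < ζ := by positivity
  have hη1 := hHE.le_one hX hφ
  have hR : 0 < R := by linarith [dist_nonneg (x := y) (y := x₀)]
  have hd0 := dist_nonneg (x := y) (y := x₀)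
  have hrR : r ≤ R := by linarith
  have hMR : 0 < M * R := by positivity
  have hMrR : M * r ≤ M * R := by gcongr
  have hsubR : Metric.ball y r ⊆ Metric.ball x₀ R := Metric.ball_subset_ball' (by linarith)
  -- If `A` were in this set, hitting `A` from `y₀` would already force `H y₀ ≥ t`.
  obtain ⟨A, hA, hAb, hAS, hhit⟩ := hHE y r hr {z | ENNReal.ofReal (ζ * v) ≤ H z} fun μ _ =>
    (hH.umeas μ inferInstance).nullMeasurable measurableSet_Ici
  rcases hAS with hAS | hAS
  · exfalso
    have h1 := hhit x₀ R hsubR hR y₀ hy₀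
    set W : Set (Euc d) := Metric.ball x₀ (M * R) \ A with hW
    have hWo : IsOpen W := Metric.isOpen_ball.sdiff hA.isClosed
    have hcl : closure W ⊆ Metric.ball x₀ (4 * M * R) :=
      (closure_mono sdiff_subset).trans (Metric.closure_ball_subset_closedBall.trans
        (Metric.closedBall_subset_ball (by linarith)))
    have h2 : ENNReal.ofReal (ζ * v) * harmonicMeasure X P W y₀ A < ENNReal.ofReal t := by
      refine lt_of_le_of_lt ?_ hy₀t
      rw [← hH.lintegral_eq W hWo hcl y₀, ← lintegral_indicator_const hA.measurableSet]
      refine lintegral_mono fun z => ?_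
      by_cases hz : z ∈ A
      · rw [indicator_of_mem hz]
        exact hAS hz
      · rw [indicator_of_notMem hz]
        exact zero_le
    have := hX.isFiniteMeasure_harmonicMeasure W y₀
    rw [← ENNReal.ofReal_toReal (measure_ne_top (harmonicMeasure X P W y₀) A),
      ← ENNReal.ofReal_mul (by positivity)] at h2
    have h3 : ζ * v * (harmonicMeasure X P W y₀).real A < t := (ENNReal.ofReal_lt_ofReal_iff'.1 h2).1
    have hp := hφ.pos r hr
    have h4 : ζ * v * (η * φ R) ≤ ζ * v * (φ r * (harmonicMeasure X P W y₀).real A) := by gcongr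
    nlinarith
  · by_contra! hcon
    have h1 := hhit y r le_rfl hr y (Metric.mem_ball_self hr)
    set W : Set (Euc d) := Metric.ball y (M * r) \ A with hW
    have hWo : IsOpen W := Metric.isOpen_ball.sdiff hA.isClosed
    have hcl : closure W ⊆ Metric.ball x₀ (4 * M * R) :=
      (closure_mono sdiff_subset).trans (Metric.closure_ball_subset_closedBall.trans
        ((Metric.closedBall_subset_closedBall' (by linarith)).trans
          (Metric.closedBall_subset_ball (show M * R + R < 4 * M * R by nlinarith))))
    have := hX.isFiniteMeasure_harmonicMeasure W y
    set μ := harmonicMeasure X P W y with hμ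
    have hμA : η ≤ μ.real A := by
      have hp := hφ.pos r hr
      nlinarith
    have hμ1 : μ univ ≤ 1 := hX.harmonicMeasure_univ_le_one hWo y
    have hμA1 : μ.real A ≤ 1 :=
      ENNReal.toReal_le_of_le_ofReal zero_le_one
        (by simpa using (measure_mono (subset_univ A)).trans hμ1)
    have hAne : A.Nonempty := by
      rw [nonempty_iff_ne_empty]
      rintro rfl
      simp at hμA
      linarith
    obtain ⟨z, hz⟩ := hAne
    have hzv : H z ≤ ENNReal.ofReal (ζ * v) := le_of_lt (not_le.1 (hAS hz))
    have hzr := hAb hz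
    rw [Metric.mem_ball] at hzr
    set D : Set (Euc d) := (Metric.ball y (L * ((M + 1) * r)))ᶜ with hD
    have hDm : MeasurableSet D := measurableSet_ball.compl
    have hAD : A ⊆ Metric.ball y (L * ((M + 1) * r)) :=
      hAb.trans (Metric.ball_subset_ball (by nlinarith [mul_pos (by linarith : 0 < M) hr]))
    have hMr : 0 < M * r := by positivity
    have hclz : closure (Metric.ball z (M * r)) ⊆ Metric.ball x₀ (4 * M * R) :=
      Metric.closure_ball_subset_closedBall.trans
        ((Metric.closedBall_subset_closedBall' (ε₂ := M * R + R) (by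
          have := dist_triangle z y x₀
          linarith)).trans
          (Metric.closedBall_subset_ball (show M * R + R < 4 * M * R by nlinarith)))
    -- Far away, `μ` is dominated by `C` times the exit distribution of a ball about a point `z` of
    -- `A`, where `H` is small. Hence large jumps contribute at most `C ζ v`.
    have hfar : ∫⁻ w in D, H w ∂μ ≤ ENNReal.ofReal C * H z := by
      rw [← hH.lintegral_eq _ Metric.isOpen_ball hclz z, ← smul_eq_mul, ← lintegral_smul_measure]
      refine lintegral_mono' (Measure.le_iff.2 fun E hE => ?_) le_rfl
      rw [Measure.restrict_apply hE, Measure.smul_apply, smul_eq_mul]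
      have hdisj : Disjoint (E ∩ D) (Metric.ball y (L * ((M + 1) * r))) :=
        disjoint_compl_left.mono_left inter_subset_right
      have hdisj' : Disjoint (E ∩ D) (Metric.ball y (M * r)) :=
        hdisj.mono_right (Metric.ball_subset_ball (by nlinarith))
      calc μ (E ∩ D) ≤ harmonicMeasure X P (Metric.ball y (M * r)) y (E ∩ D) :=
            hX.harmonicMeasure_mono Metric.isOpen_ball hWo sdiff_subset y (hE.inter hDm) hdisj'
        _ ≤ ENNReal.ofReal C * harmonicMeasure X P (Metric.ball z (M * r)) z (E ∩ D) :=
            hJ y y z ((M + 1) * r) (M * r) (M * r) hMr le_rfl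
              (Metric.ball_subset_ball (by linarith)) (Metric.ball_subset_ball' (by linarith))
              _ (hE.inter hDm) hdisj
        _ ≤ _ := by gcongr; exact inter_subset_left
    set β : ℝ := 1 + η / 2 with hβ
    have hmeas : Measurable fun w => A.indicator (fun _ => ENNReal.ofReal (ζ * v)) w +
        Aᶜ.indicator (fun _ => ENNReal.ofReal (β * v)) w :=
      (measurable_const.indicator hA.measurableSet).add
        (measurable_const.indicator hA.measurableSet.compl)
    have hmain : H y ≤ ENNReal.ofReal (ζ * v) * μ A + ENNReal.ofReal (β * v) * μ Aᶜ +
        ∫⁻ w in D, H w ∂μ := by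
      rw [← hH.lintegral_eq W hWo hcl y, ← lintegral_indicator_const hA.measurableSet,
        ← lintegral_indicator_const hA.measurableSet.compl, ← lintegral_indicator hDm,
        ← lintegral_add_left (measurable_const.indicator hA.measurableSet), ← lintegral_add_left hmeas]
      refine lintegral_mono fun w => ?_
      by_cases hwA : w ∈ A
      · rw [indicator_of_mem hwA, add_assoc]
        exact le_add_right (le_of_lt (not_le.1 (hAS hwA)))
      by_cases hwD : w ∈ D
      · rw [indicator_of_mem hwD]
        exact le_add_left le_rfl
      · rw [indicator_of_notMem hwA, indicator_of_mem (show w ∈ Aᶜ from hwA), zero_add]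
        refine le_add_right (hcon w ?_).le
        rw [mul_assoc]
        exact not_not.1 hwD
    have hAc : μ Aᶜ ≤ ENNReal.ofReal (1 - η) := by
      rw [measure_compl hA.measurableSet (measure_ne_top _ _)]
      calc μ univ - μ A ≤ 1 - ENNReal.ofReal η := by
            gcongr
            rw [← ENNReal.ofReal_toReal (measure_ne_top μ A)]
            exact ENNReal.ofReal_le_ofReal hμA
        _ = ENNReal.ofReal (1 - η) := by
            rw [ENNReal.ofReal_sub _ hη.le, ENNReal.ofReal_one]
    have hfinal : ENNReal.ofReal v ≤ ENNReal.ofReal (ζ * v + β * v * (1 - η) + C * (ζ * v)) := by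
      have hnn : 0 ≤ β * v * (1 - η) := mul_nonneg (by positivity) (by linarith)
      rw [ENNReal.ofReal_add (by positivity) (by positivity), ENNReal.ofReal_add (by positivity) hnn,
        ENNReal.ofReal_mul (p := β * v) (by positivity), ENNReal.ofReal_mul (p := C) hCpos.le]
      refine (hyv.trans hmain).trans ?_
      gcongr
      · exact mul_le_of_le_one_right zero_le ((measure_mono (subset_univ A)).trans hμ1)
      · exact hfar.trans (by gcongr)
    rw [ENNReal.ofReal_le_ofReal_iff (by
      have : 0 ≤ β * v * (1 - η) := mul_nonneg (by positivity) (by linarith)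
      positivity)] at hfinal
    have hζC : ζ * (1 + C) = η / 4 := by
      rw [hζ]
      field_simp
    have h5 : ζ * v + β * v * (1 - η) + C * (ζ * v) = (ζ * (1 + C) + β * (1 - η)) * v := by ring
    rw [h5, hζC] at hfinal
    -- Here `η/4` is the share of `A` and of the large jumps, by the choice of `ζ`; on the rest, of
    -- mass at most `1 - η`, the function was assumed to be below `βv`.
    have h6 : η / 4 + β * (1 - η) < 1 := by
      rw [hβ]
      nlinarith
    nlinarith

/-- The Harnack inequality for bounded harmonic functions. -/
theorem exists_harnack_bounded (hX : IsLevyProcess X P) (hM : 1 < M) (hη : 0 < η) (hC : 1 ≤ C)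
    (hL : 1 < L) (hJ : JumpEstimate X P L C) (hφ : IsScale φ b)
    (hHE : HittingEstimate X P φ M η) :
    ∃ α K : ℝ, 0 < α ∧ α < 1 / 2 ∧ 1 ≤ K ∧ ∀ (x₀ : Euc d) (R : ℝ), 0 < R →
      ∀ H : Euc d → ℝ≥0∞, Harm X P H (Metric.ball x₀ R) → (∃ B : ℝ≥0, ∀ z, H z ≤ B) →
      ∀ y ∈ Metric.ball x₀ (α * R), ∀ y₀ ∈ Metric.ball x₀ (α * R),
        H y ≤ ENNReal.ofReal K * H y₀ := by
  have hb := hφ.one_le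
  set β : ℝ := 1 + η / 2 with hβ
  have hβ1 : 1 < β := by rw [hβ]; linarith
  obtain ⟨q, hq0, hq1, hq⟩ := hφ.exists_ratio hβ1
  set Λ : ℝ := L * (M + 1) with hΛ
  have hΛ1 : 1 ≤ Λ := by nlinarith
  -- The first radius is `t₀ρ`; this choice keeps the total displacement `Λ t₀ρ / (1 - q)` below
  -- `ρ/4`. A power of `1/2` is taken so that the doubling property bounds its cost by `b ^ m`.
  obtain ⟨m, hm⟩ := exists_pow_lt_of_lt_one (show 0 < (1 - q) / (4 * Λ) by
    have : 0 < 1 - q := by linarith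
    positivity) (show (1 / 2 : ℝ) < 1 by norm_num)
  set t₀ : ℝ := (1 / 2) ^ m with ht₀
  have ht₀pos : 0 < t₀ := by positivity
  set ζ : ℝ := η / (4 * (1 + C)) with hζ
  have hζpos : 0 < ζ := by
    have : 0 < C := by linarith
    positivity
  have hη1 := hHE.le_one hX hφ
  set K : ℝ := b * b ^ m / (ζ * η) with hK
  have hbm : 1 ≤ b * b ^ m := one_le_mul_of_one_le_of_one_le hb (one_le_pow₀ hb)
  have hζ1 : ζ ≤ 1 := by
    rw [hζ, div_le_one (by linarith)]
    linarith
  have hK1 : 1 ≤ K := by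
    rw [hK, one_le_div (by positivity)]
    nlinarith
  have hKpos : 0 < K := by linarith
  have hMpos : 0 < M := by linarith
  refine ⟨1 / (8 * M), K, by positivity, ?_, hK1, fun x₀ R hR H hH ⟨B, hB⟩ y hy y₀ hy₀ => ?_⟩
  · rw [div_lt_div_iff₀ (by positivity) (by norm_num)]
    linarith
  by_contra! hlt
  obtain ⟨ρ, hρ⟩ : ∃ ρ : ℝ, ρ = R / (4 * M) := ⟨_, rfl⟩
  have hρ0 : 0 < ρ := by rw [hρ]; positivity
  have hRρ : R = 4 * M * ρ := by rw [hρ]; field_simp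
  have hαR : 1 / (8 * M) * R = ρ / 2 := by rw [hRρ]; field_simp; norm_num
  rw [hαR, Metric.mem_ball] at hy
  rw [hαR] at hy₀
  rw [hRρ] at hH
  have hdiv : H y₀ < H y / ENNReal.ofReal K := by
    rw [ENNReal.lt_div_iff_mul_lt (Or.inl (by simpa using hKpos)) (Or.inl ENNReal.ofReal_ne_top),
      mul_comm]
    exact hlt
  -- A positive real `t` between `H y₀` and `H y / K` serves even if `H y₀ = 0`.
  obtain ⟨t, ht1, ht2⟩ := ENNReal.lt_iff_exists_nnreal_btwn.1 hdiv
  have htpos : 0 < (t : ℝ) := by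
    have : (0 : ℝ≥0∞) < t := zero_le.trans_lt ht1
    exact_mod_cast this
  rw [← ENNReal.ofReal_coe_nnreal] at ht1
  have hyt : ENNReal.ofReal (K * t) ≤ H y := by
    rw [ENNReal.ofReal_mul hKpos.le, ENNReal.ofReal_coe_nnreal, mul_comm]
    exact (ENNReal.mul_lt_of_lt_div ht2).le
  have hgeom : ∀ j : ℕ, Λ * (t₀ * ρ) * (1 - q ^ j) / (1 - q) ≤ ρ / 4 * (1 - q ^ j) := by
    intro j
    have h1q : 0 < 1 - q := by linarith
    have hqj : 0 ≤ 1 - q ^ j := sub_nonneg.2 (pow_le_one₀ hq0.le hq1.le)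
    have h2 : t₀ * (4 * Λ) ≤ 1 - q := by
      rw [lt_div_iff₀ (by positivity)] at hm
      exact hm.le
    rw [div_le_iff₀ h1q]
    have h3 := mul_le_mul_of_nonneg_right h2 (mul_nonneg hρ0.le hqj)
    linarith
  -- The value gains a factor `β` at each step, while the radius shrinks by `q`, for which `φ` grows
  -- by `β` per step up to a constant. So the smallness condition of `Harm.exists_growth` persists;
  -- `K` is the constant that makes it hold.
  have chain : ∀ j : ℕ, ∃ z : Euc d, dist z y ≤ Λ * (t₀ * ρ) * (1 - q ^ j) / (1 - q) ∧
      ENNReal.ofReal (K * t * β ^ j) ≤ H z := by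
    intro j
    induction j with
    | zero => exact ⟨y, by simp, by simpa using hyt⟩
    | succ j ih =>
      obtain ⟨z, hz, hzv⟩ := ih
      have hqj0 : 0 < q ^ j := by positivity
      have hqj1 : q ^ j ≤ 1 := pow_le_one₀ hq0.le hq1.le
      have hpρ := hφ.pos ρ hρ0
      have h1q : 0 < 1 - q := by linarith
      have ht₀1 : t₀ ≤ 1 / 4 := by
        rw [lt_div_iff₀ (by positivity)] at hm
        nlinarith
      obtain ⟨z', hz', hzv'⟩ := hH.exists_growth hX hM hη hC hL hJ hφ hHE
        (y := z) (r := q ^ j * (t₀ * ρ)) (t := t) (v := K * t * β ^ j) (by positivity) (by positivity)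
        (Metric.ball_subset_ball (by linarith) hy₀) ht1 (by
          have h2 := dist_triangle z y x₀
          have h3 := hgeom j
          have h4 : q ^ j * (t₀ * ρ) ≤ 1 * (1 / 4 * ρ) := by gcongr
          nlinarith) hzv (by
          calc (t : ℝ) * φ (q ^ j * (t₀ * ρ)) ≤ t * (b * β ^ j * (b ^ m * φ ρ)) := by
                gcongr
                refine (hq _ j (by positivity)).trans ?_
                gcongr
                exact hφ.le_half_pow m hρ0
            _ = ζ * (K * t * β ^ j) * (η * φ ρ) := by
                rw [hK]
                field_simp)
      refine ⟨z', ?_, by rwa [pow_succ, ← mul_assoc, mul_comm _ β]⟩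
      rw [Metric.mem_ball] at hz'
      have h2 := dist_triangle z' z y
      have h3 : Λ * (t₀ * ρ) * (1 - q ^ (j + 1)) / (1 - q) =
          Λ * (t₀ * ρ) * (1 - q ^ j) / (1 - q) + Λ * (q ^ j * (t₀ * ρ)) := by
        field_simp
        ring
      rw [h3]
      linarith
  obtain ⟨j, hj⟩ := pow_unbounded_of_one_lt (B / (K * t)) hβ1
  obtain ⟨z, -, hz⟩ := chain j
  have h1 := hz.trans (hB z)
  rw [← ENNReal.ofReal_coe_nnreal] at h1
  replace h1 := (ENNReal.ofReal_le_ofReal_iff B.2).1 h1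
  rw [div_lt_iff₀ (by positivity), mul_comm] at hj
  exact absurd h1 (not_le.2 hj)

/-- The Harnack inequality. -/
theorem exists_harnack (hX : IsLevyProcess X P) (hM : 1 < M) (hη : 0 < η) (hC : 1 ≤ C)
    (hL : 1 < L) (hJ : JumpEstimate X P L C) (hφ : IsScale φ b)
    (hHE : HittingEstimate X P φ M η) :
    ∃ α K : ℝ, 0 < α ∧ α < 1 ∧ 1 ≤ K ∧ ∀ (x₀ : Euc d) (R : ℝ), 0 < R →
      ∀ H : Euc d → ℝ≥0∞, Harm X P H (Metric.ball x₀ R) →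
      ∀ y ∈ Metric.ball x₀ (α * R), ∀ y₀ ∈ Metric.ball x₀ (α * R),
        H y ≤ ENNReal.ofReal K * H y₀ := by
  obtain ⟨α, K, hα, hα2, hK, hbdd⟩ := exists_harnack_bounded hX hM hη hC hL hJ hφ hHE
  refine ⟨α / 2, K, by positivity, by linarith, hK, fun x₀ R hR H hH y hy y₀ hy₀ => ?_⟩
  set V : Set (Euc d) := Metric.ball x₀ (R / 2) with hV
  have hVo : IsOpen V := Metric.isOpen_ball
  have hcl : closure V ⊆ Metric.ball x₀ R := Metric.closure_ball_subset_closedBall.trans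
    (Metric.closedBall_subset_ball (by linarith))
  -- Truncations of `H` are not harmonic, but their integrals with respect to the harmonic measures
  -- of `V` are harmonic, bounded, and increase to `H`.
  have hmin : ∀ m : ℕ, UMeas fun z => min (H z) m := fun m μ _ =>
    (hH.umeas μ inferInstance).min aemeasurable_const
  rw [show α / 2 * R = α * (R / 2) by ring] at hy hy₀
  have hm : ∀ m : ℕ, ∫⁻ z, min (H z) m ∂(harmonicMeasure X P V y) ≤ ENNReal.ofReal K * H y₀ := by
    intro m
    refine (hbdd x₀ (R / 2) (by positivity) _ ((hmin m).harm_lintegral hX hVo) ⟨m, fun z => ?_⟩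
      y hy y₀ hy₀).trans ?_
    · calc ∫⁻ w, min (H w) m ∂(harmonicMeasure X P V z)
          ≤ ∫⁻ _, (m : ℝ≥0∞) ∂(harmonicMeasure X P V z) := lintegral_mono fun w => min_le_right _ _
        _ = m * harmonicMeasure X P V z univ := by rw [lintegral_const]
        _ ≤ ((m : ℝ≥0) : ℝ≥0∞) := by
          simpa using mul_le_of_le_one_right zero_le (hX.harmonicMeasure_univ_le_one hVo z)
    · rw [← hH.lintegral_eq V hVo hcl y₀]
      gcongr
      exact min_le_left _ _
  have hsup : H y = ⨆ m : ℕ, ∫⁻ z, min (H z) m ∂(harmonicMeasure X P V y) := by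
    have := hX.isFiniteMeasure_harmonicMeasure V y
    rw [← lintegral_iSup' (fun m => hmin m _ inferInstance)
      (ae_of_all _ fun z m m' hmm => min_le_min_left _ (by exact_mod_cast hmm)),
      ← hH.lintegral_eq V hVo hcl y]
    refine lintegral_congr fun z => ?_
    rw [← inf_iSup_eq, ENNReal.iSup_natCast, inf_top_eq]
  rw [hsup]
  exact iSup_le hm

end Harnack

/-! ### Hölder continuity of bounded harmonic functions. -/

section Hoelder

variable {d : ℕ} {Ω : Type*} [MeasurableSpace Ω] {X : ℝ≥0 → Ω → Euc d} {P : Measure Ω}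
  {φ : ℝ → ℝ} {M η b L C : ℝ}

/-- Convolution of two geometric sequences. -/
lemma sum_geom_mul_geom_le {s θ : ℝ} (hθ : 0 ≤ θ) (h : 2 * θ ≤ s) (k : ℕ) :
    ∑ j ∈ Finset.range (k + 1), s ^ j * θ ^ (k + 1 - j) ≤ 2 * θ * s ^ k := by
  have hs : 0 ≤ s := by linarith
  induction k with
  | zero => simp; linarith
  | succ k ih =>
    rw [Finset.sum_range_succ]
    have h1 : ∑ j ∈ Finset.range (k + 1), s ^ j * θ ^ (k + 1 + 1 - j) =
        θ * ∑ j ∈ Finset.range (k + 1), s ^ j * θ ^ (k + 1 - j) := by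
      rw [Finset.mul_sum]
      refine Finset.sum_congr rfl fun j hj => ?_
      have : k + 1 + 1 - j = (k + 1 - j) + 1 := by
        have := Finset.mem_range.1 hj
        omega
      rw [this]
      ring
    rw [h1, show k + 1 + 1 - (k + 1) = 1 by omega, pow_one]
    calc θ * ∑ j ∈ Finset.range (k + 1), s ^ j * θ ^ (k + 1 - j) + s ^ (k + 1) * θ
        ≤ θ * (s * s ^ k) + s ^ (k + 1) * θ := by
          gcongr
          exact ih.trans (by gcongr)
      _ = 2 * θ * s ^ (k + 1) := by ring

/-- Improvement of an upper bound from one ball to the next smaller one. -/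
lemma le_of_integral_eq {μ : Measure (Euc d)} (hμ : μ univ = 1) {f : Euc d → ℝ} {x y : Euc d}
    {K R S s θ l : ℝ} {k : ℕ} {A : Set (Euc d)} (hA : MeasurableSet A) (hS : 0 ≤ S)
    (hs : 1 / 2 ≤ s) (hsη : s = 1 - η / 4) (hθ : 0 ≤ θ) (hθη : θ = η / 16)
    (hfi : Integrable f μ) (hf : ∫ z, f z ∂μ = f y) (hμA : η ≤ μ.real A)
    (hfS : ∀ z, f z - f x ≤ 2 * S) (hfA : ∀ z ∈ A, f z ≤ l + S * s ^ k)
    (hfB : ∀ z ∈ Metric.ball x (R / K ^ k), f z ≤ l + 2 * S * s ^ k) (hfx : f x ≤ l + 2 * S * s ^ k)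
    (hosc : ∀ j ≤ k, ∀ z ∈ Metric.ball x (R / K ^ j), f z - f x ≤ 2 * S * s ^ j)
    (htail : ∀ j ≤ k, μ.real (Metric.ball x (R / K ^ j))ᶜ ≤ θ ^ (k + 1 - j)) :
    f y ≤ l + 2 * S * s ^ (k + 1) := by
  have hprob : IsProbabilityMeasure μ := ⟨hμ⟩
  have hs0 : 0 ≤ s := by linarith
  have hBm : ∀ j, MeasurableSet (Metric.ball x (R / K ^ j))ᶜ := fun j => measurableSet_ball.compl
  have hind : ∀ j, Integrable ((Metric.ball x (R / K ^ j))ᶜ.indicator fun _ => 4 * S * s ^ j) μ :=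
    fun j => (integrable_const _).indicator (hBm j)
  have hindA : Integrable (A.indicator fun _ => S * s ^ k) μ := (integrable_const _).indicator hA
  have hdiff : Integrable (fun w => l + 2 * S * s ^ k - A.indicator (fun _ => S * s ^ k) w) μ :=
    (integrable_const _).sub hindA
  have hsum : Integrable (fun w => ∑ j ∈ Finset.range (k + 1),
      (Metric.ball x (R / K ^ j))ᶜ.indicator (fun _ => 4 * S * s ^ j) w) μ :=
    integrable_finsetSum _ fun j _ => hind j
  -- Outside the ball of index `k`, look at the first index `j` whose ball misses `w`: the
  -- oscillation bound of index `j - 1` (the global one if `j = 0`) gives `f w - f x ≤ 4 S s ^ j`,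
  -- since `s ≥ 1/2`.
  have hpt : ∀ w, f w ≤ (l + 2 * S * s ^ k - A.indicator (fun _ => S * s ^ k) w) +
      ∑ j ∈ Finset.range (k + 1),
        (Metric.ball x (R / K ^ j))ᶜ.indicator (fun _ => 4 * S * s ^ j) w := by
    intro w
    have hnn : ∀ j ∈ Finset.range (k + 1),
        0 ≤ (Metric.ball x (R / K ^ j))ᶜ.indicator (fun _ => 4 * S * s ^ j) w :=
      fun j _ => indicator_nonneg (fun _ _ => by positivity) w
    have hsnn := Finset.sum_nonneg hnn
    by_cases hwA : w ∈ A
    · rw [indicator_of_mem hwA]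
      have := hfA w hwA
      linarith
    rw [indicator_of_notMem hwA]
    by_cases hwB : w ∈ Metric.ball x (R / K ^ k)
    · have := hfB w hwB
      linarith
    have hex : ∃ j, w ∉ Metric.ball x (R / K ^ j) := ⟨k, hwB⟩
    classical
    have hspec := Nat.find_spec hex
    have hlek : Nat.find hex ≤ k := Nat.find_min' hex hwB
    have hsingle := Finset.single_le_sum hnn (Finset.mem_range.2 (Nat.lt_succ_of_le hlek))
    rw [indicator_of_mem hspec] at hsingle
    suffices f w - f x ≤ 4 * S * s ^ Nat.find hex by linarith
    rcases hj : Nat.find hex with _ | i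
    · have := hfS w
      rw [pow_zero]
      linarith
    · have hi : w ∈ Metric.ball x (R / K ^ i) := not_not.1 (Nat.find_min hex (m := i) (by omega))
      have h1 := hosc i (by omega) w hi
      have h2 : 0 ≤ S * s ^ i := by positivity
      rw [pow_succ]
      nlinarith
  have hint := integral_mono hfi (hdiff.add hsum) hpt
  have e1 : ∫ w, ((l + 2 * S * s ^ k - A.indicator (fun _ => S * s ^ k) w) +
      ∑ j ∈ Finset.range (k + 1),
        (Metric.ball x (R / K ^ j))ᶜ.indicator (fun _ => 4 * S * s ^ j) w) ∂μ =
      (l + 2 * S * s ^ k - μ.real A * (S * s ^ k)) + ∑ j ∈ Finset.range (k + 1),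
        μ.real (Metric.ball x (R / K ^ j))ᶜ * (4 * S * s ^ j) := by
    rw [integral_add hdiff hsum,
      integral_sub (integrable_const _) hindA, integral_finsetSum _ fun j _ => hind j,
      integral_const, integral_indicator_const _ hA]
    simp [integral_indicator_const _ (hBm _)]
  have e2 : ∑ j ∈ Finset.range (k + 1), μ.real (Metric.ball x (R / K ^ j))ᶜ * (4 * S * s ^ j) ≤
      4 * S * (2 * θ * s ^ k) := by
    calc _ ≤ ∑ j ∈ Finset.range (k + 1), 4 * S * (s ^ j * θ ^ (k + 1 - j)) := by
          refine Finset.sum_le_sum fun j hj => ?_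
          have h1 := htail j (Nat.lt_succ_iff.1 (Finset.mem_range.1 hj))
          calc _ ≤ θ ^ (k + 1 - j) * (4 * S * s ^ j) := by gcongr
            _ = _ := by ring
      _ = 4 * S * ∑ j ∈ Finset.range (k + 1), s ^ j * θ ^ (k + 1 - j) := by rw [Finset.mul_sum]
      _ ≤ _ := by
        gcongr
        exact sum_geom_mul_geom_le hθ (by linarith) k
  have e3 : η * (S * s ^ k) ≤ μ.real A * (S * s ^ k) := by gcongr
  rw [hf] at hint
  refine hint.trans (e1.le.trans ?_)
  -- The set `A` gains `η S s ^ k`, and the tails lose `8θ S s ^ k`, half of that gain for `θ =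
  -- η/16`. The net gain is the one expressed by `s = 1 - η/4`.
  have e4 : 2 * S * s ^ (k + 1) =
      2 * S * s ^ k - η * (S * s ^ k) + 4 * S * (2 * θ * s ^ k) := by
    rw [pow_succ]
    nth_rw 2 [hsη]
    rw [hθη]
    ring
  linarith

/-- Hölder continuity of bounded harmonic functions. -/
theorem exists_hoelder (hX : IsLevyProcess X P) (hd : 1 ≤ d) (hM : 1 < M) (hη : 0 < η)
    (hC : 1 ≤ C) (hL : 1 < L) (hJ : JumpEstimate X P L C) (hφ : IsScale φ b)
    (hHE : HittingEstimate X P φ M η) :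
    ∃ β C' : ℝ, 0 < β ∧ β < 1 ∧ 1 ≤ C' ∧ ∀ (x : Euc d) (R : ℝ), 0 < R → ∀ (h : Euc d → ℝ),
      IsHarmonicOn X P h (Metric.ball x R) → ∀ S : ℝ, (∀ z, |h z| ≤ S) →
      ∀ y ∈ Metric.ball x R, |h y - h x| ≤ C' * S * (dist x y / R) ^ β := by
  have hη1 := hHE.le_one hX hφ
  obtain ⟨L₁, η₁, hL₁, hη₁, hE⟩ := exists_exit_near hX hd hM hη hφ hHE
  obtain ⟨θ, hθη⟩ : ∃ θ : ℝ, θ = η / 16 := ⟨_, rfl⟩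
  obtain ⟨s, hsη⟩ : ∃ s : ℝ, s = 1 - η / 4 := ⟨_, rfl⟩
  have hθ : 0 < θ := by rw [hθη]; positivity
  have hs : 3 / 4 ≤ s := by linarith
  have hs0 : 0 < s := by linarith
  have hs1 : s < 1 := by linarith
  obtain ⟨K, hK4, hMK, htail⟩ := exists_tail hX hM hC hL hJ hL₁ hη₁ hE hθ
  have hK0 : 0 < K := by linarith
  have hlogK : 0 < Real.log K := Real.log_pos (by linarith)
  have hosc : ∀ (x : Euc d) (R : ℝ), 0 < R → ∀ (h : Euc d → ℝ),
      IsHarmonicOn X P h (Metric.ball x R) → ∀ S : ℝ, (∀ z, |h z| ≤ S) → ∀ k : ℕ,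
      ∀ y ∈ Metric.ball x (R / K ^ k), ∀ z ∈ Metric.ball x (R / K ^ k),
        h y - h z ≤ 2 * S * s ^ k := by
    intro x R hR h hh S hS k
    have hS0 : 0 ≤ S := (abs_nonneg _).trans (hS x)
    have hS2 : ∀ y z, h y - h z ≤ 2 * S := fun y z => by
      have h1 := abs_le.1 (hS y)
      have h2 := abs_le.1 (hS z)
      linarith
    induction k using Nat.strong_induction_on with
    | _ k ih =>
      rcases k with _ | k
      · intro y _ z _
        simpa using hS2 y z
      set r : ℝ := R / K ^ (k + 1) with hr
      have hr0 : 0 < r := by positivity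
      have hrk : r ≤ R / K ^ k := by
        rw [hr]
        gcongr
        · linarith
        · omega
      have hrR : M * r < R := by
        have h1 : (1 : ℝ) ≤ K ^ k := one_le_pow₀ (by linarith)
        have h2 : K ^ (k + 1) * r = R := by rw [hr]; field_simp
        rw [pow_succ] at h2
        nlinarith [mul_pos hr0 hK0]
      have hxk : x ∈ Metric.ball x (R / K ^ k) := Metric.mem_ball_self (by positivity)
      have hbdd : BddAbove (h '' Metric.ball x (R / K ^ k)) :=
        ⟨S, by rintro _ ⟨z, -, rfl⟩; exact (abs_le.1 (hS z)).2⟩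
      set u : ℝ := sSup (h '' Metric.ball x (R / K ^ k)) with hu
      have hle : ∀ z ∈ Metric.ball x (R / K ^ k), h z ≤ u := fun z hz =>
        le_csSup hbdd (mem_image_of_mem _ hz)
      have hge : ∀ z ∈ Metric.ball x (R / K ^ k), u - 2 * S * s ^ k ≤ h z := by
        intro z hz
        rw [sub_le_iff_le_add]
        refine csSup_le ⟨_, mem_image_of_mem _ hxk⟩ ?_
        rintro _ ⟨w, hw, rfl⟩
        have := ih k (Nat.lt_succ_self k) w hw z hz
        linarith
      -- The level is the middle of the admissible range `[u - 2 S s ^ k, u]`. If `A` lies in the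
      -- lower half, the upper bound improves; otherwise the lower bound does, by the same lemma for
      -- `-h`.
      obtain ⟨A, hA, hAb, hAS, hhit⟩ := hHE x r hr0 {z | h z ≤ u - S * s ^ k} fun μ hμ =>
        hh.1 μ hμ measurableSet_Iic
      set W : Set (Euc d) := Metric.ball x (M * r) \ A with hW
      have hWo : IsOpen W := Metric.isOpen_ball.sdiff hA.isClosed
      have hcl : closure W ⊆ Metric.ball x R :=
        (closure_mono sdiff_subset).trans (Metric.closure_ball_subset_closedBall.trans
          (Metric.closedBall_subset_ball hrR))
      -- Full mass is essential: constants such as `l` must be reproduced when integrated.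
      have hmass : ∀ y, harmonicMeasure X P W y univ = 1 := fun y =>
        harmonicMeasure_univ_of_bounded hX hη₁ hE hWo (Metric.isBounded_ball.subset sdiff_subset) y
      have hμA : ∀ y ∈ Metric.ball x r, η ≤ (harmonicMeasure X P W y).real A := by
        intro y hy
        have h1 := hhit x r le_rfl hr0 y hy
        have hp := hφ.pos r hr0
        nlinarith
      have ht : ∀ y ∈ Metric.ball x r, ∀ j ≤ k,
          (harmonicMeasure X P W y).real (Metric.ball x (R / K ^ j))ᶜ ≤ θ ^ (k + 1 - j) := by
        intro y hy j hj
        have h1 := htail x r hr0 y hy W hWo sdiff_subset (k + 1 - j) (by omega)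
        have h2 : K ^ (k + 1 - j) * r = R / K ^ j := by
          rw [hr, eq_div_iff (by positivity)]
          have : K ^ (k + 1) = K ^ (k + 1 - j) * K ^ j := by
            rw [← pow_add]
            congr 1
            omega
          rw [this]
          field_simp
        rwa [h2] at h1
      have hval : ∀ y ∈ Metric.ball x r, Integrable h (harmonicMeasure X P W y) ∧
          ∫ z, h z ∂(harmonicMeasure X P W y) = h y := by
        intro y hy
        by_cases hyW : y ∈ W
        · exact hh.2 W hWo hcl y hyW
        · rw [hX.harmonicMeasure_of_notMem hWo hyW]
          exact ⟨integrable_dirac (by simp [enorm_lt_top]), integral_dirac _ _⟩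
      intro y hy z hz
      have hyk := Metric.ball_subset_ball hrk hy
      have hzk := Metric.ball_subset_ball hrk hz
      rcases hAS with hAS | hAS
      · have h1 := le_of_integral_eq (x := x) (hmass y) hA.measurableSet hS0 (by linarith) hsη hθ.le
          hθη (hval y hy).1 (hval y hy).2 (hμA y hy) (fun w => hS2 w x)
          (l := u - 2 * S * s ^ k) (fun w hw => (hAS hw).trans (by linarith))
          (fun w hw => (hle w hw).trans (by linarith)) ((hle x hxk).trans (by linarith))
          (fun j hj w hw => ih j (by omega) w hw x (Metric.mem_ball_self (by positivity))) (ht y hy)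
        have h2 := hge z hzk
        linarith
      · have h1 := le_of_integral_eq (f := fun w => -h w) (x := x) (hmass z) hA.measurableSet hS0
          (by linarith) hsη hθ.le hθη (hval z hz).1.neg
          ((integral_neg _).trans (congrArg Neg.neg (hval z hz).2)) (hμA z hz)
          (fun w => by have := hS2 x w; linarith)
          (l := -u) (fun w hw => by
            have : u - S * s ^ k < h w := not_le.1 (hAS hw)
            linarith)
          (fun w hw => by have := hge w hw; linarith) (by have := hge x hxk; linarith)
          (fun j hj w hw => by
            have := ih j (by omega) x (Metric.mem_ball_self (by positivity)) w hw
            linarith) (ht z hz)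
        have h2 := hle y hyk
        linarith
  have hβ0 : 0 < -Real.log s / Real.log K := by
    have := Real.log_neg hs0 hs1
    apply div_pos _ hlogK
    linarith
  -- The exponent satisfies `K ^ (-β) = s`. One factor `1/s` comes from rounding the distance to a
  -- power of `K⁻¹`, the other from passing to the next larger open ball, as the rounding is not
  -- strict at its upper end.
  refine ⟨-Real.log s / Real.log K, 2 / s ^ 2, hβ0, ?_, ?_, ?_⟩
  · rw [div_lt_one hlogK, ← Real.log_inv]
    apply Real.log_lt_log (by positivity)
    rw [inv_lt_comm₀ hs0 hK0]
    calc K⁻¹ ≤ 4⁻¹ := by gcongr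
      _ < s := by linarith
  · rw [one_le_div (by positivity)]
    nlinarith
  intro x R hR h hh S hS y hy
  have hS0 : 0 ≤ S := (abs_nonneg _).trans (hS x)
  rcases eq_or_ne x y with rfl | hxy
  · simp [Real.zero_rpow hβ0.ne']
  rw [Metric.mem_ball, dist_comm] at hy
  have hdpos := dist_pos.2 hxy
  obtain ⟨n, hn1, hn2⟩ := exists_nat_pow_near_of_lt_one (show 0 < dist x y / R by positivity)
    ((div_le_one hR).2 hy.le) (show 0 < K⁻¹ by positivity) (inv_lt_one_of_one_lt₀ (by linarith))
  have hKs : (K⁻¹) ^ (-Real.log s / Real.log K) = s := by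
    rw [Real.inv_rpow hK0.le, ← Real.rpow_neg hK0.le, Real.rpow_def_of_pos hK0,
      show Real.log K * -(-Real.log s / Real.log K) = Real.log s by field_simp, Real.exp_log hs0]
  have hsn : s ^ (n + 1) ≤ (dist x y / R) ^ (-Real.log s / Real.log K) := by
    calc s ^ (n + 1) = ((K⁻¹) ^ (n + 1)) ^ (-Real.log s / Real.log K) := by
          rw [← Real.rpow_natCast (K⁻¹), ← Real.rpow_mul (by positivity), mul_comm,
            Real.rpow_mul (by positivity), hKs, Real.rpow_natCast]
      _ ≤ _ := Real.rpow_le_rpow (by positivity) hn1.le hβ0.le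
  have hmain : |h y - h x| ≤ 2 * S * (s ^ n / s) := by
    rcases n with _ | n
    · have h1 := abs_le.1 (hS y)
      have h2 := abs_le.1 (hS x)
      have h3 : 2 * S ≤ 2 * S * (s ^ 0 / s) := by
        refine le_mul_of_one_le_right (by positivity) ?_
        rw [pow_zero, one_le_div hs0]
        exact hs1.le
      rw [abs_le]
      constructor <;> linarith
    · have hyb : y ∈ Metric.ball x (R / K ^ n) := by
        rw [Metric.mem_ball, dist_comm, ← div_lt_div_iff_of_pos_right hR]
        calc dist x y / R ≤ (K⁻¹) ^ (n + 1) := hn2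
          _ < (K⁻¹) ^ n := pow_lt_pow_right_of_lt_one₀ (by positivity)
            (inv_lt_one_of_one_lt₀ (by linarith)) (Nat.lt_succ_self n)
          _ = R / K ^ n / R := by
            rw [inv_pow]
            field_simp
      have hxb : x ∈ Metric.ball x (R / K ^ n) := Metric.mem_ball_self (by positivity)
      have e : s ^ (n + 1) / s = s ^ n := by rw [pow_succ]; field_simp
      rw [e, abs_le]
      have h1 := hosc x R hR h hh S hS n y hyb x hxb
      have h2 := hosc x R hR h hh S hS n x hxb y hyb
      constructor <;> linarith
  calc |h y - h x| ≤ 2 * S * (s ^ n / s) := hmain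
    _ = 2 / s ^ 2 * S * s ^ (n + 1) := by
      field_simp
      ring
    _ ≤ _ := by gcongr

end Hoelder

/-! ### Continuity of unbounded harmonic functions. -/

section Continuity

variable {d : ℕ} {Ω : Type*} [MeasurableSpace Ω] {X : ℝ≥0 → Ω → Euc d} {P : Measure Ω}

/-- Continuity of bounded harmonic functions together with the Harnack inequality implies
continuity of finite nonnegative harmonic functions of the form `∫ F dμ^V`. -/
lemma continuousAt_toReal_lintegral (hX : IsLevyProcess X P) {x : Euc d} {R α K : ℝ} (hR : 0 < R)
    (hα : 0 < α) (hα1 : α < 1)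
    (hHarnack : ∀ H : Euc d → ℝ≥0∞, Harm X P H (Metric.ball x R) →
      ∀ y ∈ Metric.ball x (α * R), ∀ y₀ ∈ Metric.ball x (α * R), H y ≤ ENNReal.ofReal K * H y₀)
    (hcont : ∀ (h : Euc d → ℝ) (S : ℝ), IsHarmonicOn X P h (Metric.ball x R) →
      (∀ z, |h z| ≤ S) → ContinuousAt h x)
    {F : Euc d → ℝ≥0∞} (hF : UMeas F) (hFtop : ∀ z, F z ≠ ⊤)
    (hfin : ∀ y ∈ Metric.ball x R, ∫⁻ z, F z ∂(harmonicMeasure X P (Metric.ball x R) y) ≠ ⊤) :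
    ContinuousAt (fun y => (∫⁻ z, F z ∂(harmonicMeasure X P (Metric.ball x R) y)).toReal) x := by
  set V : Set (Euc d) := Metric.ball x R with hV
  have hVo : IsOpen V := Metric.isOpen_ball
  set p : Euc d → ℝ≥0∞ := fun y => ∫⁻ z, F z ∂(harmonicMeasure X P V y) with hp
  set q : ℕ → Euc d → ℝ≥0∞ := fun m y => ∫⁻ z, min (F z) m ∂(harmonicMeasure X P V y) with hq
  set D : ℕ → Euc d → ℝ≥0∞ := fun m y =>
    ∫⁻ z, (F z - min (F z) m) ∂(harmonicMeasure X P V y) with hD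
  have hmin : ∀ m : ℕ, UMeas fun z => min (F z) m := fun m μ _ =>
    (hF μ inferInstance).min aemeasurable_const
  have hsub : ∀ m : ℕ, UMeas fun z => F z - min (F z) m := fun m μ _ =>
    (hF μ inferInstance).sub (hmin m μ inferInstance)
  have hsplit : ∀ m y, p y = q m y + D m y := by
    intro m y
    have := hX.isFiniteMeasure_harmonicMeasure V y
    rw [hp, hq, hD]
    dsimp only
    rw [← lintegral_add_left' (hmin m _ inferInstance)]
    exact lintegral_congr fun z => (add_tsub_cancel_of_le (min_le_left _ _)).symm
  have hxV : x ∈ V := Metric.mem_ball_self hR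
  have hqbd : ∀ m z, q m z ≤ ((m : ℝ≥0) : ℝ≥0∞) := by
    intro m z
    calc q m z ≤ ∫⁻ _, (m : ℝ≥0∞) ∂(harmonicMeasure X P V z) :=
          lintegral_mono fun w => min_le_right _ _
      _ = m * harmonicMeasure X P V z univ := by rw [lintegral_const]
      _ ≤ ((m : ℝ≥0) : ℝ≥0∞) := by
        simpa using mul_le_of_le_one_right zero_le (hX.harmonicMeasure_univ_le_one hVo z)
  have hqcont : ∀ m, ContinuousAt (fun y => (q m y).toReal) x := by
    intro m
    refine hcont _ (m : ℝ≥0) (((hmin m).harm_lintegral hX hVo).isHarmonicOn hX (hqbd m))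
      fun z => ?_
    rw [abs_of_nonneg ENNReal.toReal_nonneg]
    exact ENNReal.toReal_mono ENNReal.coe_ne_top (hqbd m z)
  have hDlim : Tendsto (fun m => D m x) atTop (𝓝 0) := by
    have := hX.isFiniteMeasure_harmonicMeasure V x
    rw [← lintegral_zero (μ := harmonicMeasure X P V x)]
    refine tendsto_lintegral_of_dominated_convergence' F (fun m => hsub m _ inferInstance)
      (fun m => ae_of_all _ fun z => tsub_le_self) (hfin x hxV) (ae_of_all _ fun z => ?_)
    obtain ⟨N, hN⟩ := ENNReal.exists_nat_gt (hFtop z)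
    refine tendsto_const_nhds.congr' ?_
    filter_upwards [eventually_ge_atTop N] with m hm
    rw [min_eq_left (hN.le.trans (by exact_mod_cast hm)), tsub_self]
  have hKlim : Tendsto (fun m => ENNReal.ofReal K * D m x) atTop (𝓝 0) := by
    simpa using ENNReal.Tendsto.const_mul hDlim (Or.inr ENNReal.ofReal_ne_top)
  rw [Metric.continuousAt_iff]
  intro ε hε
  have hε3 : (0 : ℝ≥0∞) < ENNReal.ofReal (ε / 3) := by simpa using hε
  obtain ⟨m, hm1, hm2⟩ := ((hDlim.eventually (gt_mem_nhds hε3)).and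
    (hKlim.eventually (gt_mem_nhds hε3))).exists
  obtain ⟨δ, hδ, hδq⟩ := Metric.continuousAt_iff.1 (hqcont m) (ε / 3) (by positivity)
  refine ⟨min δ (α * R), lt_min hδ (by positivity), fun {y} hy => ?_⟩
  have hyα : y ∈ Metric.ball x (α * R) := hy.trans_le (min_le_right _ _)
  have hyV : y ∈ V := Metric.ball_subset_ball (by nlinarith) hyα
  -- The remainder `D m` is again nonnegative and harmonic, so Harnack turns its smallness at `x`
  -- into smallness near `x`, where no domination is available.
  have hDy : D m y < ENNReal.ofReal (ε / 3) :=
    (hHarnack (D m) ((hsub m).harm_lintegral hX hVo) y hyα x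
      (Metric.mem_ball_self (by positivity))).trans_lt hm2
  have h1 := hδq (hy.trans_le (min_le_left _ _))
  have hreal : ∀ z, D m z < ENNReal.ofReal (ε / 3) →
      (p z).toReal = (q m z).toReal + (D m z).toReal ∧ (D m z).toReal < ε / 3 := by
    intro z hz
    refine ⟨?_, ?_⟩
    · rw [hsplit m z, ENNReal.toReal_add
        ((hqbd m z).trans_lt ENNReal.coe_lt_top).ne (ne_top_of_lt hz)]
    · rw [← ENNReal.toReal_ofReal (show 0 ≤ ε / 3 by positivity)]
      exact (ENNReal.toReal_lt_toReal (ne_top_of_lt hz) ENNReal.ofReal_ne_top).2 hz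
  obtain ⟨e1, l1⟩ := hreal y hDy
  obtain ⟨e2, l2⟩ := hreal x hm1
  rw [Real.dist_eq, abs_lt] at h1 ⊢
  have n1 : 0 ≤ (D m y).toReal := ENNReal.toReal_nonneg
  have n2 : 0 ≤ (D m x).toReal := ENNReal.toReal_nonneg
  constructor <;> linarith

end Continuity

end LevyHarnack

/-! ### The three assertions. -/

theorem theorem5p2 {d : ℕ} (hd : 1 ≤ d)
    {Ω : Type*} [MeasurableSpace Ω] (P : Measure Ω) (X : ℝ≥0 → Ω → Euc d)
    (hX : IsLevyProcess X P)
    (n : Euc d → ℝ≥0∞) (hn : Measurable n) (hsys : HasLevySystemDensity X P n)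
    (hnJ : ∃ (α : ℝ) (c_J : ℝ≥0), 0 < α ∧ α < 1 / 2 ∧ 1 ≤ c_J ∧
      ∀ y z : Euc d, ‖y‖ < 2 * α * ‖z‖ → n z ≤ c_J * n (z + y))
    (G : Euc d → Euc d → ℝ≥0∞) (hG : Measurable (fun p : Euc d × Euc d => G p.1 p.2))
    (hGpos : ∀ x y, 0 < G x y)
    (g : ℝ≥0 → ℝ≥0∞)
    (hG1 : PropertyG1 X P G) (hG2 : PropertyG2 G g) (hG3 : PropertyG3 G g) :
    (∃ α K : ℝ, 0 < α ∧ α < 1 ∧ 1 ≤ K ∧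
      ∀ (x : Euc d) (R : ℝ), 0 < R → ∀ h : Euc d → ℝ, IsHarmonicOn X P h (Metric.ball x R) →
        (∀ z, 0 ≤ h z) →
        ∀ y ∈ Metric.ball x (α * R), ∀ y' ∈ Metric.ball x (α * R), h y ≤ K * h y') ∧
    (∃ β C : ℝ, 0 < β ∧ β < 1 ∧ 1 ≤ C ∧
      ∀ (x : Euc d) (R : ℝ), 0 < R → ∀ h : Euc d → ℝ, IsHarmonicOn X P h (Metric.ball x R) →
        BddAbove (range fun z => |h z|) →
        ∀ y ∈ Metric.ball x R, |h y - h x| ≤ C * (⨆ z, |h z|) * (‖x - y‖ / R) ^ β) ∧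
    (∀ U : Set (Euc d), IsOpen U → ∀ h : Euc d → ℝ, IsHarmonicOn X P h U → ContinuousOn h U) := by
  obtain ⟨φ, M, η, b, hM, hη, hφ, hHE⟩ := exists_hittingEstimate hX hG hG1 hG2 hG3
  obtain ⟨L, C, hL, hC, hJ⟩ := exists_jumpEstimate hsys hnJ
  obtain ⟨α, K, hα, hα1, hK, hHar⟩ := exists_harnack hX hM hη hC hL hJ hφ hHE
  obtain ⟨β, C', hβ, hβ1, hC', hHol⟩ := exists_hoelder hX hd hM hη hC hL hJ hφ hHE
  refine ⟨⟨α, K, hα, hα1, hK, fun x R hR h hh h0 y hy y' hy' => ?_⟩,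
    ⟨β, C', hβ, hβ1, hC', fun x R hR h hh hbdd y hy => ?_⟩, fun U hU h hh x hx => ?_⟩
  · have h1 := hHar x R hR _ (hh.harm hX h0) y hy y' hy'
    rw [← ENNReal.ofReal_mul (by linarith)] at h1
    exact (ENNReal.ofReal_le_ofReal_iff (mul_nonneg (by linarith) (h0 y'))).1 h1
  · rw [← dist_eq_norm]
    exact hHol x R hR h hh _ (fun z => le_ciSup hbdd z) y hy
  · obtain ⟨R, hR, hRU⟩ := Metric.nhds_basis_closedBall.mem_iff.1 (hU.mem_nhds hx)
    have hcl : closure (Metric.ball x R) ⊆ U := Metric.closure_ball_subset_closedBall.trans hRU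
    have hbc : ∀ (f : Euc d → ℝ) (S : ℝ), IsHarmonicOn X P f (Metric.ball x R) →
        (∀ z, |f z| ≤ S) → ContinuousAt f x := by
      intro f S hf hS
      rw [ContinuousAt, tendsto_iff_dist_tendsto_zero]
      have hlim : Tendsto (fun y => C' * S * (dist x y / R) ^ β) (𝓝 x) (𝓝 0) := by
        have : ContinuousAt (fun y => C' * S * (dist x y / R) ^ β) x := by
          refine continuousAt_const.mul (ContinuousAt.rpow_const (by fun_prop) (Or.inr hβ.le))
        simpa [ContinuousAt, Real.zero_rpow hβ.ne'] using this
      refine squeeze_zero' (Eventually.of_forall fun _ => dist_nonneg) ?_ hlim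
      filter_upwards [Metric.ball_mem_nhds x hR] with y hy
      exact hHol x R hR f hf S hS y hy
    -- The positive and negative parts of `h` are not harmonic. Their integrals with respect to the
    -- exit distributions of the ball are, they are finite by integrability, and their difference is
    -- `h` on the ball.
    have hint := fun y hy => hh.2 _ Metric.isOpen_ball hcl y hy
    have hp := continuousAt_toReal_lintegral hX hR hα hα1 (hHar x R hR) hbc
      hh.1.umeas_ofReal (fun z => ENNReal.ofReal_ne_top)
      (fun y hy => (hint y hy).1.lintegral_lt_top.ne)
    have hn := continuousAt_toReal_lintegral hX hR hα hα1 (hHar x R hR) hbc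
      (F := fun z => ENNReal.ofReal (-h z))
      (fun μ _ => ((hh.1.aemeasurable μ).neg).ennreal_ofReal) (fun z => ENNReal.ofReal_ne_top)
      (fun y hy => (hint y hy).1.neg.lintegral_lt_top.ne)
    refine ((hp.sub hn).congr ?_).continuousWithinAt
    filter_upwards [Metric.ball_mem_nhds x hR] with y hy
    rw [← (hint y hy).2, integral_eq_lintegral_pos_part_sub_lintegral_neg_part (hint y hy).1]
    rfl
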